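/- Let $n\ge 1$ and let $M_{\rm ask}\subset\mathbb C^n$ be an open $\mathbb C^*$-invariant cone on which $Z^n\neq 0$, with a holomorphic prepotential $F$ on $M_{\rm ask}$, homogeneous of degree $2$. Put $F_{AB}=\partial_A\partial_BF$, $N_{AB}=\operatorname{Im}F_{AB}$, $(N^{AB})=(N_{AB})^{-1}$, and assume that $(M_{\rm ask},F)$ defines a projective special Kähler domain: $-2Z^AN_{AB}\bar Z^B>0$ on $M_{\rm ask}$ and $K(z)=-\ln(-2Z^AN_{AB}\bar Z^B)|_{Z=(z,1)}$ is the Kähler potential of a (positive definite) Kähler metric $K_{a\bar b}=\partial_a\partial_{\bar b}K$ on $M_{\rm sk}=\{z\in\mathbb C^{n-1}:(z,1)\in M_{\rm ask}\}$. Let $G=\mathbb R^{2n+2}$ with global coordinates $(\phi,\tilde\phi,a^A,b_A)$ (the Iwasawa subgroup of $\mathrm{SU}(1,n+1)$; only its manifold structure is used) and $M=M_{\rm sk}\times G$. Let $e^b=e_a{}^b\,dz^a$ be a smooth unitary coframe of $M_{\rm sk}$, i.e. $\sum_b e_a{}^b\,\overline{e_c{}^b}=K_{a\bar c}$, let $\Pi_A{}^b=(e_a{}^b,-z^ae_a{}^b)$,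 and, with $Z=(z,1)$, put $$u=i\,e^{K/2+\phi}Z^A(db_A-F_{AB}da^B),\qquad v=\tfrac12e^{2\phi}\big[de^{-2\phi}-i(d\tilde\phi+b_Ada^A-a^Adb_A)\big],$$ $$E^b=-\tfrac i2e^{\phi-K/2}\Pi_A{}^bN^{AB}(db_B-\bar F_{BC}da^C).$$ The c-map quaternionic Kähler structure on $M$ is given by $g=u\bar u+v\bar v+\sum_b(e^b\bar e^b+E^b\bar E^b)$ (where $\alpha\bar\alpha=\frac12(\alpha\otimes\bar\alpha+\bar\alpha\otimes\alpha)$) and by $Q=\mathrm{span}\{J_1,J_2,J_3\}$, where, for the $2\times 2n$ matrix of one-forms $$\mathcal U=\tfrac1{\sqrt2}\begin{pmatrix}\bar u&\bar e&-v&-E\\ \bar v&\bar E&u&e\end{pmatrix},$$ the $J_\alpha$ are the endomorphism fields determined by $\mathcal U^{\mathcal A k}\circ J_\alpha=-i(\sigma_\alpha)^{\mathcal A}{}_{\mathcal B}\,\mathcal U^{\mathcal Bk}$ with the Pauli matrices $\sigma_\alpha$. Then the $J_\alpha$ exist and are unique, and: 1. $J_3$ is an integrable almost complex structure on $M$ (around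 every point there are $J_3$-holomorphic coordinates), and $(g,J_3)$ is a Hermitian structure. 2. All factors $M_{\rm sk}\times\{y\}$ ($y\in G$) and $\{p\}\times G$ ($p\in M_{\rm sk}$) are complex submanifolds of $(M,J_3)$. 3. At every point of $M$, the restriction of $J_3$ to the first factor is the original complex structure $J$ (multiplication by $i$ in the coordinates $z$) of $M_{\rm sk}$. 4. For every $p\in M_{\rm sk}$, $(g,J_3)$ induces on $\{p\}\times G$ a Hermitian structure which is not Kähler. 5. For every $p\in M_{\rm sk}$, $\{p\}\times G$ with the metric induced by $g$ is isometric to the complex hyperbolic space $H_{\mathbb C}^{n+1}$ of constant holomorphic sectional curvature $-4$, i.e. to the unit ball $\{|w|<1\}\subset\mathbb C^{n+1}$ with the metric $\dfrac{|dw|^2}{1-|w|^2}+\dfrac{|\langle w,dw\rangle|^2}{(1-|w|^2)^2}$. -/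

import Mathlib

open scoped ContDiff ComplexConjugate ComplexOrder

/-! ## Complex, Hermitian and Kähler structures on open subsets of real normed spaces -/

section Geometry

variable {V W : Type*} [NormedAddCommGroup V] [NormedSpace ℝ V]
  [NormedAddCommGroup W] [NormedSpace ℝ W]

/-- A smooth almost complex structure on the open set `S`. -/
structure IsAlmostComplex (S : Set V) (J : V → V →L[ℝ] V) : Prop where
  smooth : ContDiffOn ℝ ∞ J S
  sq : ∀ x ∈ S, ∀ X, J x (J x X) = -X

/-- A `J`-holomorphic chart of `(S, J)` with values in `ℂ^d`: a diffeomorphism between open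
sets whose differential intertwines `J` and multiplication by the imaginary unit. -/
structure IsHolomorphicChart (S : Set V) (J : V → V →L[ℝ] V) {d : ℕ}
    (Ψ : OpenPartialHomeomorph V (Fin d → ℂ)) : Prop where
  source_subset : Ψ.source ⊆ S
  smooth : ContDiffOn ℝ ∞ Ψ Ψ.source
  smooth_symm : ContDiffOn ℝ ∞ Ψ.symm Ψ.target
  holomorphic : ∀ x ∈ Ψ.source, ∀ X,
    fderiv ℝ Ψ x (J x X) = Complex.I • fderiv ℝ Ψ x X

/-- The almost complex structure `J` on the open set `S` is integrable: it is the complex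
structure of a complex manifold, i.e. every point has a `J`-holomorphic chart. -/
structure IsIntegrableComplex (S : Set V) (J : V → V →L[ℝ] V) : Prop where
  almostComplex : IsAlmostComplex S J
  exists_chart : ∀ x ∈ S, ∃ (d : ℕ) (Ψ : OpenPartialHomeomorph V (Fin d → ℂ)),
    IsHolomorphicChart S J Ψ ∧ x ∈ Ψ.source

/-- `N` is a complex submanifold of the complex manifold `(S, J)`: around each of its points
there is a holomorphic chart in which `N` is a coordinate subspace. -/
def IsComplexSubmanifold (S : Set V) (J : V → V →L[ℝ] V) (N : Set V) : Prop :=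
  N ⊆ S ∧ ∀ x ∈ N, ∃ (d : ℕ) (Ψ : OpenPartialHomeomorph V (Fin d → ℂ)) (I : Set (Fin d)),
    IsHolomorphicChart S J Ψ ∧ x ∈ Ψ.source ∧
      ∀ y ∈ Ψ.source, y ∈ N ↔ ∀ i ∈ I, Ψ y i = 0

/-- A smooth Riemannian metric on the open set `S`. -/
structure IsRiemannianMetric (S : Set V) (g : V → V → V → ℝ) : Prop where
  smooth : ∀ X Y, ContDiffOn ℝ ∞ (fun x => g x X Y) S
  add_left : ∀ x ∈ S, ∀ X X' Y, g x (X + X') Y = g x X Y + g x X' Y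
  smul_left : ∀ x ∈ S, ∀ (c : ℝ) (X Y), g x (c • X) Y = c * g x X Y
  symm : ∀ x ∈ S, ∀ X Y, g x X Y = g x Y X
  pos : ∀ x ∈ S, ∀ X, X ≠ 0 → 0 < g x X X

/-- A Hermitian structure `(g, J)` (with integrable `J`) on the open set `S`. -/
structure IsHermitianStructure (S : Set V) (g : V → V → V → ℝ) (J : V → V →L[ℝ] V) :
    Prop where
  metric : IsRiemannianMetric S g
  integrable : IsIntegrableComplex S J
  compatible : ∀ x ∈ S, ∀ X Y, g x (J x X) (J x Y) = g x X Y

/-- The fundamental two-form `g(·, J·)`. -/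
def fundamentalForm (g : V → V → V → ℝ) (J : V → V →L[ℝ] V) (x X Y : V) : ℝ :=
  g x X (J x Y)

/-- The exterior derivative of a two-form, evaluated on constant vector fields. -/
noncomputable def extDerivTwoForm (θ : V → V → V → ℝ) (x X Y Z : V) : ℝ :=
  fderiv ℝ (fun y => θ y Y Z) x X + fderiv ℝ (fun y => θ y Z X) x Y
    + fderiv ℝ (fun y => θ y X Y) x Z

/-- A Kähler structure: a Hermitian structure with closed fundamental two-form. -/
structure IsKahlerStructure (S : Set V) (g : V → V → V → ℝ) (J : V → V →L[ℝ] V) :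
    Prop where
  hermitian : IsHermitianStructure S g J
  closed : ∀ x ∈ S, ∀ X Y Z, extDerivTwoForm (fundamentalForm g J) x X Y Z = 0

/-- The Riemannian manifolds `(S, g)` and `(T, h)` (open sets with metrics) are isometric. -/
def AreIsometric (S : Set V) (g : V → V → V → ℝ) (T : Set W) (h : W → W → W → ℝ) : Prop :=
  ∃ f : OpenPartialHomeomorph V W, f.source = S ∧ f.target = T ∧
    ContDiffOn ℝ ∞ f S ∧ ContDiffOn ℝ ∞ f.symm T ∧
    ∀ x ∈ S, ∀ X Y, h (f x) (fderiv ℝ f x X) (fderiv ℝ f x Y) = g x X Y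

end Geometry

/-- The metric of complex hyperbolic space in the unit ball model, normalised to constant
holomorphic sectional curvature `-4` (for `N = 1` it is `|dw|² / (1 - |w|²)²`). -/
noncomputable def complexHyperbolicMetric (N : ℕ) (w X Y : EuclideanSpace ℂ (Fin N)) : ℝ :=
  (inner ℂ X Y / ((1 - ‖w‖ ^ 2 : ℝ) : ℂ)
    + inner ℂ X w * inner ℂ w Y / ((1 - ‖w‖ ^ 2 : ℝ) : ℂ) ^ 2).re

/-! ## Projective special Kähler domains -/

section SpecialKahler

variable {m : ℕ}

/-- `∂_a f`, where `∂_a = (∂_{x^a} - i ∂_{y^a}) / 2`. -/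
noncomputable def wirtinger (a : Fin m) (f : (Fin m → ℂ) → ℂ) (z : Fin m → ℂ) : ℂ :=
  (fderiv ℝ f z (Pi.single a 1) - Complex.I * fderiv ℝ f z (Pi.single a Complex.I)) / 2

/-- `∂_{\bar a} f`, where `∂_{\bar a} = (∂_{x^a} + i ∂_{y^a}) / 2`. -/
noncomputable def wirtingerBar (a : Fin m) (f : (Fin m → ℂ) → ℂ) (z : Fin m → ℂ) : ℂ :=
  (fderiv ℝ f z (Pi.single a 1) + Complex.I * fderiv ℝ f z (Pi.single a Complex.I)) / 2

/-- The second holomorphic derivatives `F_{AB}` of the prepotential. -/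
noncomputable def prepotentialHessian (F : (Fin (m + 1) → ℂ) → ℂ) (Z : Fin (m + 1) → ℂ) :
    Matrix (Fin (m + 1)) (Fin (m + 1)) ℂ :=
  Matrix.of fun A B =>
    fderiv ℂ (fun Y => fderiv ℂ F Y (Pi.single B 1)) Z (Pi.single A 1)

/-- `N_{AB} = Im F_{AB}`. -/
noncomputable def imHessian (F : (Fin (m + 1) → ℂ) → ℂ) (Z : Fin (m + 1) → ℂ) :
    Matrix (Fin (m + 1)) (Fin (m + 1)) ℝ :=
  Matrix.of fun A B => (prepotentialHessian F Z A B).im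

/-- The real number `Z^A N_{AB} \bar Z^B`. -/
noncomputable def hermitianNorm (F : (Fin (m + 1) → ℂ) → ℂ) (Z : Fin (m + 1) → ℂ) : ℝ :=
  (∑ A, ∑ B, Z A * (imHessian F Z A B : ℂ) * conj (Z B)).re

/-- Homogeneous coordinates `(z, 1)` of the point with special coordinates `z`. -/
def homogeneous (z : Fin m → ℂ) : Fin (m + 1) → ℂ :=
  Fin.snoc (α := fun _ => ℂ) z 1

/-- The Kähler potential `K(z) = -log (-2 Z^A N_{AB} \bar Z^B)`, at `Z = (z, 1)`. -/
noncomputable def kahlerPotential (F : (Fin (m + 1) → ℂ) → ℂ) (z : Fin m → ℂ) : ℝ :=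
  -Real.log (-2 * hermitianNorm F (homogeneous z))

/-- The coefficients `K_{a \bar b} = ∂_a ∂_{\bar b} K`. -/
noncomputable def kahlerMetricMatrix (F : (Fin (m + 1) → ℂ) → ℂ) (z : Fin m → ℂ) :
    Matrix (Fin m) (Fin m) ℂ :=
  Matrix.of fun a b =>
    wirtinger a (wirtingerBar b (fun w => (kahlerPotential F w : ℂ))) z

/-- A projective special Kähler domain of complex dimension `m = n - 1`: an open
`ℂ^*`-invariant cone in `ℂ^n` on which the last coordinate does not vanish, with a holomorphic
prepotential `F` homogeneous of degree two, such that `-2 Z^A N_{AB} \bar Z^B > 0` on the cone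
and `K` is the potential of a Kähler metric on the projectivised cone. -/
structure ProjectiveSpecialKahlerDomain (m : ℕ) where
  cone : Set (Fin (m + 1) → ℂ)
  F : (Fin (m + 1) → ℂ) → ℂ
  isOpen_cone : IsOpen cone
  smul_mem : ∀ Z ∈ cone, ∀ c : ℂ, c ≠ 0 → c • Z ∈ cone
  last_ne_zero : ∀ Z ∈ cone, Z (Fin.last m) ≠ 0
  holomorphic : DifferentiableOn ℂ F cone
  homogeneous_two : ∀ Z ∈ cone, ∀ c : ℂ, c ≠ 0 → F (c • Z) = c ^ 2 * F Z
  norm_pos : ∀ Z ∈ cone, 0 < -2 * hermitianNorm F Z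
  metric_posDef : ∀ z, homogeneous z ∈ cone → (kahlerMetricMatrix F z).PosDef

end SpecialKahler

/-! ## The c-map -/

/-- The group `G`, in its global coordinates `(φ, φ', a, b)` (where `φ'` is written `\tilde φ`
in the formulas below), as a manifold. -/
abbrev FibreSpace (m : ℕ) : Type :=
  ℝ × ℝ × (Fin (m + 1) → ℝ) × (Fin (m + 1) → ℝ)

/-- The coordinate space `ℂ^(n-1) × G` containing `M = M_sk × G`. A point or tangent vector has
components `(z, φ, φ', a, b)`. -/
abbrev TotalSpace (m : ℕ) : Type := (Fin m → ℂ) × FibreSpace m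

namespace ProjectiveSpecialKahlerDomain

variable {m : ℕ} (D : ProjectiveSpecialKahlerDomain m)

/-- `M_sk`, as an open set of special coordinates `z`. -/
def base : Set (Fin m → ℂ) := {z | homogeneous z ∈ D.cone}

/-- `M = M_sk × G`. -/
def total : Set (TotalSpace m) := D.base ×ˢ Set.univ

/-- A vielbein `e_a^b` of `M_sk`: a smooth unitary coframe `e^b = e_a^b dz^a`,
i.e. `∑_b e_a^b \bar{e_c^b} = K_{a \bar c}`. -/
structure IsVielbein (e : (Fin m → ℂ) → Matrix (Fin m) (Fin m) ℂ) : Prop where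
  smooth : ∀ a b, ContDiffOn ℝ ∞ (fun z => e z a b) D.base
  unitary : ∀ z ∈ D.base, ∀ a c,
    ∑ b, e z a b * conj (e z c b) = kahlerMetricMatrix D.F z a c

variable (e : (Fin m → ℂ) → Matrix (Fin m) (Fin m) ℂ)

/-- `Π_A^b = (e_a^b, - z^a e_a^b)`. -/
def projectedVielbein (z : Fin m → ℂ) (A : Fin (m + 1)) (b : Fin m) : ℂ :=
  Fin.snoc (α := fun _ => ℂ) (fun a => e z a b) (-∑ a, z a * e z a b) A

/-- `u = i e^{K/2 + φ} Z^A (db_A - F_{AB} da^B)`. -/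
noncomputable def formU (p X : TotalSpace m) : ℂ :=
  match p, X with
  | (z, φ, _, _, _), (_, _, _, da, db) =>
    Complex.I * (Real.exp (kahlerPotential D.F z / 2 + φ) : ℂ) *
      ∑ A, homogeneous z A *
        ((db A : ℂ) - ∑ B, prepotentialHessian D.F (homogeneous z) A B * (da B : ℂ))

/-- `v = (1/2) e^{2φ} [d e^{-2φ} - i (d\tilde φ + b_A da^A - a^A db_A)]`. -/
noncomputable def formV (p X : TotalSpace m) : ℂ :=
  match p, X with
  | (_, φ, _, a, b), (_, dφ, dφt, da, db) =>
    (1 / 2 : ℂ) * (Real.exp (2 * φ) : ℂ) *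
      (((-2 * Real.exp (-2 * φ) * dφ : ℝ) : ℂ)
        - Complex.I * ((dφt + ∑ A, (b A * da A - a A * db A) : ℝ) : ℂ))

/-- `E^b = -(i/2) e^{φ - K/2} Π_A^b N^{AB} (db_B - \bar F_{BC} da^C)`, with `N^{AB}` the inverse
matrix of `N_{AB}`. -/
noncomputable def formE (β : Fin m) (p X : TotalSpace m) : ℂ :=
  match p, X with
  | (z, φ, _, _, _), (_, _, _, da, db) =>
    -(Complex.I / 2) * (Real.exp (φ - kahlerPotential D.F z / 2) : ℂ) *
      ∑ A, ∑ B, projectedVielbein e z A β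
        * ((imHessian D.F (homogeneous z))⁻¹ A B : ℂ)
        * ((db B : ℂ) - ∑ C, conj (prepotentialHessian D.F (homogeneous z) B C) * (da C : ℂ))

/-- `e^b = e_a^b dz^a`. -/
def formBase (β : Fin m) (p X : TotalSpace m) : ℂ :=
  ∑ a, e p.1 a β * X.1 a

/-- The forms `(u, e^1, …, e^{n-1})`. -/
noncomputable def formsUe (k : Fin (m + 1)) (p X : TotalSpace m) : ℂ :=
  Fin.cons (α := fun _ => ℂ) (D.formU p X) (fun β => formBase e β p X) k

/-- The forms `(v, E^1, …, E^{n-1})`. -/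
noncomputable def formsVE (k : Fin (m + 1)) (p X : TotalSpace m) : ℂ :=
  Fin.cons (α := fun _ => ℂ) (formV p X) (fun β => D.formE e β p X) k

/-- The quaternionic vielbein: the `2 × 2n` matrix of one-forms with rows
`(\bar u, \bar e, -v, -E) / √2` and `(\bar v, \bar E, u, e) / √2`. -/
noncomputable def quaternionicVielbein (𝒜 : Fin 2) (k : Fin (m + 1) ⊕ Fin (m + 1))
    (p X : TotalSpace m) : ℂ :=
  (1 / (Real.sqrt 2 : ℂ)) *
    (![Sum.elim (fun k => conj (D.formsUe e k p X)) (fun k => -D.formsVE e k p X),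
      Sum.elim (fun k => conj (D.formsVE e k p X)) (fun k => D.formsUe e k p X)] 𝒜 k)

/-- The metric `g = u \bar u + v \bar v + ∑_b (e^b \bar e^b + E^b \bar E^b)`, where
`α \bar α = (α ⊗ \bar α + \bar α ⊗ α) / 2`. -/
noncomputable def metric (p X Y : TotalSpace m) : ℝ :=
  ∑ k, ((D.formsUe e k p X * conj (D.formsUe e k p Y)).re
    + (D.formsVE e k p X * conj (D.formsVE e k p Y)).re)

/-- The Pauli matrices. -/
def pauli : Fin 3 → Matrix (Fin 2) (Fin 2) ℂ :=
  ![!![0, 1; 1, 0], !![0, -Complex.I; Complex.I, 0], !![1, 0; 0, -1]]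

/-- `J = (J_1, J_2, J_3)` is the triple of endomorphism fields on `M` defined by
`U^{𝒜k} ∘ J_α = -i (σ_α)^𝒜_ℬ U^{ℬk}`. -/
def IsQuaternionicFrame (J : Fin 3 → TotalSpace m → TotalSpace m →L[ℝ] TotalSpace m) : Prop :=
  ∀ α, ∀ p ∈ D.total, ∀ X 𝒜 k,
    D.quaternionicVielbein e 𝒜 k p (J α p X)
      = -Complex.I * ∑ ℬ, pauli α 𝒜 ℬ * D.quaternionicVielbein e ℬ k p X

/-- The metric induced by `g` on the fibre `{z} × G`. -/
noncomputable def fibreMetric (z : Fin m → ℂ) (y X Y : FibreSpace m) : ℝ :=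
  D.metric e (z, y) (0, X) (0, Y)

/-- The endomorphism field induced on the fibre `{z} × G` by an endomorphism field of `M` which
preserves the tangent spaces of the fibre. -/
noncomputable def fibreEndomorphism (J : TotalSpace m → TotalSpace m →L[ℝ] TotalSpace m)
    (z : Fin m → ℂ) (y : FibreSpace m) : FibreSpace m →L[ℝ] FibreSpace m :=
  (ContinuousLinearMap.snd ℝ (Fin m → ℂ) (FibreSpace m)).comp
    ((J (z, y)).comp (ContinuousLinearMap.inr ℝ (Fin m → ℂ) (FibreSpace m)))

end ProjectiveSpecialKahlerDomain

/-! ### Holomorphic functions of several variables are smooth -/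

section SeveralComplexVariables

open Metric Complex

variable {E : Type*} [NormedAddCommGroup E] [NormedSpace ℂ E]

/-! Everything rests on one identity of special geometry. Put h = e^{-K} and regard N as a
sesquilinear form on ℂ^n. Euler's relation gives K_{a b̄} = 2 N_{ab}/h + 4 conj((NZ)_a) (NZ)_b / h²
(`kahlerMetricMatrix_eq`). The form 2N/h + 4 N(·,Z) N(Z,·)/h² has Z in its kernel, because N(Z,Z) =
-h/2. A unitary coframe therefore diagonalises it on all of ℂ^n by means of Π
(`sum_frameProj_mul_conj`). Positivity of K_{a b̄} then forces N to be invertible and makes (u, e;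
v, E) a complex-valued coframe of M. In this coframe the defining equations of the J_α prescribe
constant endomorphisms, whence existence and uniqueness. In particular J_3 multiplies u, e by i and
v, E by -i, so it preserves g.

Integrability: u is complex linear and E is antilinear in the vector db_A - F_{AB} da^B, so the
opposite signs above together say that J_3 multiplies this vector by i. Hence dz, db_A - F_{AB} da^B
and conj v are the (1,0)-forms. They have the same span as the differentials of explicit functions
z, W_A = b_A - F_{AB} a^B and S = e^{-2φ} + i(φ̃ + W_A a^A), because dF_{AB} is a combination of the
dz. These functions are global coordinates. For fixed y₀ the values of W, S at (z, y₀) are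
holomorphic in z. Subtracting them gives a holomorphic chart in which M_sk × {y₀} and {z₀} × G are
coordinate subspaces.

Geometry of the fibres: the identity also yields ∑ E(X) conj E(Y) = (e^{2φ}/2) N(R_X, R_Y) +
conj(u(X)) u(Y), where R_X is the complex vector of X with its index raised (`sum_formE_mul_conj`).
Taking imaginary parts, u(X) conj u(Y) + ∑ E(X) conj E(Y) contributes -e^{2φ}/2 times the standard
symplectic form in (a, b), with no dependence on z (`im_formU_add_sum_formE`). So ζ = (u, E) at φ =
0 is a linear coordinate on the (a, b)-space in which the fibre metric is the horospherical form of
the complex hyperbolic metric; a Cayley transform carries it to the ball.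

In the complex structure of the ball u, v and E all have type (1,0), while for J_3 only u has. This
mismatch adds 2 Im(u ⊗ conj u) to the negative of the hyperbolic fundamental form, and the exterior
derivative of the sum takes the value -4 e^K on a suitable triple, so the induced structure is not
Kähler. -/

/-- Cauchy's estimate for the derivative of a holomorphic function in a direction. -/
theorem norm_fderiv_le_of_differentiableOn_ball {f : E → ℂ} {x : E} {R C : ℝ} (hR : 0 < R)
    (hf : ∀ y ∈ ball x R, DifferentiableAt ℂ f y) (hC0 : 0 ≤ C)
    (hC : ∀ y ∈ ball x R, ‖f y‖ ≤ C) :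
    ‖fderiv ℂ f x‖ ≤ 2 * C / R := by
  refine ContinuousLinearMap.opNorm_le_bound _ (by positivity) fun v => ?_
  rcases eq_or_ne v 0 with rfl | hv
  · simp
  have hv' : 0 < ‖v‖ := norm_pos_iff.2 hv
  -- The complex line through x in direction v stays in the ball up to this radius; Cauchy's
  -- estimate in one variable then costs only the factor 2.
  set r : ℝ := R / (2 * ‖v‖) with hr
  have hr0 : 0 < r := by positivity
  have hmem : ∀ ζ : ℂ, ζ ∈ closedBall (0 : ℂ) r → x + ζ • v ∈ ball x R := by
    intro ζ hζ
    rw [mem_closedBall_zero_iff] at hζ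
    rw [mem_ball_iff_norm, add_sub_cancel_left, norm_smul]
    calc ‖ζ‖ * ‖v‖ ≤ r * ‖v‖ := by gcongr
      _ = R / 2 := by rw [hr]; field_simp
      _ < R := by linarith
  have hd : ∀ ζ ∈ closedBall (0 : ℂ) r, HasDerivAt (fun ζ : ℂ => f (x + ζ • v))
      (fderiv ℂ f (x + ζ • v) v) ζ := by
    intro ζ hζ
    have h1 : HasDerivAt (fun ζ : ℂ => x + ζ • v) v ζ := by
      simpa using ((hasDerivAt_id ζ).smul_const v).const_add x
    exact (hf _ (hmem ζ hζ)).hasFDerivAt.comp_hasDerivAt ζ h1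
  have key := norm_deriv_le_of_forall_mem_sphere_norm_le (c := 0) (C := C) hr0
    (f := fun ζ : ℂ => f (x + ζ • v))
    (DifferentiableOn.diffContOnCl (s := ball (0 : ℂ) r) fun ζ hζ =>
      (hd ζ (closure_ball_subset_closedBall hζ)).differentiableAt.differentiableWithinAt)
    fun ζ hζ => hC _ (hmem ζ (sphere_subset_closedBall hζ))
  rw [(hd 0 (by simp [hr0.le])).deriv] at key
  simp only [zero_smul, add_zero] at key
  calc _ ≤ C / r := key
    _ = 2 * C / R * ‖v‖ := by rw [hr]; field_simp

/-- A directional derivative of a holomorphic function on an open set of a finite-dimensional space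
is holomorphic. -/
theorem DifferentiableOn.fderiv_apply_of_isOpen [FiniteDimensional ℂ E] {f : E → ℂ} {U : Set E}
    (hU : IsOpen U) (hf : DifferentiableOn ℂ f U) (v : E) :
    DifferentiableOn ℂ (fun x => fderiv ℂ f x v) U := by
  intro x₀ hx₀
  apply DifferentiableAt.differentiableWithinAt
  have : ProperSpace E := FiniteDimensional.proper ℂ E
  obtain ⟨R', hR', hsub'⟩ := Metric.isOpen_iff.1 hU x₀ hx₀
  -- Three radii: x moves in a ball of radius R, the integration circle adds at most R, and the
  -- estimate of the derivative at a point of the circle needs one more ball of radius R.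
  obtain ⟨R, hR, hsub⟩ : ∃ R > 0, closedBall x₀ (3 * R) ⊆ U :=
    ⟨R' / 4, by positivity, (closedBall_subset_ball (by linarith)).trans hsub'⟩
  obtain ⟨C, hC⟩ := (isCompact_closedBall x₀ (3 * R)).exists_bound_of_continuousOn
    (hf.continuousOn.mono hsub)
  have hC0 : 0 ≤ C := (norm_nonneg _).trans (hC x₀ (mem_closedBall_self (by positivity)))
  have hfa : ∀ y ∈ closedBall x₀ (3 * R), DifferentiableAt ℂ f y := fun y hy =>
    hf.differentiableAt (hU.mem_nhds (hsub hy))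
  obtain ⟨r, hr, hrv⟩ : ∃ r > 0, r * ‖v‖ ≤ R :=
    ⟨R / (‖v‖ + 1), by positivity, by
      rw [div_mul_eq_mul_div, div_le_iff₀ (by positivity)]; nlinarith [norm_nonneg v]⟩
  have hmem : ∀ x ∈ ball x₀ R, ∀ ζ ∈ closedBall (0 : ℂ) r,
      x + ζ • v ∈ ball x₀ (2 * R) := by
    intro x hx ζ hζ
    rw [mem_closedBall_zero_iff] at hζ
    rw [mem_ball_iff_norm] at hx ⊢
    calc ‖x + ζ • v - x₀‖ = ‖(x - x₀) + ζ • v‖ := by congr 1; abel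
      _ ≤ ‖x - x₀‖ + ‖ζ‖ * ‖v‖ := (norm_add_le _ _).trans_eq (by rw [norm_smul])
      _ < R + r * ‖v‖ := add_lt_add_of_lt_of_le hx (by gcongr)
      _ ≤ 2 * R := by linarith
  have hsub2 : ball x₀ (2 * R) ⊆ closedBall x₀ (3 * R) :=
    ball_subset_closedBall.trans (closedBall_subset_closedBall (by linarith))
  have hcirc : ∀ t : ℝ, circleMap 0 r t ∈ closedBall (0 : ℂ) r := fun t =>
    sphere_subset_closedBall (circleMap_mem_sphere 0 hr.le t)
  -- the kernel of Cauchy's formula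
  set k : ℝ → ℂ := fun t => _root_.deriv (circleMap 0 r) t * (1 / (circleMap 0 r t - 0) ^ 2) with hk
  have hkc : Continuous k := by
    simp only [hk, deriv_circleMap]
    refine ((continuous_circleMap 0 r).mul continuous_const).mul
      (continuous_const.div (((continuous_circleMap 0 r).sub continuous_const).pow 2) fun t => ?_)
    simpa using hr.ne'
  have hformula : ∀ x ∈ ball x₀ R, fderiv ℂ f x v =
      (2 * Real.pi * I)⁻¹ * ∫ t in (0 : ℝ)..2 * Real.pi, k t * f (x + circleMap 0 r t • v) := by
    intro x hx
    have hd : ∀ ζ ∈ closedBall (0 : ℂ) r, HasDerivAt (fun ζ : ℂ => f (x + ζ • v))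
        (fderiv ℂ f (x + ζ • v) v) ζ := by
      intro ζ hζ
      have h1 : HasDerivAt (fun ζ : ℂ => x + ζ • v) v ζ := by
        simpa using ((hasDerivAt_id ζ).smul_const v).const_add x
      exact (hfa _ (hsub2 (hmem x hx ζ hζ))).hasFDerivAt.comp_hasDerivAt ζ h1
    have h := DifferentiableOn.deriv_eq_smul_circleIntegral (c := 0) hr
      (f := fun ζ : ℂ => f (x + ζ • v))
      fun ζ hζ => (hd ζ hζ).differentiableAt.differentiableWithinAt
    rw [(hd 0 (by simp [hr.le])).deriv] at h
    simp only [zero_smul, add_zero, smul_eq_mul] at h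
    rw [eq_inv_mul_iff_mul_eq₀ Complex.two_pi_I_ne_zero, ← h, circleIntegral]
    refine intervalIntegral.integral_congr fun t _ => ?_
    simp [hk, mul_assoc]
  have hcont : ∀ x ∈ ball x₀ R, Continuous fun t : ℝ => k t * f (x + circleMap 0 r t • v) := by
    intro x hx
    refine hkc.mul (hf.continuousOn.comp_continuous (by fun_prop) fun t => ?_)
    exact hsub (hsub2 (hmem x hx _ (hcirc t)))
  -- Continuity of the derivative is not yet known, so the integrand of the differentiated integral
  -- is shown to be merely measurable; this needs a σ-algebra on `E`.
  let _ : MeasurableSpace E := borel E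
  have : BorelSpace E := ⟨rfl⟩
  have hint : DifferentiableAt ℂ (fun x => ∫ t in (0 : ℝ)..2 * Real.pi,
      k t * f (x + circleMap 0 r t • v)) x₀ := by
    -- Differentiation of Cauchy's formula under the integral sign; Cauchy's estimate supplies the
    -- dominating function.
    refine (intervalIntegral.hasFDerivAt_integral_of_dominated_of_fderiv_le (s := ball x₀ R)
      (F' := fun x t => k t • fderiv ℂ f (x + circleMap 0 r t • v))
      (bound := fun t => ‖k t‖ * (2 * C / R)) (ball_mem_nhds x₀ hR) ?_ ?_ ?_ ?_ ?_
      ?_).differentiableAt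
    · filter_upwards [ball_mem_nhds x₀ hR] with x hx
      exact (hcont x hx).aestronglyMeasurable
    · exact (hcont x₀ (mem_ball_self hR)).intervalIntegrable _ _
    · have : Measurable fun t : ℝ => k t • fderiv ℂ f (x₀ + circleMap 0 r t • v) :=
        hkc.measurable.smul ((measurable_fderiv ℂ f).comp
          (Continuous.measurable (by fun_prop)))
      exact this.aestronglyMeasurable
    · refine Filter.Eventually.of_forall fun t _ x hx => ?_
      rw [norm_smul]
      gcongr
      have hy := hmem x hx _ (hcirc t)
      have hb : ball (x + circleMap 0 r t • v) R ⊆ closedBall x₀ (3 * R) := by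
        intro y hy'
        rw [mem_ball] at hy hy'
        rw [mem_closedBall]
        linarith [dist_triangle y (x + circleMap 0 r t • v) x₀]
      exact norm_fderiv_le_of_differentiableOn_ball hR (fun y hy => hfa y (hb hy)) hC0
        fun y hy => hC y (hb hy)
    · exact (Continuous.intervalIntegrable (by fun_prop) _ _)
    · refine Filter.Eventually.of_forall fun t _ x hx => ?_
      have h1 : HasFDerivAt (fun x : E => x + circleMap 0 r t • v) (.id ℂ E) x :=
        (hasFDerivAt_id x).add_const _
      exact ((hfa _ (hsub2 (hmem x hx _ (hcirc t)))).hasFDerivAt.comp x h1).const_mul (k t)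
  refine (hint.const_mul (2 * Real.pi * I)⁻¹).congr_of_eventuallyEq ?_
  filter_upwards [ball_mem_nhds x₀ hR] with x hx using hformula x hx

/-- A holomorphic function on an open set of a finite-dimensional space is smooth. -/
theorem DifferentiableOn.contDiffOn_of_finiteDimensional [FiniteDimensional ℂ E] {U : Set E}
    (hU : IsOpen U) {f : E → ℂ} (hf : DifferentiableOn ℂ f U) : ContDiffOn ℂ ∞ f U := by
  rw [contDiffOn_infty]
  intro n
  induction n generalizing f with
  | zero => exact contDiffOn_zero.2 hf.continuousOn
  | succ n ih =>
    push_cast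
    rw [contDiffOn_succ_iff_fderiv_of_isOpen hU]
    refine ⟨hf, by simp, contDiffOn_clm_apply.2 fun v => ?_⟩
    exact ih (hf.fderiv_apply_of_isOpen hU v)

end SeveralComplexVariables

/-! ### Wirtinger calculus -/

section Wirtinger

variable {m : ℕ} {f g : (Fin m → ℂ) → ℂ} {z : Fin m → ℂ} (a : Fin m)

theorem Filter.EventuallyEq.wirtinger_eq (h : f =ᶠ[nhds z] g) :
    wirtinger a f z = wirtinger a g z := by
  simp only [wirtinger, h.fderiv_eq]

theorem Filter.EventuallyEq.wirtingerBar_eq (h : f =ᶠ[nhds z] g) :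
    wirtingerBar a f z = wirtingerBar a g z := by
  simp only [wirtingerBar, h.fderiv_eq]

theorem wirtinger_mul (hf : DifferentiableAt ℝ f z) (hg : DifferentiableAt ℝ g z) :
    wirtinger a (fun w => f w * g w) z = wirtinger a f z * g z + f z * wirtinger a g z := by
  simp only [wirtinger, fderiv_fun_mul hf hg, add_apply,
    smul_apply, smul_eq_mul]
  ring

theorem wirtingerBar_mul (hf : DifferentiableAt ℝ f z) (hg : DifferentiableAt ℝ g z) :
    wirtingerBar a (fun w => f w * g w) z
      = wirtingerBar a f z * g z + f z * wirtingerBar a g z := by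
  simp only [wirtingerBar, fderiv_fun_mul hf hg, add_apply,
    smul_apply, smul_eq_mul]
  ring

theorem wirtinger_sub (hf : DifferentiableAt ℝ f z) (hg : DifferentiableAt ℝ g z) :
    wirtinger a (fun w => f w - g w) z = wirtinger a f z - wirtinger a g z := by
  simp only [wirtinger, fderiv_fun_sub hf hg, sub_apply]
  ring

theorem wirtingerBar_sub (hf : DifferentiableAt ℝ f z) (hg : DifferentiableAt ℝ g z) :
    wirtingerBar a (fun w => f w - g w) z = wirtingerBar a f z - wirtingerBar a g z := by
  simp only [wirtingerBar, fderiv_fun_sub hf hg, sub_apply]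
  ring

theorem wirtinger_const_mul (c : ℂ) (hf : DifferentiableAt ℝ f z) :
    wirtinger a (fun w => c * f w) z = c * wirtinger a f z := by
  simp only [wirtinger, fderiv_const_mul hf, smul_apply, smul_eq_mul]
  ring

theorem wirtingerBar_const_mul (c : ℂ) (hf : DifferentiableAt ℝ f z) :
    wirtingerBar a (fun w => c * f w) z = c * wirtingerBar a f z := by
  simp only [wirtingerBar, fderiv_const_mul hf, smul_apply, smul_eq_mul]
  ring

theorem wirtinger_sum {ι : Type*} (s : Finset ι) {F : ι → (Fin m → ℂ) → ℂ}
    (hF : ∀ i ∈ s, DifferentiableAt ℝ (F i) z) :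
    wirtinger a (fun w => ∑ i ∈ s, F i w) z = ∑ i ∈ s, wirtinger a (F i) z := by
  simp only [wirtinger, fderiv_fun_sum hF, sum_apply, Finset.mul_sum,
    ← Finset.sum_sub_distrib, Finset.sum_div]

theorem wirtingerBar_sum {ι : Type*} (s : Finset ι) {F : ι → (Fin m → ℂ) → ℂ}
    (hF : ∀ i ∈ s, DifferentiableAt ℝ (F i) z) :
    wirtingerBar a (fun w => ∑ i ∈ s, F i w) z = ∑ i ∈ s, wirtingerBar a (F i) z := by
  simp only [wirtingerBar, fderiv_fun_sum hF, sum_apply, Finset.mul_sum,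
    ← Finset.sum_add_distrib, Finset.sum_div]

theorem fderiv_conj_apply (hf : DifferentiableAt ℝ f z) (X : Fin m → ℂ) :
    fderiv ℝ (fun w => conj (f w)) z X = conj (fderiv ℝ f z X) := by
  have := (Complex.conjCLE.toContinuousLinearMap.hasFDerivAt.comp z hf.hasFDerivAt).fderiv
  exact congrArg (fun L => L X) this

theorem DifferentiableAt.conj_comp (hf : DifferentiableAt ℝ f z) :
    DifferentiableAt ℝ (fun w => conj (f w)) z :=
  Complex.conjCLE.toContinuousLinearMap.differentiableAt.comp z hf

theorem wirtinger_conj (hf : DifferentiableAt ℝ f z) :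
    wirtinger a (fun w => conj (f w)) z = conj (wirtingerBar a f z) := by
  simp only [wirtinger, wirtingerBar, fderiv_conj_apply hf, map_div₀, map_add, map_mul,
    Complex.conj_I, map_ofNat]
  ring

theorem wirtingerBar_conj (hf : DifferentiableAt ℝ f z) :
    wirtingerBar a (fun w => conj (f w)) z = conj (wirtinger a f z) := by
  simp only [wirtinger, wirtingerBar, fderiv_conj_apply hf, map_div₀, map_sub, map_mul,
    Complex.conj_I, map_ofNat]
  ring

theorem fderiv_real_single_I (hf : DifferentiableAt ℂ f z) :
    fderiv ℝ f z (Pi.single a Complex.I) = Complex.I * fderiv ℂ f z (Pi.single a 1) := by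
  have h : (Pi.single a Complex.I : Fin m → ℂ) = Complex.I • Pi.single a 1 := by
    rw [← Pi.single_smul]; simp
  rw [hf.fderiv_restrictScalars ℝ, ContinuousLinearMap.coe_restrictScalars', h, map_smul,
    smul_eq_mul]

theorem wirtinger_of_differentiableAt (hf : DifferentiableAt ℂ f z) :
    wirtinger a f z = fderiv ℂ f z (Pi.single a 1) := by
  rw [wirtinger, fderiv_real_single_I a hf, hf.fderiv_restrictScalars ℝ,
    ContinuousLinearMap.coe_restrictScalars', ← mul_assoc, Complex.I_mul_I]
  ring

theorem wirtingerBar_of_differentiableAt (hf : DifferentiableAt ℂ f z) :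
    wirtingerBar a f z = 0 := by
  rw [wirtingerBar, fderiv_real_single_I a hf, hf.fderiv_restrictScalars ℝ,
    ContinuousLinearMap.coe_restrictScalars', ← mul_assoc, Complex.I_mul_I]
  ring

theorem fderiv_ofReal_comp_apply {h : (Fin m → ℂ) → ℝ} (hh : DifferentiableAt ℝ h z)
    (X : Fin m → ℂ) : fderiv ℝ (fun w => (h w : ℂ)) z X = (fderiv ℝ h z X : ℂ) := by
  have := (Complex.ofRealCLM.hasFDerivAt.comp z hh.hasFDerivAt).fderiv
  exact congrArg (fun L => L X) this

theorem wirtingerBar_log {h : (Fin m → ℂ) → ℝ} (hh : DifferentiableAt ℝ h z) (h0 : h z ≠ 0) :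
    wirtingerBar a (fun w => (Real.log (h w) : ℂ)) z
      = (h z : ℂ)⁻¹ * wirtingerBar a (fun w => (h w : ℂ)) z := by
  simp only [wirtingerBar, fderiv_ofReal_comp_apply hh, fderiv_ofReal_comp_apply (hh.log h0),
    fderiv.log hh h0, smul_apply, smul_eq_mul, Complex.ofReal_mul,
    Complex.ofReal_inv]
  ring

/-- Obtained from the product rule for f · f⁻¹ = 1. -/
theorem wirtinger_inv (hf : DifferentiableAt ℝ f z) (h0 : f z ≠ 0) :
    wirtinger a (fun w => (f w)⁻¹) z = -wirtinger a f z / f z ^ 2 := by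
  have h1 : DifferentiableAt ℝ (fun w => (f w)⁻¹) z := hf.inv h0
  have h2 := wirtinger_mul a hf h1
  have h3 : (fun w => f w * (f w)⁻¹) =ᶠ[nhds z] fun _ => 1 := by
    filter_upwards [hf.continuousAt.eventually_ne h0] with w hw using mul_inv_cancel₀ hw
  rw [h3.wirtinger_eq, wirtinger_of_differentiableAt a (differentiableAt_const _)] at h2
  simp only [fderiv_fun_const, Pi.zero_apply, zero_apply] at h2
  field_simp at h2 ⊢
  linear_combination -h2

end Wirtinger

/-! ### The affine embedding z ↦ (z, 1) -/

section Homogeneous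

variable {m : ℕ}

/-- The differential `X ↦ (X, 0)` of `z ↦ (z, 1)`. -/
noncomputable def homogeneousDeriv (m : ℕ) : (Fin m → ℂ) →L[ℂ] (Fin (m + 1) → ℂ) :=
  ContinuousLinearMap.pi fun A =>
    Fin.lastCases (motive := fun _ => (Fin m → ℂ) →L[ℂ] ℂ) 0
      (fun a => ContinuousLinearMap.proj a) A

@[simp]
theorem homogeneousDeriv_castSucc (X : Fin m → ℂ) (a : Fin m) :
    homogeneousDeriv m X a.castSucc = X a := by
  simp [homogeneousDeriv]

@[simp]
theorem homogeneousDeriv_last (X : Fin m → ℂ) :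
    homogeneousDeriv m X (Fin.last m) = 0 := by
  simp [homogeneousDeriv]

@[simp]
theorem homogeneous_castSucc (z : Fin m → ℂ) (a : Fin m) :
    homogeneous z a.castSucc = z a := by
  simp [homogeneous]

@[simp]
theorem homogeneous_last (z : Fin m → ℂ) : homogeneous z (Fin.last m) = 1 := by
  simp [homogeneous]

theorem homogeneous_eq_add (z : Fin m → ℂ) :
    homogeneous z = homogeneousDeriv m z + homogeneous 0 := by
  ext A
  refine Fin.lastCases ?_ (fun a => ?_) A <;> simp

theorem hasFDerivAt_homogeneous (z : Fin m → ℂ) :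
    HasFDerivAt homogeneous (homogeneousDeriv m) z := by
  have : (homogeneous : (Fin m → ℂ) → _) = fun z => homogeneousDeriv m z + homogeneous 0 :=
    funext homogeneous_eq_add
  rw [this]
  exact (homogeneousDeriv m).hasFDerivAt.add_const _

theorem homogeneousDeriv_single (a : Fin m) :
    homogeneousDeriv m (Pi.single a 1) = Pi.single a.castSucc 1 := by
  ext A
  refine Fin.lastCases ?_ (fun b => ?_) A
  · simp [(Fin.castSucc_lt_last a).ne']
  · simp [Pi.single_apply]

theorem contDiff_homogeneous : ContDiff ℂ ∞ (homogeneous : (Fin m → ℂ) → _) := by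
  have : (homogeneous : (Fin m → ℂ) → _) = fun z => homogeneousDeriv m z + homogeneous 0 :=
    funext homogeneous_eq_add
  rw [this]
  exact (homogeneousDeriv m).contDiff.add contDiff_const

theorem hasFDerivAt_homogeneous_apply (z : Fin m → ℂ) (B : Fin (m + 1)) :
    HasFDerivAt (fun w => homogeneous w B)
      ((ContinuousLinearMap.proj B).comp (homogeneousDeriv m)) z :=
  (ContinuousLinearMap.proj (R := ℂ) (φ := fun _ : Fin (m + 1) => ℂ) B).hasFDerivAt.comp z
    (hasFDerivAt_homogeneous z)

theorem wirtinger_homogeneous (a : Fin m) (B : Fin (m + 1)) (z : Fin m → ℂ) :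
    wirtinger a (fun w => homogeneous w B) z = (Pi.single a.castSucc 1 : Fin (m + 1) → ℂ) B := by
  rw [wirtinger_of_differentiableAt a (hasFDerivAt_homogeneous_apply z B).differentiableAt,
    (hasFDerivAt_homogeneous_apply z B).fderiv, ← homogeneousDeriv_single]
  rfl

theorem wirtingerBar_homogeneous (a : Fin m) (B : Fin (m + 1)) (z : Fin m → ℂ) :
    wirtingerBar a (fun w => homogeneous w B) z = 0 :=
  wirtingerBar_of_differentiableAt a (hasFDerivAt_homogeneous_apply z B).differentiableAt

end Homogeneous

/-! ### The prepotential, Euler's relation and the special Kähler metric -/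

namespace ProjectiveSpecialKahlerDomain

variable {m : ℕ} (D : ProjectiveSpecialKahlerDomain m)

theorem isOpen_base : IsOpen D.base :=
  D.isOpen_cone.preimage contDiff_homogeneous.continuous

theorem differentiableOn_gradient (B : Fin (m + 1)) :
    DifferentiableOn ℂ (fun Y => fderiv ℂ D.F Y (Pi.single B 1)) D.cone :=
  D.holomorphic.fderiv_apply_of_isOpen D.isOpen_cone _

theorem differentiableOn_hessian (A B : Fin (m + 1)) :
    DifferentiableOn ℂ (fun Y => prepotentialHessian D.F Y A B) D.cone :=
  (D.differentiableOn_gradient B).fderiv_apply_of_isOpen D.isOpen_cone _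

theorem hessian_symm {Z : Fin (m + 1) → ℂ} (hZ : Z ∈ D.cone) (A B : Fin (m + 1)) :
    prepotentialHessian D.F Z A B = prepotentialHessian D.F Z B A := by
  have hc : ContDiffAt ℂ ∞ D.F Z :=
    (D.holomorphic.contDiffOn_of_finiteDimensional D.isOpen_cone).contDiffAt
      (D.isOpen_cone.mem_nhds hZ)
  have hd : DifferentiableAt ℂ (fderiv ℂ D.F) Z :=
    (hc.fderiv_right (m := 1) (by norm_cast)).differentiableAt (by simp)
  have h : ∀ A B : Fin (m + 1), prepotentialHessian D.F Z A B
      = fderiv ℂ (fderiv ℂ D.F) Z (Pi.single A 1) (Pi.single B 1) := by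
    intro A B
    simp only [prepotentialHessian, Matrix.of_apply]
    rw [fderiv_clm_apply hd (differentiableAt_const _)]
    simp
  rw [h, h]
  exact hc.isSymmSndFDerivAt (by
    rw [minSmoothness_of_isRCLikeNormedField]
    exact WithTop.coe_le_coe.2 (le_top : (2 : ℕ∞) ≤ ⊤)) _ _

/-- Differentiating F(cZ) = c² F(Z) in Z and cancelling one factor c shows that the gradient is
homogeneous of degree one. -/
theorem gradient_smul {Z : Fin (m + 1) → ℂ} (hZ : Z ∈ D.cone) {c : ℂ} (hc : c ≠ 0)
    (v : Fin (m + 1) → ℂ) : fderiv ℂ D.F (c • Z) v = c * fderiv ℂ D.F Z v := by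
  have hF : ∀ Y ∈ D.cone, HasFDerivAt D.F (fderiv ℂ D.F Y) Y := fun Y hY =>
    (D.holomorphic.differentiableAt (D.isOpen_cone.mem_nhds hY)).hasFDerivAt
  have h1 : HasFDerivAt (fun Y => D.F (c • Y))
      ((fderiv ℂ D.F (c • Z)).comp (c • ContinuousLinearMap.id ℂ _)) Z :=
    (hF _ (D.smul_mem Z hZ c hc)).comp Z ((hasFDerivAt_id Z).const_smul c)
  have h2 : HasFDerivAt (fun Y => D.F (c • Y)) (c ^ 2 • fderiv ℂ D.F Z) Z := by
    refine ((hF Z hZ).const_mul (c ^ 2)).congr_of_eventuallyEq ?_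
    filter_upwards [D.isOpen_cone.mem_nhds hZ] with Y hY using D.homogeneous_two Y hY c hc
  have h3 := congrArg (fun L => L v) (h1.unique h2)
  simp only [ContinuousLinearMap.comp_apply, smul_apply,
    ContinuousLinearMap.id_apply, map_smul, smul_eq_mul] at h3
  exact mul_left_cancel₀ hc (by rw [h3]; ring)

/-- Euler's relation `Z^A F_{AB} = F_B`. -/
theorem sum_mul_hessian {Z : Fin (m + 1) → ℂ} (hZ : Z ∈ D.cone) (B : Fin (m + 1)) :
    ∑ A, Z A * prepotentialHessian D.F Z A B = fderiv ℂ D.F Z (Pi.single B 1) := by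
  set G : (Fin (m + 1) → ℂ) → ℂ := fun Y => fderiv ℂ D.F Y (Pi.single B 1) with hG
  have hd : HasFDerivAt G (fderiv ℂ G Z) ((1 : ℂ) • Z) := by
    rw [one_smul]
    exact ((D.differentiableOn_gradient B).differentiableAt (D.isOpen_cone.mem_nhds hZ)).hasFDerivAt
  -- The derivative of c ↦ F_B(cZ) at c = 1 is computed twice, by the chain rule and by homogeneity.
  have h1 : HasDerivAt (fun c : ℂ => G (c • Z)) (fderiv ℂ G Z Z) 1 := by
    have hl : HasDerivAt (fun c : ℂ => c • Z) Z 1 := by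
      simpa using (hasDerivAt_id (1 : ℂ)).smul_const Z
    exact hd.comp_hasDerivAt (1 : ℂ) hl
  have h2 : HasDerivAt (fun c : ℂ => G (c • Z)) (G Z) 1 := by
    have : HasDerivAt (fun c : ℂ => c * G Z) (G Z) 1 := by
      simpa using (hasDerivAt_id (1 : ℂ)).mul_const (G Z)
    refine this.congr_of_eventuallyEq ?_
    filter_upwards [isOpen_ne.mem_nhds (one_ne_zero : (1 : ℂ) ≠ 0)] with c hc
    exact D.gradient_smul hZ hc _
  refine Eq.trans ?_ (h1.unique h2)
  conv_rhs => rw [pi_eq_sum_univ' Z]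
  rw [map_sum]
  refine Finset.sum_congr rfl fun A _ => ?_
  rw [map_smul, smul_eq_mul]
  congr 2
  ext C
  simp [Pi.single_apply]

theorem ofReal_imHessian (F : (Fin (m + 1) → ℂ) → ℂ) (Z : Fin (m + 1) → ℂ)
    (A B : Fin (m + 1)) : (imHessian F Z A B : ℂ)
      = (prepotentialHessian F Z A B - conj (prepotentialHessian F Z A B)) / (2 * Complex.I) := by
  rw [Complex.sub_conj, imHessian, Matrix.of_apply]
  field_simp
  push_cast
  ring

theorem imHessian_symm {Z : Fin (m + 1) → ℂ} (hZ : Z ∈ D.cone) (A B : Fin (m + 1)) :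
    imHessian D.F Z A B = imHessian D.F Z B A := by
  simp only [imHessian, Matrix.of_apply, D.hessian_symm hZ A B]

theorem ofReal_hermitianNorm {Z : Fin (m + 1) → ℂ} (hZ : Z ∈ D.cone) :
    (hermitianNorm D.F Z : ℂ) = ∑ A, ∑ B, Z A * (imHessian D.F Z A B : ℂ) * conj (Z B) := by
  rw [hermitianNorm, ← Complex.conj_eq_iff_re, map_sum]
  simp only [map_sum, map_mul, Complex.conj_conj, Complex.conj_ofReal]
  rw [Finset.sum_comm]
  refine Finset.sum_congr rfl fun A _ => Finset.sum_congr rfl fun B _ => ?_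
  rw [D.imHessian_symm hZ]
  ring

/-- Euler's relation removes the second derivatives: what remains is a sum of products of a
holomorphic and an antiholomorphic function, and such products are easy to differentiate. -/
theorem ofReal_neg_two_mul_hermitianNorm {Z : Fin (m + 1) → ℂ} (hZ : Z ∈ D.cone) :
    ((-2 * hermitianNorm D.F Z : ℝ) : ℂ)
      = Complex.I * (∑ B, fderiv ℂ D.F Z (Pi.single B 1) * conj (Z B)
        - conj (∑ B, fderiv ℂ D.F Z (Pi.single B 1) * conj (Z B))) := by
  rw [Complex.ofReal_mul, D.ofReal_hermitianNorm hZ]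
  have h1 : ∑ B, fderiv ℂ D.F Z (Pi.single B 1) * conj (Z B)
      = ∑ A, ∑ B, Z A * prepotentialHessian D.F Z A B * conj (Z B) := by
    rw [Finset.sum_comm]
    refine Finset.sum_congr rfl fun B _ => ?_
    rw [← D.sum_mul_hessian hZ, Finset.sum_mul]
  have h2 : conj (∑ A, ∑ B, Z A * prepotentialHessian D.F Z A B * conj (Z B))
      = ∑ A, ∑ B, Z A * conj (prepotentialHessian D.F Z A B) * conj (Z B) := by
    simp only [map_sum, map_mul, Complex.conj_conj]
    rw [Finset.sum_comm]
    refine Finset.sum_congr rfl fun A _ => Finset.sum_congr rfl fun B _ => ?_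
    rw [D.hessian_symm hZ]
    ring
  rw [h1, h2]
  simp only [← Finset.sum_sub_distrib, Finset.mul_sum]
  refine Finset.sum_congr rfl fun A _ => Finset.sum_congr rfl fun B _ => ?_
  rw [ofReal_imHessian]
  have := Complex.I_ne_zero
  field_simp
  push_cast
  linear_combination (-2 * Z A * conj (Z B) * (prepotentialHessian D.F Z A B
    - conj (prepotentialHessian D.F Z A B))) * Complex.I_sq

section Potential

variable {D} {z : Fin m → ℂ} (hz : z ∈ D.base)
include hz

theorem differentiableAt_gradient_homogeneous (B : Fin (m + 1)) :
    DifferentiableAt ℂ (fun w => fderiv ℂ D.F (homogeneous w) (Pi.single B 1)) z :=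
  ((D.differentiableOn_gradient B).differentiableAt (D.isOpen_cone.mem_nhds hz)).comp z
    (hasFDerivAt_homogeneous z).differentiableAt

theorem fderiv_gradient_homogeneous (a : Fin m) (B : Fin (m + 1)) :
    fderiv ℂ (fun w => fderiv ℂ D.F (homogeneous w) (Pi.single B 1)) z (Pi.single a 1)
      = prepotentialHessian D.F (homogeneous z) a.castSucc B := by
  have h := ((D.differentiableOn_gradient B).differentiableAt
    (D.isOpen_cone.mem_nhds hz)).hasFDerivAt.comp z (hasFDerivAt_homogeneous z)
  have h2 := congrArg (fun L => L (Pi.single a 1)) h.fderiv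
  simp only [ContinuousLinearMap.comp_apply, homogeneousDeriv_single] at h2
  exact h2


theorem differentiableAt_hessian_homogeneous (A B : Fin (m + 1)) :
    DifferentiableAt ℂ (fun w => prepotentialHessian D.F (homogeneous w) A B) z :=
  ((D.differentiableOn_hessian A B).differentiableAt (D.isOpen_cone.mem_nhds hz)).comp z
    (hasFDerivAt_homogeneous z).differentiableAt

theorem differentiableAt_gradient_sum : DifferentiableAt ℝ (fun w =>
    ∑ B, fderiv ℂ D.F (homogeneous w) (Pi.single B 1) * conj (homogeneous w B)) z :=
  DifferentiableAt.fun_sum fun B _ =>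
    ((differentiableAt_gradient_homogeneous hz B).restrictScalars ℝ).mul
      ((hasFDerivAt_homogeneous_apply z B).differentiableAt.restrictScalars ℝ).conj_comp

/-- F_B is holomorphic, so the antiholomorphic derivative only sees conj Z^B, and of these only the
one with B = b. -/
theorem wirtingerBar_gradient_sum (b : Fin m) :
    wirtingerBar b (fun w => ∑ B, fderiv ℂ D.F (homogeneous w) (Pi.single B 1)
        * conj (homogeneous w B)) z
      = fderiv ℂ D.F (homogeneous z) (Pi.single b.castSucc 1) := by
  have h1 := fun B => (differentiableAt_gradient_homogeneous hz B)
  have h2 := fun B => ((hasFDerivAt_homogeneous_apply z B).differentiableAt.restrictScalars ℝ)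
  rw [wirtingerBar_sum b _ fun B _ => ((h1 B).restrictScalars ℝ).fun_mul (h2 B).conj_comp]
  simp_rw [wirtingerBar_mul b ((h1 _).restrictScalars ℝ) (h2 _).conj_comp,
    wirtingerBar_of_differentiableAt b (h1 _), wirtingerBar_conj b (h2 _), wirtinger_homogeneous]
  rw [Finset.sum_eq_single b.castSucc]
  · simp
  · intro B _ hB
    simp [hB]
  · simp

theorem wirtinger_gradient_sum (b : Fin m) :
    wirtinger b (fun w => ∑ B, fderiv ℂ D.F (homogeneous w) (Pi.single B 1)
        * conj (homogeneous w B)) z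
      = ∑ B, prepotentialHessian D.F (homogeneous z) b.castSucc B * conj (homogeneous z B) := by
  have h1 := fun B => (differentiableAt_gradient_homogeneous hz B)
  have h2 := fun B => ((hasFDerivAt_homogeneous_apply z B).differentiableAt.restrictScalars ℝ)
  rw [wirtinger_sum b _ fun B _ => ((h1 B).restrictScalars ℝ).fun_mul (h2 B).conj_comp]
  refine Finset.sum_congr rfl fun B _ => ?_
  rw [wirtinger_mul b ((h1 _).restrictScalars ℝ) (h2 _).conj_comp,
    wirtinger_of_differentiableAt b (h1 _), wirtinger_conj b (h2 _), wirtingerBar_homogeneous,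
    fderiv_gradient_homogeneous hz]
  simp

theorem ofReal_norm_eventuallyEq :
    (fun w => ((-2 * hermitianNorm D.F (homogeneous w) : ℝ) : ℂ)) =ᶠ[nhds z] fun w =>
      Complex.I * (∑ B, fderiv ℂ D.F (homogeneous w) (Pi.single B 1) * conj (homogeneous w B)
        - conj (∑ B, fderiv ℂ D.F (homogeneous w) (Pi.single B 1) * conj (homogeneous w B))) := by
  filter_upwards [D.isOpen_base.mem_nhds hz] with w hw
  exact D.ofReal_neg_two_mul_hermitianNorm hw

theorem differentiableAt_norm :
    DifferentiableAt ℝ (fun w => -2 * hermitianNorm D.F (homogeneous w)) z := by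
  have h : DifferentiableAt ℝ (fun w => ((-2 * hermitianNorm D.F (homogeneous w) : ℝ) : ℂ)) z :=
    (((differentiableAt_gradient_sum hz).sub (differentiableAt_gradient_sum hz).conj_comp).const_mul
      Complex.I).congr_of_eventuallyEq (ofReal_norm_eventuallyEq hz)
  exact Complex.reCLM.differentiableAt.comp z h

theorem wirtingerBar_norm (b : Fin m) :
    wirtingerBar b (fun w => ((-2 * hermitianNorm D.F (homogeneous w) : ℝ) : ℂ)) z
      = Complex.I * ∑ B, homogeneous z B * (prepotentialHessian D.F (homogeneous z) b.castSucc B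
        - conj (prepotentialHessian D.F (homogeneous z) b.castSucc B)) := by
  have h := differentiableAt_gradient_sum hz
  rw [(ofReal_norm_eventuallyEq hz).wirtingerBar_eq,
    wirtingerBar_const_mul b _ (h.fun_sub h.conj_comp), wirtingerBar_sub b h h.conj_comp,
    wirtingerBar_conj b h, wirtingerBar_gradient_sum hz, wirtinger_gradient_sum hz,
    ← D.sum_mul_hessian hz]
  simp only [map_sum, map_mul, Complex.conj_conj, ← Finset.sum_sub_distrib]
  congr 1
  refine Finset.sum_congr rfl fun B _ => ?_
  rw [D.hessian_symm hz B]
  ring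

theorem wirtinger_norm (b : Fin m) :
    wirtinger b (fun w => ((-2 * hermitianNorm D.F (homogeneous w) : ℝ) : ℂ)) z
      = conj (wirtingerBar b
          (fun w => ((-2 * hermitianNorm D.F (homogeneous w) : ℝ) : ℂ)) z) := by
  have h : DifferentiableAt ℝ (fun w => ((-2 * hermitianNorm D.F (homogeneous w) : ℝ) : ℂ)) z :=
    Complex.ofRealCLM.differentiableAt.comp z (differentiableAt_norm hz)
  rw [← wirtinger_conj b h]
  simp only [Complex.conj_ofReal]

/-- By Euler's relation the first derivative is i (F_b - Z^B conj F_{bB}). Here F_b is holomorphic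
and the coefficients conj F_{bB} are antiholomorphic, so no third derivatives of F appear. -/
theorem wirtinger_wirtingerBar_norm (a b : Fin m) :
    wirtinger a (wirtingerBar b
        (fun w => ((-2 * hermitianNorm D.F (homogeneous w) : ℝ) : ℂ))) z
      = -2 * (imHessian D.F (homogeneous z) a.castSucc b.castSucc : ℂ) := by
  have h1 := fun B => ((hasFDerivAt_homogeneous_apply z B).differentiableAt.restrictScalars ℝ)
  have h2 := fun A B => (differentiableAt_hessian_homogeneous hz A B)
  have h3 := fun A B => (h2 A B).restrictScalars ℝ
  have heq : (wirtingerBar b (fun w => ((-2 * hermitianNorm D.F (homogeneous w) : ℝ) : ℂ)))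
      =ᶠ[nhds z] fun w => Complex.I * (fderiv ℂ D.F (homogeneous w) (Pi.single b.castSucc 1)
        - ∑ B, homogeneous w B * conj (prepotentialHessian D.F (homogeneous w) b.castSucc B)) := by
    filter_upwards [D.isOpen_base.mem_nhds hz] with w hw
    rw [wirtingerBar_norm hw, ← D.sum_mul_hessian hw]
    simp only [mul_sub, Finset.sum_sub_distrib]
    congr 2
    refine Finset.sum_congr rfl fun B _ => ?_
    rw [D.hessian_symm hw]
  have hg := differentiableAt_gradient_homogeneous hz b.castSucc
  have hs : ∀ B, DifferentiableAt ℝ (fun w => homogeneous w B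
      * conj (prepotentialHessian D.F (homogeneous w) b.castSucc B)) z := fun B =>
    (h1 B).fun_mul (h3 _ B).conj_comp
  rw [heq.wirtinger_eq, wirtinger_const_mul a _
    ((hg.restrictScalars ℝ).fun_sub (DifferentiableAt.fun_sum fun B _ => hs B)),
    wirtinger_sub a (hg.restrictScalars ℝ) (DifferentiableAt.fun_sum fun B _ => hs B),
    wirtinger_of_differentiableAt a hg, fderiv_gradient_homogeneous hz,
    wirtinger_sum a _ fun B _ => hs B]
  have : ∀ B, wirtinger a (fun w => homogeneous w B
      * conj (prepotentialHessian D.F (homogeneous w) b.castSucc B)) z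
      = (Pi.single a.castSucc 1 : Fin (m + 1) → ℂ) B
        * conj (prepotentialHessian D.F (homogeneous z) b.castSucc B) := by
    intro B
    rw [wirtinger_mul a (h1 B) (h3 _ B).conj_comp, wirtinger_homogeneous,
      wirtinger_conj a (h3 _ B), wirtingerBar_of_differentiableAt a (h2 _ B)]
    simp
  simp_rw [this]
  rw [Finset.sum_eq_single a.castSucc (by intro B _ hB; simp [hB]) (by simp), Pi.single_eq_same,
    one_mul, ofReal_imHessian, D.hessian_symm hz b.castSucc]
  have := Complex.I_ne_zero
  field_simp
  rw [Complex.I_sq]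
  ring

/-- For K = -log h the mixed derivative is -h_{a b̄}/h + h_a h_{b̄}/h², into which h_{b̄} = -2
(NZ)_b and h_{a b̄} = -2 N_{ab} are inserted. -/
theorem kahlerMetricMatrix_eq (a b : Fin m) :
    kahlerMetricMatrix D.F z a b
      = 2 * (imHessian D.F (homogeneous z) a.castSucc b.castSucc : ℂ)
          / ((-2 * hermitianNorm D.F (homogeneous z) : ℝ) : ℂ)
        + 4 * conj (∑ A, (imHessian D.F (homogeneous z) a.castSucc A : ℂ) * homogeneous z A)
          * (∑ A, (imHessian D.F (homogeneous z) b.castSucc A : ℂ) * homogeneous z A)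
          / ((-2 * hermitianNorm D.F (homogeneous z) : ℝ) : ℂ) ^ 2 := by
  set h : (Fin m → ℂ) → ℝ := fun w => -2 * hermitianNorm D.F (homogeneous w) with hh
  have hpos : ∀ w ∈ D.base, 0 < h w := fun w hw => D.norm_pos _ hw
  have hq : ∀ b, wirtingerBar b (fun w => (h w : ℂ)) z
      = -2 * ∑ A, (imHessian D.F (homogeneous z) b.castSucc A : ℂ) * homogeneous z A := by
    intro b
    rw [wirtingerBar_norm hz, Finset.mul_sum, Finset.mul_sum]
    refine Finset.sum_congr rfl fun B _ => ?_
    rw [ofReal_imHessian]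
    have := Complex.I_ne_zero
    field_simp
    rw [Complex.I_sq]
    ring
  have heq : wirtingerBar b (fun w => (kahlerPotential D.F w : ℂ)) =ᶠ[nhds z] fun w =>
      -1 * ((h w : ℂ)⁻¹ * wirtingerBar b (fun w => (h w : ℂ)) w) := by
    filter_upwards [D.isOpen_base.mem_nhds hz] with w hw
    rw [← wirtingerBar_log b (differentiableAt_norm hw) (hpos w hw).ne']
    have hd : DifferentiableAt ℝ (fun w => (Real.log (h w) : ℂ)) w :=
      Complex.ofRealCLM.differentiableAt.comp w ((differentiableAt_norm hw).log (hpos w hw).ne')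
    rw [← wirtingerBar_const_mul b _ hd]
    simp [kahlerPotential, hh]
  have hne : (h z : ℂ) ≠ 0 := Complex.ofReal_ne_zero.2 (hpos z hz).ne'
  have hd : DifferentiableAt ℝ (fun w => (h w : ℂ)) z :=
    Complex.ofRealCLM.differentiableAt.comp z (differentiableAt_norm hz)
  have hdq : DifferentiableAt ℝ (wirtingerBar b (fun w => (h w : ℂ))) z := by
    have h0 : DifferentiableAt ℝ (fun w => Complex.I * ∑ B, homogeneous w B
        * (prepotentialHessian D.F (homogeneous w) b.castSucc B
          - conj (prepotentialHessian D.F (homogeneous w) b.castSucc B))) z := by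
      refine DifferentiableAt.const_mul (DifferentiableAt.fun_sum fun B _ => ?_) _
      have h3 := (differentiableAt_hessian_homogeneous hz b.castSucc B).restrictScalars ℝ
      exact ((hasFDerivAt_homogeneous_apply z B).differentiableAt.restrictScalars ℝ).mul
        (h3.fun_sub h3.conj_comp)
    refine h0.congr_of_eventuallyEq ?_
    filter_upwards [D.isOpen_base.mem_nhds hz] with w hw using wirtingerBar_norm hw b
  rw [kahlerMetricMatrix, Matrix.of_apply, heq.wirtinger_eq,
    wirtinger_const_mul a _ ((hd.fun_inv hne).fun_mul hdq), wirtinger_mul a (hd.fun_inv hne) hdq,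
    wirtinger_inv a hd hne, wirtinger_norm hz, wirtinger_wirtingerBar_norm hz, hq, hq]
  change _ = 2 * _ / (h z : ℂ) + _ / (h z : ℂ) ^ 2
  simp only [map_mul, map_neg, map_ofNat]
  field_simp
  ring

end Potential

end ProjectiveSpecialKahlerDomain

/-! ### Sesquilinear forms of real matrices -/

section Sesquilinear

variable {ι : Type*} [Fintype ι]

/-- The sesquilinear form `X^A N_{AB} \bar Y^B` of a real matrix. -/
noncomputable def Matrix.sesq (N : Matrix ι ι ℝ) (X Y : ι → ℂ) : ℂ :=
  ∑ A, ∑ B, X A * (N A B : ℂ) * conj (Y B)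

variable {N : Matrix ι ι ℝ}

theorem Matrix.sesq_sub_left (X X' Y : ι → ℂ) :
    N.sesq (X - X') Y = N.sesq X Y - N.sesq X' Y := by
  simp only [Matrix.sesq, Pi.sub_apply, sub_mul, Finset.sum_sub_distrib]

theorem Matrix.sesq_sub_right (X Y Y' : ι → ℂ) :
    N.sesq X (Y - Y') = N.sesq X Y - N.sesq X Y' := by
  simp only [Matrix.sesq, Pi.sub_apply, map_sub, mul_sub, Finset.sum_sub_distrib]

theorem Matrix.sesq_smul_left (c : ℂ) (X Y : ι → ℂ) :
    N.sesq (c • X) Y = c * N.sesq X Y := by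
  simp only [Matrix.sesq, Pi.smul_apply, smul_eq_mul, Finset.mul_sum, mul_assoc]

theorem Matrix.sesq_smul_right (c : ℂ) (X Y : ι → ℂ) :
    N.sesq X (c • Y) = conj c * N.sesq X Y := by
  simp only [Matrix.sesq, Pi.smul_apply, smul_eq_mul, Finset.mul_sum, map_mul]
  refine Finset.sum_congr rfl fun A _ => Finset.sum_congr rfl fun B _ => ?_
  ring

theorem Matrix.sesq_eq_sum_mulVec (X Y : ι → ℂ) :
    N.sesq X Y = ∑ A, X A * ∑ B, (N A B : ℂ) * conj (Y B) := by
  simp only [Matrix.sesq, Finset.mul_sum, mul_assoc]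

theorem Matrix.sesq_conj (hN : ∀ A B, N A B = N B A) (X Y : ι → ℂ) :
    conj (N.sesq X Y) = N.sesq Y X := by
  simp only [Matrix.sesq, map_sum, map_mul, Complex.conj_conj, Complex.conj_ofReal]
  rw [Finset.sum_comm]
  refine Finset.sum_congr rfl fun A _ => Finset.sum_congr rfl fun B _ => ?_
  rw [hN]
  ring

end Sesquilinear

/-! ### Projection along Z, and invertibility of N -/

namespace ProjectiveSpecialKahlerDomain

variable {m : ℕ} (D : ProjectiveSpecialKahlerDomain m)
  {e : (Fin m → ℂ) → Matrix (Fin m) (Fin m) ℂ} (he : D.IsVielbein e)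

/-- The positive function `e^{-K} = -2 Z^A N_{AB} \bar Z^B` on `M_sk`. -/
noncomputable def coneNorm (z : Fin m → ℂ) : ℝ := -2 * hermitianNorm D.F (homogeneous z)

variable (e) in
/-- The projection of a vector of `ℂ^n` to the tangent space of `M_sk`, in the frame dual to `e`. -/
noncomputable def frameProj (z : Fin m → ℂ) (X : Fin (m + 1) → ℂ) (β : Fin m) : ℂ :=
  ∑ A, X A * projectedVielbein e z A β

/-- In this form the projection visibly kills Z = (z, 1): only X minus its last component times Z
enters. -/
theorem frameProj_eq (z : Fin m → ℂ) (X : Fin (m + 1) → ℂ) (β : Fin m) :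
    frameProj e z X β = ∑ a : Fin m, (X a.castSucc - X (Fin.last m) * z a) * e z a β := by
  simp only [frameProj, Fin.sum_univ_castSucc, projectedVielbein, Fin.snoc_castSucc, Fin.snoc_last,
    sub_mul, Finset.sum_sub_distrib, mul_neg, Finset.mul_sum, ← sub_eq_add_neg, mul_assoc]

variable {D} {z : Fin m → ℂ} (hz : z ∈ D.base)
include hz

theorem coneNorm_pos : 0 < D.coneNorm z := D.norm_pos _ hz

theorem exp_kahlerPotential : Real.exp (kahlerPotential D.F z) = (D.coneNorm z)⁻¹ := by
  rw [kahlerPotential, Real.exp_neg, Real.exp_log (D.norm_pos _ hz), coneNorm]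

theorem sesq_homogeneous :
    (imHessian D.F (homogeneous z)).sesq (homogeneous z) (homogeneous z)
      = -(D.coneNorm z : ℂ) / 2 := by
  rw [Matrix.sesq, ← D.ofReal_hermitianNorm hz, coneNorm]
  push_cast
  ring

include he

theorem sum_vielbein_mul_conj (X Y : Fin m → ℂ) :
    ∑ β, (∑ a, X a * e z a β) * conj (∑ a, Y a * e z a β)
      = ∑ a, ∑ c, X a * kahlerMetricMatrix D.F z a c * conj (Y c) := by
  simp only [map_sum, map_mul]
  simp_rw [Finset.sum_mul_sum, ← he.unitary z hz, Finset.mul_sum, Finset.sum_mul]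
  rw [Finset.sum_comm]
  refine Finset.sum_congr rfl fun a _ => ?_
  rw [Finset.sum_comm]
  refine Finset.sum_congr rfl fun c _ => Finset.sum_congr rfl fun β _ => ?_
  ring

/-- Both sides are unchanged when multiples of Z are subtracted from X or Y: the left by the form of
Π, the right because N(Z,Z) = -h/2. This reduces to vectors with last component zero, where the
identity is the formula for K_{a b̄} combined with unitarity of the vielbein. -/
theorem sum_frameProj_mul_conj (X Y : Fin (m + 1) → ℂ) :
    ∑ β, frameProj e z X β * conj (frameProj e z Y β)
      = 2 / (D.coneNorm z : ℂ) * (imHessian D.F (homogeneous z)).sesq X Y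
        + 4 / (D.coneNorm z : ℂ) ^ 2 * (imHessian D.F (homogeneous z)).sesq X (homogeneous z)
          * (imHessian D.F (homogeneous z)).sesq (homogeneous z) Y := by
  set N := imHessian D.F (homogeneous z) with hN
  set Z := homogeneous z with hZ
  set h : ℂ := (D.coneNorm z : ℂ) with hh
  have hh0 : h ≠ 0 := Complex.ofReal_ne_zero.2 (coneNorm_pos hz).ne'
  -- The representatives with vanishing last component; only the block N_{ab} of N and the pairings
  -- with Z survive on them.
  set X₀ := X - X (Fin.last m) • Z with hX₀
  set Y₀ := Y - Y (Fin.last m) • Z with hY₀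
  have hX : ∀ a : Fin m, X a.castSucc - X (Fin.last m) * z a = X₀ a.castSucc := by
    intro a; simp [hX₀, hZ]
  have hY : ∀ a : Fin m, Y a.castSucc - Y (Fin.last m) * z a = Y₀ a.castSucc := by
    intro a; simp [hY₀, hZ]
  have hXl : X₀ (Fin.last m) = 0 := by simp [hX₀, hZ]
  have hYl : Y₀ (Fin.last m) = 0 := by simp [hY₀, hZ]
  have hsymm : ∀ A B, N A B = N B A := D.imHessian_symm hz
  have h1 : ∑ β, frameProj e z X β * conj (frameProj e z Y β)
      = ∑ a : Fin m, ∑ c : Fin m, X₀ a.castSucc * kahlerMetricMatrix D.F z a c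
        * conj (Y₀ c.castSucc) := by
    simp only [frameProj_eq, hX, hY]
    exact sum_vielbein_mul_conj he hz _ _
  have h2 : ∑ β, frameProj e z X β * conj (frameProj e z Y β)
      = 2 / h * N.sesq X₀ Y₀ + 4 / h ^ 2 * N.sesq X₀ Z * N.sesq Z Y₀ := by
    have e1 : N.sesq X₀ Y₀ = ∑ a : Fin m, ∑ c : Fin m,
        X₀ a.castSucc * (N a.castSucc c.castSucc : ℂ) * conj (Y₀ c.castSucc) := by
      simp only [Matrix.sesq, Fin.sum_univ_castSucc, hXl, hYl, zero_mul, map_zero, mul_zero,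
        Finset.sum_const_zero, add_zero]
    have e2 : N.sesq X₀ Z = ∑ a : Fin m,
        X₀ a.castSucc * conj (∑ A, (N a.castSucc A : ℂ) * Z A) := by
      rw [Matrix.sesq_eq_sum_mulVec, Fin.sum_univ_castSucc, hXl]
      simp only [zero_mul, add_zero, map_sum, map_mul, Complex.conj_ofReal]
    have e3 : N.sesq Z Y₀ = ∑ a : Fin m,
        (∑ A, (N a.castSucc A : ℂ) * Z A) * conj (Y₀ a.castSucc) := by
      rw [Matrix.sesq, Finset.sum_comm, Fin.sum_univ_castSucc, hYl]
      simp only [map_zero, mul_zero, Finset.sum_const_zero, add_zero, Finset.sum_mul]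
      refine Finset.sum_congr rfl fun a _ => Finset.sum_congr rfl fun A _ => ?_
      rw [hsymm]
      ring
    rw [h1, e1, e2, e3, mul_assoc, Finset.sum_mul_sum, Finset.mul_sum, Finset.mul_sum,
      ← Finset.sum_add_distrib]
    refine Finset.sum_congr rfl fun a _ => ?_
    rw [Finset.mul_sum, Finset.mul_sum, ← Finset.sum_add_distrib]
    refine Finset.sum_congr rfl fun c _ => ?_
    rw [kahlerMetricMatrix_eq hz]
    change X₀ a.castSucc * (2 * _ / h + 4 * _ * _ / h ^ 2) * _ = _
    ring
  have hZZ : N.sesq Z Z = -h / 2 := sesq_homogeneous hz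
  rw [h2, hX₀, hY₀]
  simp only [Matrix.sesq_sub_left, Matrix.sesq_sub_right, Matrix.sesq_smul_left,
    Matrix.sesq_smul_right, hZZ]
  field_simp
  ring

/-- A unitary coframe of a positive definite metric is nondegenerate, so the kernel of Π is exactly
the line through Z. -/
theorem frameProj_eq_zero {X : Fin (m + 1) → ℂ} (hX : ∀ β, frameProj e z X β = 0) :
    X = X (Fin.last m) • homogeneous z := by
  have hker : ∀ Y : Fin m → ℂ, (∀ β, ∑ a, Y a * e z a β = 0) → Y = 0 := by
    intro Y hY
    by_contra hne
    -- The vector is conjugated since `Matrix.PosDef` puts the conjugate on the left, whereas K_{a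
    -- b̄} is contracted here with Y^a conj Y^b.
    have hpos := (D.metric_posDef z hz).dotProduct_mulVec_pos (x := star Y) (by simpa using hne)
    have h0 : star (star Y) ⬝ᵥ (kahlerMetricMatrix D.F z).mulVec (star Y)
        = ∑ β, (∑ a, Y a * e z a β) * conj (∑ a, Y a * e z a β) := by
      rw [sum_vielbein_mul_conj he hz]
      simp [dotProduct, Matrix.mulVec, Finset.mul_sum, mul_assoc]
    rw [h0] at hpos
    simp [hY] at hpos
  have h := hker (fun a => X a.castSucc - X (Fin.last m) * z a) fun β => by
    rw [← frameProj_eq, hX]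
  ext A
  refine Fin.lastCases (by simp) (fun a => ?_) A
  have := congrFun h a
  simp only [Pi.zero_apply, sub_eq_zero] at this
  simp [this]

/-- A null vector X of N has vanishing projection by `sum_frameProj_mul_conj`, so X = cZ. Then 0 =
N(Z,X) = -conj(c) h/2 forces c = 0. -/
theorem isUnit_det_imHessian : IsUnit (imHessian D.F (homogeneous z)).det := by
  set N := imHessian D.F (homogeneous z) with hN
  rw [isUnit_iff_ne_zero]
  intro h0
  obtain ⟨x, hx0, hx⟩ := Matrix.exists_mulVec_eq_zero_iff.2 h0
  set X : Fin (m + 1) → ℂ := fun A => (x A : ℂ) with hX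
  have hsymm : ∀ A B, N A B = N B A := D.imHessian_symm hz
  have hNX : ∀ Y, N.sesq Y X = 0 := by
    intro Y
    rw [Matrix.sesq_eq_sum_mulVec]
    refine Finset.sum_eq_zero fun A _ => ?_
    have : ∑ B, (N A B : ℂ) * conj (X B) = ((N.mulVec x A : ℝ) : ℂ) := by
      simp [hX, Matrix.mulVec, dotProduct]
    rw [this, hx]
    simp
  have h1 := sum_frameProj_mul_conj he hz X X
  rw [hNX, hNX] at h1
  have h2 : ∀ β, frameProj e z X β = 0 := by
    have : ∑ β, Complex.normSq (frameProj e z X β) = 0 := by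
      have h3 := h1
      simp only [Complex.mul_conj, mul_zero, add_zero, ← Complex.ofReal_sum] at h3
      exact_mod_cast h3
    intro β
    exact Complex.normSq_eq_zero.1
      ((Finset.sum_eq_zero_iff_of_nonneg fun _ _ => Complex.normSq_nonneg _).1 this β
        (Finset.mem_univ β))
  have h3 := frameProj_eq_zero he hz h2
  have h4 := hNX (homogeneous z)
  rw [h3, Matrix.sesq_smul_right, sesq_homogeneous hz] at h4
  have h5 : X (Fin.last m) = 0 := by
    have := coneNorm_pos hz
    simpa [this.ne'] using h4
  rw [h5, zero_smul] at h3
  refine hx0 (funext fun A => ?_)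
  exact Complex.ofReal_eq_zero.1 (congrFun h3 A)

end ProjectiveSpecialKahlerDomain

/-! ### Algebra of the forms u and E -/

namespace ProjectiveSpecialKahlerDomain

variable {m : ℕ}

/-- The complex vector `b_A - H_{AB} a^B`. -/
def fibreVec (H : Matrix (Fin (m + 1)) (Fin (m + 1)) ℂ) (a b : Fin (m + 1) → ℝ)
    (A : Fin (m + 1)) : ℂ :=
  (b A : ℂ) - ∑ B, H A B * (a B : ℂ)

/-- The vector `N^{AB} \bar W_B`. -/
noncomputable def raise (N : Matrix (Fin (m + 1)) (Fin (m + 1)) ℝ) (W : Fin (m + 1) → ℂ)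
    (A : Fin (m + 1)) : ℂ :=
  ∑ B, ((N⁻¹ A B : ℝ) : ℂ) * conj (W B)

theorem sum_mul_raise {N : Matrix (Fin (m + 1)) (Fin (m + 1)) ℝ} (hN : IsUnit N.det)
    (W : Fin (m + 1) → ℂ) (A : Fin (m + 1)) :
    ∑ B, (N A B : ℂ) * raise N W B = conj (W A) := by
  have h : ∀ C, ∑ B, (N A B : ℂ) * ((N⁻¹ B C : ℝ) : ℂ) = (1 : Matrix _ _ ℂ) A C := by
    intro C
    have := congrFun (congrFun (Matrix.mul_nonsing_inv N hN) A) C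
    rw [Matrix.mul_apply] at this
    rw [Matrix.one_apply, ← Complex.ofReal_one, ← Complex.ofReal_zero, ← apply_ite Complex.ofReal,
      ← Matrix.one_apply, ← this]
    push_cast
    rfl
  simp only [raise, Finset.mul_sum]
  rw [Finset.sum_comm]
  simp only [← mul_assoc, ← Finset.sum_mul, h, Matrix.one_apply, ite_mul, one_mul, zero_mul,
    Finset.sum_ite_eq, Finset.mem_univ, if_true]

theorem sesq_raise_right {N : Matrix (Fin (m + 1)) (Fin (m + 1)) ℝ} (hN : IsUnit N.det)
    (X W : Fin (m + 1) → ℂ) : N.sesq X (raise N W) = ∑ A, X A * W A := by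
  rw [Matrix.sesq_eq_sum_mulVec]
  refine Finset.sum_congr rfl fun A _ => ?_
  rw [← Complex.conj_conj (W A), ← sum_mul_raise hN W A]
  simp

theorem sesq_raise_left {N : Matrix (Fin (m + 1)) (Fin (m + 1)) ℝ} (hN : IsUnit N.det)
    (hs : ∀ A B, N A B = N B A) (X W : Fin (m + 1) → ℂ) :
    N.sesq (raise N W) X = conj (∑ A, X A * W A) := by
  rw [← Matrix.sesq_conj hs, sesq_raise_right hN]

/-- The symplectic form of the fibre in terms of the complex vectors `b_A - H_{AB} a^B`. -/
theorem im_sesq_raise_fibreVec {H : Matrix (Fin (m + 1)) (Fin (m + 1)) ℂ}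
    (hH : ∀ A B, H A B = H B A) {N : Matrix (Fin (m + 1)) (Fin (m + 1)) ℝ}
    (hN : IsUnit N.det) (hHN : ∀ A B, (H A B).im = N A B) (a b a' b' : Fin (m + 1) → ℝ) :
    (N.sesq (raise N (fibreVec H a b)) (raise N (fibreVec H a' b'))).im
      = -∑ A, (b A * a' A - a A * b' A) := by
  -- With H = R + iN, the raised vector of b - Ha is N⁻¹(b - Ra) + i a. Its imaginary part no longer
  -- involves H, and in the final expression the symmetric R cancels.
  set R : Matrix (Fin (m + 1)) (Fin (m + 1)) ℝ := Matrix.of fun A B => (H A B).re with hR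
  have hRs : R.transpose = R := by ext A B; simp [hR, hH A B]
  have hNs : N.transpose = N := by ext A B; simp [← hHN, hH A B]
  have hre : ∀ a b A, (fibreVec H a b A).re = (b - R.mulVec a) A := by
    intro a b A
    simp [fibreVec, Matrix.mulVec, dotProduct, hR]
  have him : ∀ a b A, (fibreVec H a b A).im = -(N.mulVec a) A := by
    intro a b A
    simp [fibreVec, Matrix.mulVec, dotProduct, hHN]
  have h1 : ∀ a b A, (raise N (fibreVec H a b) A).re = (N⁻¹.mulVec (b - R.mulVec a)) A := by
    intro a b A
    simp only [raise, Complex.re_sum, Complex.re_ofReal_mul, Complex.conj_re, hre, Matrix.mulVec,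
      dotProduct]
  have h2 : ∀ a b A, (raise N (fibreVec H a b) A).im = a A := by
    intro a b A
    simp only [raise, Complex.im_sum, Complex.im_ofReal_mul, Complex.conj_im, him, neg_neg]
    change (N⁻¹.mulVec (N.mulVec a)) A = a A
    rw [Matrix.mulVec_mulVec, Matrix.nonsing_inv_mul N hN, Matrix.one_mulVec]
  rw [sesq_raise_right hN]
  simp only [Complex.im_sum, Complex.mul_im, h1, h2, hre, him]
  have e1 : (N⁻¹.mulVec (b - R.mulVec a)) ⬝ᵥ (N.mulVec a') = (b - R.mulVec a) ⬝ᵥ a' := by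
    rw [Matrix.dotProduct_mulVec, ← Matrix.mulVec_transpose, hNs, Matrix.mulVec_mulVec,
      Matrix.mul_nonsing_inv N hN, Matrix.one_mulVec]
  have e2 : R.mulVec a ⬝ᵥ a' = a ⬝ᵥ R.mulVec a' := by
    rw [Matrix.dotProduct_mulVec, ← Matrix.mulVec_transpose, hRs]
  have e3 : ∑ A, (N⁻¹.mulVec (b - R.mulVec a) A * -(N.mulVec a') A + a A * (b' - R.mulVec a') A)
      = -(N⁻¹.mulVec (b - R.mulVec a) ⬝ᵥ (N.mulVec a')) + a ⬝ᵥ (b' - R.mulVec a') := by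
    simp [dotProduct, Finset.sum_add_distrib]
  have e4 : -∑ A, (b A * a' A - a A * b' A) = -(b ⬝ᵥ a') + a ⬝ᵥ b' := by
    simp only [dotProduct, Finset.sum_sub_distrib]
    ring
  rw [e3, e1, e4, sub_dotProduct, dotProduct_sub, e2]
  ring

variable (D : ProjectiveSpecialKahlerDomain m) (e : (Fin m → ℂ) → Matrix (Fin m) (Fin m) ℂ)

/-- The vector `db_A - F_{AB} da^B` at the point `(z, 1)`. -/
noncomputable def baseVec (z : Fin m → ℂ) (a b : Fin (m + 1) → ℝ) : Fin (m + 1) → ℂ :=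
  fibreVec (prepotentialHessian D.F (homogeneous z)) a b

theorem formU_eq (p X : TotalSpace m) :
    D.formU p X = Complex.I * (Real.exp (kahlerPotential D.F p.1 / 2 + p.2.1) : ℂ) *
      ∑ A, homogeneous p.1 A * D.baseVec p.1 X.2.2.2.1 X.2.2.2.2 A := rfl

theorem formV_eq (p X : TotalSpace m) :
    formV p X = -(X.2.1 : ℂ) - Complex.I * ((Real.exp (2 * p.2.1) / 2 *
      (X.2.2.1 + ∑ A, (p.2.2.2.2 A * X.2.2.2.1 A - p.2.2.2.1 A * X.2.2.2.2 A)) : ℝ) : ℂ) := by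
  have h : formV p X = (1 / 2 : ℂ) * (Real.exp (2 * p.2.1) : ℂ) *
      (((-2 * Real.exp (-2 * p.2.1) * X.2.1 : ℝ) : ℂ) - Complex.I * ((X.2.2.1
        + ∑ A, (p.2.2.2.2 A * X.2.2.2.1 A - p.2.2.2.1 A * X.2.2.2.2 A) : ℝ) : ℂ)) := rfl
  have h2 : (Real.exp (2 * p.2.1) : ℂ) * (Real.exp (-2 * p.2.1) : ℂ) = 1 := by
    rw [← Complex.ofReal_mul, ← Real.exp_add]
    simp
  rw [h]
  simp only [Complex.ofReal_mul, Complex.ofReal_div, Complex.ofReal_neg, Complex.ofReal_ofNat]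
    at h2 ⊢
  linear_combination -(X.2.1 : ℂ) * h2

theorem formE_eq (β : Fin m) (p X : TotalSpace m) :
    D.formE e β p X = -(Complex.I / 2) * (Real.exp (p.2.1 - kahlerPotential D.F p.1 / 2) : ℂ) *
      frameProj e p.1 (raise (imHessian D.F (homogeneous p.1))
        (D.baseVec p.1 X.2.2.2.1 X.2.2.2.2)) β := by
  have h : D.formE e β p X
    = -(Complex.I / 2) * (Real.exp (p.2.1 - kahlerPotential D.F p.1 / 2) : ℂ) *
      ∑ A, ∑ B, projectedVielbein e p.1 A β
        * ((imHessian D.F (homogeneous p.1))⁻¹ A B : ℂ)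
        * ((X.2.2.2.2 B : ℂ)
          - ∑ C, conj (prepotentialHessian D.F (homogeneous p.1) B C) * (X.2.2.2.1 C : ℂ)) := rfl
  rw [h, frameProj]
  congr 1
  refine Finset.sum_congr rfl fun A _ => ?_
  rw [raise, Finset.sum_mul]
  refine Finset.sum_congr rfl fun B _ => ?_
  simp only [baseVec, fibreVec, map_sub, map_sum, map_mul, Complex.conj_ofReal]
  ring

variable {D e} (he : D.IsVielbein e) {z : Fin m → ℂ} (hz : z ∈ D.base)
include he hz

/-- The second hypothesis puts the raised vector on the line of Z; the first is its N-product with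
Z, which is nonzero on that line except at the origin. So u and E together determine W. -/
theorem eq_zero_of_frameProj_raise_eq_zero {W : Fin (m + 1) → ℂ}
    (h1 : ∑ A, homogeneous z A * W A = 0)
    (h2 : ∀ β, frameProj e z (raise (imHessian D.F (homogeneous z)) W) β = 0) : W = 0 := by
  set N := imHessian D.F (homogeneous z) with hN
  have hu : IsUnit N.det := isUnit_det_imHessian he hz
  have h3 := frameProj_eq_zero he hz h2
  have h4 := sesq_raise_right hu (homogeneous z) W
  rw [h1, h3, Matrix.sesq_smul_right, sesq_homogeneous hz] at h4
  have h5 : raise N W (Fin.last m) = 0 := by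
    simpa [(coneNorm_pos hz).ne'] using h4
  rw [h5, zero_smul] at h3
  ext A
  have h6 := sum_mul_raise hu W A
  rw [h3] at h6
  simpa using h6.symm

/-- This is `sum_frameProj_mul_conj` at the raised vectors, where N(Z, raised W) = Z^A W_A
reproduces u. Since E is antilinear in W, the u-term appears with the conjugate on the first
argument. -/
theorem sum_formE_mul_conj (p X Y : TotalSpace m) (hp : p.1 = z) :
    ∑ β, D.formE e β p X * conj (D.formE e β p Y)
      = (Real.exp (2 * p.2.1) : ℂ) / 2 *
        (imHessian D.F (homogeneous z)).sesq
          (raise (imHessian D.F (homogeneous z)) (D.baseVec z X.2.2.2.1 X.2.2.2.2))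
          (raise (imHessian D.F (homogeneous z)) (D.baseVec z Y.2.2.2.1 Y.2.2.2.2))
        + conj (D.formU p X) * D.formU p Y := by
  subst hp
  set N := imHessian D.F (homogeneous p.1) with hN
  have hu : IsUnit N.det := isUnit_det_imHessian he hz
  have hs : ∀ A B, N A B = N B A := D.imHessian_symm hz
  have hh := coneNorm_pos hz
  -- The squared prefactors of E and u are e^{2φ} h and e^{2φ}/h, up to numerical constants.
  have e1 : (Real.exp (p.2.1 - kahlerPotential D.F p.1 / 2) : ℂ) ^ 2
      = (Real.exp (2 * p.2.1) : ℂ) * (D.coneNorm p.1 : ℂ) := by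
    rw [← Complex.ofReal_pow, ← Real.exp_nat_mul, ← Complex.ofReal_mul]
    congr 1
    have : D.coneNorm p.1 = Real.exp (-kahlerPotential D.F p.1) := by
      rw [Real.exp_neg, exp_kahlerPotential hz, inv_inv]
    rw [this, ← Real.exp_add]
    congr 1
    push_cast
    ring
  have e2 : (Real.exp (kahlerPotential D.F p.1 / 2 + p.2.1) : ℂ) ^ 2
      = (Real.exp (2 * p.2.1) : ℂ) / (D.coneNorm p.1 : ℂ) := by
    rw [← Complex.ofReal_pow, ← Real.exp_nat_mul, ← Complex.ofReal_div]
    congr 1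
    rw [div_eq_mul_inv (Real.exp _), ← exp_kahlerPotential hz, ← Real.exp_add]
    congr 1
    push_cast
    ring
  set ε : ℂ := (Real.exp (p.2.1 - kahlerPotential D.F p.1 / 2) : ℂ) with hε
  set δ : ℂ := (Real.exp (kahlerPotential D.F p.1 / 2 + p.2.1) : ℂ) with hδ
  have hεc : conj ε = ε := Complex.conj_ofReal _
  have hδc : conj δ = δ := Complex.conj_ofReal _
  have h1 : ∑ β, D.formE e β p X * conj (D.formE e β p Y) = ε ^ 2 / 4 *
      ∑ β, frameProj e p.1 (raise N (D.baseVec p.1 X.2.2.2.1 X.2.2.2.2)) β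
        * conj (frameProj e p.1 (raise N (D.baseVec p.1 Y.2.2.2.1 Y.2.2.2.2)) β) := by
    rw [Finset.mul_sum]
    refine Finset.sum_congr rfl fun β _ => ?_
    rw [formE_eq, formE_eq, map_mul, map_mul, hεc]
    simp only [map_neg, map_div₀, Complex.conj_I, map_ofNat]
    linear_combination (-(1 / 4) * ε ^ 2
      * frameProj e p.1 (raise N (D.baseVec p.1 X.2.2.2.1 X.2.2.2.2)) β
        * conj (frameProj e p.1 (raise N (D.baseVec p.1 Y.2.2.2.1 Y.2.2.2.2)) β)) * Complex.I_sq
  rw [h1, sum_frameProj_mul_conj he hz, e1, sesq_raise_left hu hs (homogeneous p.1), sesq_raise_right hu (homogeneous p.1),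
    formU_eq, formU_eq, ← hδ]
  have hne : (D.coneNorm p.1 : ℂ) ≠ 0 := Complex.ofReal_ne_zero.2 hh.ne'
  simp only [map_mul, Complex.conj_I, hδc]
  have e3 : δ * δ = (Real.exp (2 * p.2.1) : ℂ) / (D.coneNorm p.1 : ℂ) := by rw [← e2, sq]
  generalize (∑ A, homogeneous p.1 A * D.baseVec p.1 X.2.2.2.1 X.2.2.2.2 A) = x at *
  generalize (∑ A, homogeneous p.1 A * D.baseVec p.1 Y.2.2.2.1 Y.2.2.2.2 A) = y at *
  have e4 : -Complex.I * δ * conj x * (Complex.I * δ * y)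
      = (Real.exp (2 * p.2.1) : ℂ) / (D.coneNorm p.1 : ℂ) * conj x * y := by
    rw [← e3]
    linear_combination (-δ * δ * conj x * y) * Complex.I_sq
  rw [e4]
  field_simp
  ring

/-- The terms u(X) conj u(Y) and conj(u(X)) u(Y) have opposite imaginary parts and cancel. What is
left is the symplectic form, independent of z; this is what makes all fibres hyperbolic. -/
theorem im_formU_add_sum_formE (p X Y : TotalSpace m) (hp : p.1 = z) :
    (D.formU p X * conj (D.formU p Y) + ∑ β, D.formE e β p X * conj (D.formE e β p Y)).im
      = -(Real.exp (2 * p.2.1) / 2) *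
        ∑ A, (X.2.2.2.2 A * Y.2.2.2.1 A - X.2.2.2.1 A * Y.2.2.2.2 A) := by
  rw [sum_formE_mul_conj he hz p X Y hp]
  have h := im_sesq_raise_fibreVec (D.hessian_symm hz) (isUnit_det_imHessian he hz)
    (fun A B => rfl) X.2.2.2.1 X.2.2.2.2 Y.2.2.2.1 Y.2.2.2.2
  have e1 : (Real.exp (2 * p.2.1) : ℂ) / 2 = ((Real.exp (2 * p.2.1) / 2 : ℝ) : ℂ) := by
    push_cast; rfl
  simp only [Complex.add_im, e1, Complex.im_ofReal_mul, baseVec]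
  rw [h]
  simp only [Complex.mul_im, Complex.conj_re, Complex.conj_im]
  ring

end ProjectiveSpecialKahlerDomain

/-! ### Smoothness of determinants and inverse matrices -/

section SmoothMatrix

variable {E : Type*} [NormedAddCommGroup E] [NormedSpace ℝ E] {S : Set E} {n : WithTop ℕ∞}
  {ι : Type*} [Fintype ι] [DecidableEq ι] {M : E → Matrix ι ι ℝ}

theorem ContDiffOn.matrix_det (hM : ∀ i j, ContDiffOn ℝ n (fun x => M x i j) S) :
    ContDiffOn ℝ n (fun x => (M x).det) S := by
  simp only [Matrix.det_apply']
  exact ContDiffOn.sum fun σ _ => contDiffOn_const.mul (contDiffOn_prod fun i _ => hM _ _)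

theorem ContDiffOn.matrix_inv (hM : ∀ i j, ContDiffOn ℝ n (fun x => M x i j) S)
    (hu : ∀ x ∈ S, IsUnit (M x).det) (i j : ι) :
    ContDiffOn ℝ n (fun x => (M x)⁻¹ i j) S := by
  simp only [Matrix.inv_def, Matrix.smul_apply, Ring.inverse_eq_inv', smul_eq_mul,
    Matrix.adjugate_apply]
  refine ((ContDiffOn.matrix_det hM).inv fun x hx => (hu x hx).ne_zero).mul
    (ContDiffOn.matrix_det fun k l => ?_)
  simp only [Matrix.updateRow_apply]
  split_ifs
  · exact contDiffOn_const
  · exact hM k l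

end SmoothMatrix

/-! ### The coframe: linearity, smoothness, invertibility -/

namespace ProjectiveSpecialKahlerDomain

variable {m : ℕ} (D : ProjectiveSpecialKahlerDomain m)

theorem contDiffOn_hessian (A B : Fin (m + 1)) :
    ContDiffOn ℂ ∞ (fun z => prepotentialHessian D.F (homogeneous z) A B) D.base :=
  ((D.differentiableOn_hessian A B).contDiffOn_of_finiteDimensional D.isOpen_cone).comp
    contDiff_homogeneous.contDiffOn fun _ hz => hz

theorem contDiffOn_imHessian (A B : Fin (m + 1)) :
    ContDiffOn ℝ ∞ (fun z => imHessian D.F (homogeneous z) A B) D.base :=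
  Complex.imCLM.contDiff.comp_contDiffOn ((D.contDiffOn_hessian A B).restrict_scalars ℝ)

theorem contDiff_homogeneous_apply (A : Fin (m + 1)) :
    ContDiff ℝ ∞ (fun z : Fin m → ℂ => homogeneous z A) :=
  (contDiff_pi.1 contDiff_homogeneous A).restrict_scalars ℝ

theorem contDiffOn_kahlerPotential : ContDiffOn ℝ ∞ (kahlerPotential D.F) D.base := by
  unfold kahlerPotential
  refine (ContDiffOn.log (f := fun z => -2 * hermitianNorm D.F (homogeneous z))
    (contDiffOn_const.mul ?_) fun z hz => (D.norm_pos _ hz).ne').neg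
  unfold hermitianNorm
  refine Complex.reCLM.contDiff.comp_contDiffOn
    (ContDiffOn.sum fun A _ => ContDiffOn.sum fun B _ => ?_)
  exact ((contDiff_homogeneous_apply A).contDiffOn.mul
    (Complex.ofRealCLM.contDiff.comp_contDiffOn (D.contDiffOn_imHessian A B))).mul
      (Complex.conjCLE.contDiff.comp_contDiffOn (contDiff_homogeneous_apply B).contDiffOn)

theorem isOpen_total : IsOpen D.total := D.isOpen_base.prod isOpen_univ

theorem comp_fst_contDiffOn {E : Type*} [NormedAddCommGroup E] [NormedSpace ℝ E]
    {f : (Fin m → ℂ) → E} (hf : ContDiffOn ℝ ∞ f D.base) :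
    ContDiffOn ℝ ∞ (fun p : TotalSpace m => f p.1) D.total :=
  hf.comp contDiff_fst.contDiffOn fun _ hp => hp.1

theorem fibreVec_add (H : Matrix (Fin (m + 1)) (Fin (m + 1)) ℂ) (a b a' b' : Fin (m + 1) → ℝ) :
    fibreVec H (a + a') (b + b') = fibreVec H a b + fibreVec H a' b' := by
  ext A
  simp only [fibreVec, Pi.add_apply, Complex.ofReal_add, mul_add, Finset.sum_add_distrib]
  ring

theorem fibreVec_smul (H : Matrix (Fin (m + 1)) (Fin (m + 1)) ℂ) (c : ℝ)
    (a b : Fin (m + 1) → ℝ) : fibreVec H (c • a) (c • b) = c • fibreVec H a b := by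
  ext A
  simp only [fibreVec, Pi.smul_apply, smul_eq_mul, Complex.ofReal_mul, Complex.real_smul, mul_sub,
    Finset.mul_sum]
  congr 1
  exact Finset.sum_congr rfl fun B _ => by ring

theorem raise_add (N : Matrix (Fin (m + 1)) (Fin (m + 1)) ℝ) (W W' : Fin (m + 1) → ℂ) :
    raise N (W + W') = raise N W + raise N W' := by
  ext A
  simp only [raise, Pi.add_apply, map_add, mul_add, Finset.sum_add_distrib]

theorem raise_smul (N : Matrix (Fin (m + 1)) (Fin (m + 1)) ℝ) (c : ℂ) (W : Fin (m + 1) → ℂ) :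
    raise N (c • W) = conj c • raise N W := by
  ext A
  simp only [raise, Pi.smul_apply, smul_eq_mul, map_mul, Finset.mul_sum]
  exact Finset.sum_congr rfl fun B _ => by ring

variable (e : (Fin m → ℂ) → Matrix (Fin m) (Fin m) ℂ)

theorem frameProj_add (z : Fin m → ℂ) (X Y : Fin (m + 1) → ℂ) (β : Fin m) :
    frameProj e z (X + Y) β = frameProj e z X β + frameProj e z Y β := by
  simp only [frameProj, Pi.add_apply, add_mul, Finset.sum_add_distrib]

theorem frameProj_smul (z : Fin m → ℂ) (c : ℂ) (X : Fin (m + 1) → ℂ) (β : Fin m) :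
    frameProj e z (c • X) β = c * frameProj e z X β := by
  simp only [frameProj, Pi.smul_apply, smul_eq_mul, Finset.mul_sum, mul_assoc]

theorem formU_add (p X Y : TotalSpace m) :
    D.formU p (X + Y) = D.formU p X + D.formU p Y := by
  simp only [formU_eq, baseVec, Prod.snd_add, Prod.fst_add, fibreVec_add, Pi.add_apply, mul_add,
    Finset.sum_add_distrib]

theorem formU_smul (c : ℝ) (p X : TotalSpace m) : D.formU p (c • X) = c * D.formU p X := by
  simp only [formU_eq, baseVec, Prod.smul_snd, Prod.smul_fst, fibreVec_smul, Pi.smul_apply, Complex.real_smul,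
    Finset.mul_sum]
  exact Finset.sum_congr rfl fun B _ => by ring

theorem formV_add (p X Y : TotalSpace m) :
    formV p (X + Y) = formV p X + formV p Y := by
  simp only [formV_eq, Prod.snd_add, Prod.fst_add, Pi.add_apply]
  have : ∑ A, (p.2.2.2.2 A * (X.2.2.2.1 A + Y.2.2.2.1 A)
      - p.2.2.2.1 A * (X.2.2.2.2 A + Y.2.2.2.2 A))
      = ∑ A, (p.2.2.2.2 A * X.2.2.2.1 A - p.2.2.2.1 A * X.2.2.2.2 A)
      + ∑ A, (p.2.2.2.2 A * Y.2.2.2.1 A - p.2.2.2.1 A * Y.2.2.2.2 A) := by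
    rw [← Finset.sum_add_distrib]
    exact Finset.sum_congr rfl fun B _ => by ring
  rw [this]
  push_cast
  ring

theorem formV_smul (c : ℝ) (p X : TotalSpace m) : formV p (c • X) = c * formV p X := by
  simp only [formV_eq, Prod.smul_snd, Prod.smul_fst, Pi.smul_apply, smul_eq_mul]
  have : ∑ A, (p.2.2.2.2 A * (c * X.2.2.2.1 A) - p.2.2.2.1 A * (c * X.2.2.2.2 A))
      = c * ∑ A, (p.2.2.2.2 A * X.2.2.2.1 A - p.2.2.2.1 A * X.2.2.2.2 A) := by
    rw [Finset.mul_sum]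
    exact Finset.sum_congr rfl fun B _ => by ring
  rw [this]
  push_cast
  ring

theorem formE_add (β : Fin m) (p X Y : TotalSpace m) :
    D.formE e β p (X + Y) = D.formE e β p X + D.formE e β p Y := by
  simp only [formE_eq, baseVec, Prod.snd_add, Prod.fst_add, fibreVec_add, raise_add,
    frameProj_add, mul_add]

theorem formE_smul (c : ℝ) (β : Fin m) (p X : TotalSpace m) :
    D.formE e β p (c • X) = c * D.formE e β p X := by
  have h : ∀ W : Fin (m + 1) → ℂ, c • W = (c : ℂ) • W := fun W => rfl
  simp only [formE_eq, baseVec, Prod.smul_snd, Prod.smul_fst, fibreVec_smul, h, raise_smul,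
    frameProj_smul, Complex.conj_ofReal]
  ring

theorem formBase_add (β : Fin m) (p X Y : TotalSpace m) :
    formBase e β p (X + Y) = formBase e β p X + formBase e β p Y := by
  simp only [formBase, Prod.fst_add, Pi.add_apply, mul_add, Finset.sum_add_distrib]

theorem formBase_smul (c : ℝ) (β : Fin m) (p X : TotalSpace m) :
    formBase e β p (c • X) = c * formBase e β p X := by
  simp only [formBase, Prod.smul_fst, Pi.smul_apply, Complex.real_smul, Finset.mul_sum]
  exact Finset.sum_congr rfl fun B _ => by ring

/-- The complex coframe `(u, e; v, E)` at a point, as a real linear map. -/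
noncomputable def coframe (p : TotalSpace m) :
    TotalSpace m →L[ℝ] (Fin (m + 1) → ℂ) × (Fin (m + 1) → ℂ) :=
  LinearMap.toContinuousLinearMap
    { toFun := fun X => (fun k => D.formsUe e k p X, fun k => D.formsVE e k p X)
      map_add' := fun X Y => by
        refine Prod.ext (funext fun k => ?_) (funext fun k => ?_)
        · refine Fin.cases ?_ (fun β => ?_) k
          · exact D.formU_add p X Y
          · exact formBase_add e β p X Y
        · refine Fin.cases ?_ (fun β => ?_) k
          · exact formV_add p X Y
          · exact D.formE_add e β p X Y
      map_smul' := fun c X => by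
        refine Prod.ext (funext fun k => ?_) (funext fun k => ?_)
        · refine Fin.cases ?_ (fun β => ?_) k
          · exact D.formU_smul c p X
          · exact formBase_smul e c β p X
        · refine Fin.cases ?_ (fun β => ?_) k
          · exact formV_smul c p X
          · exact D.formE_smul e c β p X }

theorem coframe_apply (p X : TotalSpace m) :
    D.coframe e p X = (fun k => D.formsUe e k p X, fun k => D.formsVE e k p X) := rfl

theorem contDiffOn_baseVec (a b : Fin (m + 1) → ℝ) (A : Fin (m + 1)) :
    ContDiffOn ℝ ∞ (fun z => D.baseVec z a b A) D.base :=
  contDiffOn_const.sub (ContDiffOn.sum fun B _ =>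
    ((D.contDiffOn_hessian A B).restrict_scalars ℝ).mul contDiffOn_const)

theorem contDiffOn_formU (X : TotalSpace m) :
    ContDiffOn ℝ ∞ (fun p => D.formU p X) D.total := by
  simp only [formU_eq]
  have h1 : ContDiffOn ℝ ∞ (fun p : TotalSpace m => kahlerPotential D.F p.1 / 2 + p.2.1)
      D.total :=
    ((D.comp_fst_contDiffOn D.contDiffOn_kahlerPotential).div_const 2).add (by fun_prop)
  refine (contDiffOn_const.mul (Complex.ofRealCLM.contDiff.comp_contDiffOn h1.exp)).mul
    (ContDiffOn.sum fun A _ => ContDiffOn.mul ?_ ?_)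
  · exact ((contDiff_homogeneous_apply A).comp contDiff_fst).contDiffOn
  · exact D.comp_fst_contDiffOn (D.contDiffOn_baseVec _ _ A)

theorem contDiff_formV (X : TotalSpace m) :
    ContDiff ℝ ∞ (fun p : TotalSpace m => formV p X) := by
  simp only [formV_eq]
  have h : ContDiff ℝ ∞ fun p : TotalSpace m => Real.exp (2 * p.2.1) / 2 *
      (X.2.2.1 + ∑ A, (p.2.2.2.2 A * X.2.2.2.1 A - p.2.2.2.1 A * X.2.2.2.2 A)) := by
    fun_prop
  exact contDiff_const.sub (contDiff_const.mul (Complex.ofRealCLM.contDiff.comp h))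

variable {D e} (he : D.IsVielbein e)
include he

theorem eq_zero_of_formBase_eq_zero {p X : TotalSpace m} (hp : p.1 ∈ D.base)
    (h : ∀ β, formBase e β p X = 0) : X.1 = 0 := by
  have h1 : ∀ β, frameProj e p.1 (homogeneousDeriv m X.1) β = 0 := by
    intro β
    rw [frameProj_eq, ← h β, formBase]
    exact Finset.sum_congr rfl fun a _ => by simp [mul_comm]
  have h2 := frameProj_eq_zero he hp h1
  ext a
  simpa using congrFun h2 a.castSucc

theorem eq_zero_of_formU_formE {p X : TotalSpace m} (hp : p.1 ∈ D.base)
    (hU : D.formU p X = 0) (hE : ∀ β, D.formE e β p X = 0) :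
    D.baseVec p.1 X.2.2.2.1 X.2.2.2.2 = 0 := by
  refine eq_zero_of_frameProj_raise_eq_zero he hp ?_ fun β => ?_
  · rw [formU_eq] at hU
    simpa [Real.exp_ne_zero, -Complex.ofReal_exp] using hU
  · have := hE β
    rw [formE_eq] at this
    simpa [Real.exp_ne_zero, -Complex.ofReal_exp] using this

/-- The imaginary part of b - F a is -N a and N is invertible; then the real part gives b. -/
theorem fibreVec_eq_zero {z : Fin m → ℂ} (hz : z ∈ D.base) {a b : Fin (m + 1) → ℝ}
    (h : D.baseVec z a b = 0) : a = 0 ∧ b = 0 := by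
  have ha : (imHessian D.F (homogeneous z)).mulVec a = 0 := by
    ext A
    have := congrArg Complex.im (congrFun h A)
    simpa [baseVec, fibreVec, Matrix.mulVec, dotProduct, imHessian] using this
  have ha0 : a = 0 := by
    by_contra hne
    exact (isUnit_det_imHessian he hz).ne_zero (Matrix.exists_mulVec_eq_zero_iff.1 ⟨a, hne, ha⟩)
  refine ⟨ha0, ?_⟩
  ext A
  have := congrFun h A
  simpa [baseVec, fibreVec, ha0] using this

/-- The forms e detect dz, u and E detect (da, db), and once these vanish the real and imaginary
parts of v detect dφ and dφ̃. -/
theorem coframe_injective {p : TotalSpace m} (hp : p ∈ D.total) :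
    Function.Injective (D.coframe e p) := by
  rw [injective_iff_map_eq_zero]
  intro X hX
  rw [coframe_apply, Prod.mk_eq_zero] at hX
  have hU : D.formU p X = 0 := congrFun hX.1 0
  have hV : formV p X = 0 := congrFun hX.2 0
  have hB : ∀ β, formBase e β p X = 0 := fun β => congrFun hX.1 β.succ
  have hE : ∀ β, D.formE e β p X = 0 := fun β => congrFun hX.2 β.succ
  have h1 := eq_zero_of_formBase_eq_zero he hp.1 hB
  obtain ⟨ha, hb⟩ := fibreVec_eq_zero he hp.1 (eq_zero_of_formU_formE he hp.1 hU hE)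
  rw [formV_eq, ha, hb] at hV
  have h2 : X.2.1 = 0 := by simpa [-Complex.ofReal_exp, -Complex.ofReal_mul] using congrArg Complex.re hV
  have h3 : X.2.2.1 = 0 := by
    have := congrArg Complex.im hV
    simpa [Real.exp_ne_zero, -Complex.ofReal_exp, -Complex.ofReal_mul] using this
  exact Prod.ext h1 (Prod.ext h2 (Prod.ext h3 (Prod.ext ha hb)))

/-- Injectivity suffices, both real dimensions being 4(m + 1). -/
theorem coframe_isInvertible {p : TotalSpace m} (hp : p ∈ D.total) :
    (D.coframe e p).IsInvertible := by
  have hfin : Module.finrank ℝ (TotalSpace m)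
      = Module.finrank ℝ ((Fin (m + 1) → ℂ) × (Fin (m + 1) → ℂ)) := by
    simp [Module.finrank_pi_fintype, Complex.finrank_real_complex]
    ring
  refine ⟨(LinearEquiv.ofInjectiveOfFinrankEq (D.coframe e p : TotalSpace m →ₗ[ℝ] _)
    (coframe_injective he hp) hfin).toContinuousLinearEquiv, ?_⟩
  ext X <;> rfl

theorem contDiffOn_formE (β : Fin m) (X : TotalSpace m) :
    ContDiffOn ℝ ∞ (fun p => D.formE e β p X) D.total := by
  simp only [formE_eq, frameProj, raise]
  have h1 : ContDiffOn ℝ ∞ (fun p : TotalSpace m => p.2.1 - kahlerPotential D.F p.1 / 2)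
      D.total :=
    ContDiffOn.sub (by fun_prop) ((D.comp_fst_contDiffOn D.contDiffOn_kahlerPotential).div_const 2)
  refine (contDiffOn_const.mul (Complex.ofRealCLM.contDiff.comp_contDiffOn h1.exp)).mul
    (ContDiffOn.sum fun A _ => ContDiffOn.mul (ContDiffOn.sum fun B _ => ContDiffOn.mul ?_ ?_) ?_)
  · exact Complex.ofRealCLM.contDiff.comp_contDiffOn (D.comp_fst_contDiffOn
      (ContDiffOn.matrix_inv D.contDiffOn_imHessian (fun z hz => isUnit_det_imHessian he hz) A B))
  · exact Complex.conjCLE.contDiff.comp_contDiffOn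
      (D.comp_fst_contDiffOn (D.contDiffOn_baseVec _ _ B))
  · refine D.comp_fst_contDiffOn (f := fun z => projectedVielbein e z A β) ?_
    refine Fin.lastCases ?_ (fun a => ?_) A
    · simp only [projectedVielbein, Fin.snoc_last]
      exact (ContDiffOn.sum fun a _ => ContDiffOn.mul (by fun_prop) (he.smooth a β)).neg
    · simp only [projectedVielbein, Fin.snoc_castSucc]
      exact he.smooth a β

theorem contDiffOn_formBase (β : Fin m) (X : TotalSpace m) :
    ContDiffOn ℝ ∞ (fun p => formBase e β p X) D.total := by
  unfold formBase
  exact ContDiffOn.sum fun a _ => (D.comp_fst_contDiffOn (he.smooth a β)).mul contDiffOn_const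

theorem contDiffOn_coframe : ContDiffOn ℝ ∞ (D.coframe e) D.total := by
  refine contDiffOn_clm_apply.2 fun X => ContDiffOn.prodMk (contDiffOn_pi.2 fun k => ?_)
    (contDiffOn_pi.2 fun k => ?_)
  · refine Fin.cases ?_ (fun β => ?_) k
    · exact D.contDiffOn_formU X
    · exact contDiffOn_formBase he β X
  · refine Fin.cases ?_ (fun β => ?_) k
    · exact (contDiff_formV X).contDiffOn
    · exact contDiffOn_formE he β X

end ProjectiveSpecialKahlerDomain

/-! ### The almost complex structures J_α and the metric -/

namespace ProjectiveSpecialKahlerDomain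

variable {m : ℕ} (D : ProjectiveSpecialKahlerDomain m)
  (e : (Fin m → ℂ) → Matrix (Fin m) (Fin m) ℂ)

/-- The action of the three complex structures on the values of the coframe. -/
noncomputable def coframeAction (E : Type*) [NormedAddCommGroup E] [NormedSpace ℂ E] :
    Fin 3 → (E × E →L[ℝ] E × E) :=
  ![(Complex.I • ContinuousLinearMap.snd ℝ E E).prod (Complex.I • ContinuousLinearMap.fst ℝ E E),
    (-ContinuousLinearMap.snd ℝ E E).prod (ContinuousLinearMap.fst ℝ E E),
    (Complex.I • ContinuousLinearMap.fst ℝ E E).prod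
      (-(Complex.I • ContinuousLinearMap.snd ℝ E E))]

/-- The almost complex structures `J_1, J_2, J_3` of the c-map. -/
noncomputable def cMapStructure (α : Fin 3) (p : TotalSpace m) :
    TotalSpace m →L[ℝ] TotalSpace m :=
  (D.coframe e p).inverse.comp ((coframeAction (Fin (m + 1) → ℂ) α).comp (D.coframe e p))

theorem coframeAction_fst_apply {ι : Type*} [Fintype ι] (α : Fin 3) (q : (ι → ℂ) × (ι → ℂ))
    (k : ι) : (coframeAction (ι → ℂ) α q).1 k = (coframeAction ℂ α (q.1 k, q.2 k)).1 := by
  fin_cases α <;> rfl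

theorem coframeAction_snd_apply {ι : Type*} [Fintype ι] (α : Fin 3) (q : (ι → ℂ) × (ι → ℂ))
    (k : ι) : (coframeAction (ι → ℂ) α q).2 k = (coframeAction ℂ α (q.1 k, q.2 k)).2 := by
  fin_cases α <;> rfl

/-- The four entries of the defining equation for one pair (u, v). They come in two conjugate pairs,
by the quaternionic reality of the vielbein, so the system is consistent and amounts to prescribing
(u', v'). -/
theorem pauli_equations_iff (α : Fin 3) {s : ℂ} (hs : s ≠ 0) (u v u' v' : ℂ) :
    ((s * conj u' = -Complex.I * (pauli α 0 0 * (s * conj u) + pauli α 0 1 * (s * conj v)) ∧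
      s * -v' = -Complex.I * (pauli α 0 0 * (s * -v) + pauli α 0 1 * (s * u))) ∧
     (s * conj v' = -Complex.I * (pauli α 1 0 * (s * conj u) + pauli α 1 1 * (s * conj v)) ∧
      s * u' = -Complex.I * (pauli α 1 0 * (s * -v) + pauli α 1 1 * (s * u)))) ↔
    (u' = (coframeAction ℂ α (u, v)).1 ∧ v' = (coframeAction ℂ α (u, v)).2) := by
  have hi := Complex.I_mul_I
  constructor
  -- The entries in the unbarred columns already determine u' and v'; the discarded ones are their
  -- conjugates.
  · rintro ⟨⟨-, h2⟩, -, h4⟩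
    fin_cases α <;> simp [pauli, coframeAction] at h2 h4 ⊢ <;>
      refine ⟨mul_left_cancel₀ hs ?_, mul_left_cancel₀ hs ?_⟩
    · linear_combination h4
    · linear_combination h2
    · linear_combination h4 + s * v * hi
    · linear_combination -h2 - s * u * hi
    · linear_combination h4
    · linear_combination -h2
  · rintro ⟨rfl, rfl⟩
    fin_cases α <;> simp [pauli, coframeAction] <;> refine ⟨⟨?_, ?_⟩, ?_, ?_⟩
    all_goals first
      | ring1
      | linear_combination s * conj v * hi
      | linear_combination s * conj u * hi
      | linear_combination -s * conj u * hi
      | linear_combination -s * conj v * hi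
      | linear_combination s * v * hi
      | linear_combination s * u * hi
      | linear_combination -s * u * hi
      | linear_combination -s * v * hi

/-- The Pauli matrices act only on the row index, so the equations decouple over the columns into
the pairs (u, v) and (e^b, E^b). -/
theorem isQuaternionicFrame_iff
    {J : Fin 3 → TotalSpace m → TotalSpace m →L[ℝ] TotalSpace m} :
    D.IsQuaternionicFrame e J ↔ ∀ α, ∀ p ∈ D.total, ∀ X,
      D.coframe e p (J α p X) = coframeAction (Fin (m + 1) → ℂ) α (D.coframe e p X) := by
  have hs : (1 / (Real.sqrt 2 : ℂ)) ≠ 0 := by simp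
  unfold IsQuaternionicFrame
  refine forall_congr' fun α => forall₂_congr fun p _ => forall_congr' fun X => ?_
  have h := fun k => pauli_equations_iff α hs (D.formsUe e k p X) (D.formsVE e k p X)
    (D.formsUe e k p (J α p X)) (D.formsVE e k p (J α p X))
  simp only [Prod.ext_iff, funext_iff, coframeAction_fst_apply, coframeAction_snd_apply]
  simp only [coframe_apply, ← forall_and, ← h, Fin.forall_fin_two, Sum.forall,
    quaternionicVielbein, Fin.sum_univ_two, Matrix.cons_val_zero, Matrix.cons_val_one,
    Sum.elim_inl, Sum.elim_inr]

theorem metric_self (p X : TotalSpace m) :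
    D.metric e p X X
      = ∑ k, (Complex.normSq (D.formsUe e k p X) + Complex.normSq (D.formsVE e k p X)) := by
  simp only [metric, Complex.mul_conj, Complex.ofReal_re]

variable {D e} (he : D.IsVielbein e)
include he

theorem coframe_inverse_apply {p : TotalSpace m} (hp : p ∈ D.total)
    (q : (Fin (m + 1) → ℂ) × (Fin (m + 1) → ℂ)) :
    D.coframe e p ((D.coframe e p).inverse q) = q := by
  obtain ⟨L, hL⟩ := coframe_isInvertible he hp
  rw [← hL, ContinuousLinearMap.inverse_equiv]
  exact L.apply_symm_apply q

theorem isQuaternionicFrame_cMapStructure : D.IsQuaternionicFrame e (D.cMapStructure e) :=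
  (D.isQuaternionicFrame_iff e).2 fun _ _ hp _ => coframe_inverse_apply he hp _

theorem IsQuaternionicFrame.eqOn {J J' : Fin 3 → TotalSpace m → TotalSpace m →L[ℝ] TotalSpace m}
    (hJ : D.IsQuaternionicFrame e J) (hJ' : D.IsQuaternionicFrame e J') (α : Fin 3) :
    Set.EqOn (J' α) (J α) D.total := by
  intro p hp
  refine ContinuousLinearMap.ext fun X => ?_
  refine coframe_injective he hp ?_
  rw [(D.isQuaternionicFrame_iff e).1 hJ α p hp, (D.isQuaternionicFrame_iff e).1 hJ' α p hp]

/-- Inversion of continuous linear maps is smooth at invertible ones, and the coframe is smooth. -/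
theorem contDiffOn_cMapStructure (α : Fin 3) :
    ContDiffOn ℝ ∞ (D.cMapStructure e α) D.total := by
  have h := contDiffOn_coframe he
  refine ContDiffOn.clm_comp (fun p hp => ?_) (contDiffOn_const.clm_comp h)
  exact ((coframe_isInvertible he hp).contDiffAt_map_inverse).comp_contDiffWithinAt p (h p hp)

theorem coframe_cMapStructure_two {p : TotalSpace m} (hp : p ∈ D.total) (X : TotalSpace m) :
    D.coframe e p (D.cMapStructure e 2 p X)
      = (Complex.I • (D.coframe e p X).1, -(Complex.I • (D.coframe e p X).2)) :=
  coframe_inverse_apply he hp _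

theorem formsUe_cMapStructure_two {p : TotalSpace m} (hp : p ∈ D.total) (X : TotalSpace m)
    (k : Fin (m + 1)) :
    D.formsUe e k p (D.cMapStructure e 2 p X) = Complex.I * D.formsUe e k p X :=
  congrFun (congrArg Prod.fst (coframe_cMapStructure_two he hp X)) k

theorem formsVE_cMapStructure_two {p : TotalSpace m} (hp : p ∈ D.total) (X : TotalSpace m)
    (k : Fin (m + 1)) :
    D.formsVE e k p (D.cMapStructure e 2 p X) = -(Complex.I * D.formsVE e k p X) :=
  congrFun (congrArg Prod.snd (coframe_cMapStructure_two he hp X)) k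

theorem isAlmostComplex_cMapStructure_two :
    IsAlmostComplex D.total (D.cMapStructure e 2) where
  smooth := contDiffOn_cMapStructure he 2
  sq p hp X := by
    refine coframe_injective he hp ?_
    rw [coframe_cMapStructure_two he hp, coframe_cMapStructure_two he hp, map_neg]
    simp [smul_smul, Prod.ext_iff]

theorem metric_cMapStructure_two {p : TotalSpace m} (hp : p ∈ D.total) (X Y : TotalSpace m) :
    D.metric e p (D.cMapStructure e 2 p X) (D.cMapStructure e 2 p Y) = D.metric e p X Y := by
  simp only [metric, formsUe_cMapStructure_two he hp, formsVE_cMapStructure_two he hp]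
  refine Finset.sum_congr rfl fun k _ => ?_
  simp [Complex.mul_re, Complex.mul_im]

theorem isRiemannianMetric_metric : IsRiemannianMetric D.total (D.metric e) where
  smooth X Y := by
    have h := contDiffOn_coframe he
    have hU : ∀ k X, ContDiffOn ℝ ∞ (fun p => D.formsUe e k p X) D.total := fun k X =>
      contDiffOn_pi.1 (contDiff_fst.comp_contDiffOn (contDiffOn_clm_apply.1 h X)) k
    have hV : ∀ k X, ContDiffOn ℝ ∞ (fun p => D.formsVE e k p X) D.total := fun k X =>
      contDiffOn_pi.1 (contDiff_snd.comp_contDiffOn (contDiffOn_clm_apply.1 h X)) k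
    have hre := Complex.reCLM.contDiff (n := ∞)
    have hc := Complex.conjCLE.contDiff (n := ∞)
    exact ContDiffOn.sum fun k _ =>
      (hre.comp_contDiffOn ((hU k X).mul (hc.comp_contDiffOn (hU k Y)))).add
        (hre.comp_contDiffOn ((hV k X).mul (hc.comp_contDiffOn (hV k Y))))
  add_left p _ X X' Y := by
    have hU : ∀ k, D.formsUe e k p (X + X') = D.formsUe e k p X + D.formsUe e k p X' := fun k =>
      congrFun (congrArg Prod.fst (map_add (D.coframe e p) X X')) k
    have hV : ∀ k, D.formsVE e k p (X + X') = D.formsVE e k p X + D.formsVE e k p X' := fun k =>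
      congrFun (congrArg Prod.snd (map_add (D.coframe e p) X X')) k
    simp only [metric, hU, hV, ← Finset.sum_add_distrib, add_mul, Complex.add_re]
    exact Finset.sum_congr rfl fun k _ => by ring
  smul_left p _ c X Y := by
    have hU : ∀ k, D.formsUe e k p (c • X) = c * D.formsUe e k p X := fun k =>
      congrFun (congrArg Prod.fst (map_smul (D.coframe e p) c X)) k
    have hV : ∀ k, D.formsVE e k p (c • X) = c * D.formsVE e k p X := fun k =>
      congrFun (congrArg Prod.snd (map_smul (D.coframe e p) c X)) k
    simp only [metric, hU, hV, Finset.mul_sum, mul_assoc, Complex.re_ofReal_mul]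
    exact Finset.sum_congr rfl fun k _ => by ring
  symm p _ X Y := by
    simp only [metric]
    refine Finset.sum_congr rfl fun k _ => ?_
    simp [Complex.mul_re]
    ring
  pos p hp X hX := by
    rw [metric_self]
    refine lt_of_le_of_ne (Finset.sum_nonneg fun k _ =>
      add_nonneg (Complex.normSq_nonneg _) (Complex.normSq_nonneg _)) fun h => hX ?_
    have h0 := (Finset.sum_eq_zero_iff_of_nonneg fun k _ =>
      add_nonneg (Complex.normSq_nonneg _) (Complex.normSq_nonneg _)).1 h.symm
    refine coframe_injective he hp ?_
    rw [map_zero, coframe_apply]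
    refine Prod.ext (funext fun k => ?_) (funext fun k => ?_)
    · have := h0 k (Finset.mem_univ k)
      exact Complex.normSq_eq_zero.1 (le_antisymm
        (by linarith [Complex.normSq_nonneg (D.formsVE e k p X)]) (Complex.normSq_nonneg _))
    · have := h0 k (Finset.mem_univ k)
      exact Complex.normSq_eq_zero.1 (le_antisymm
        (by linarith [Complex.normSq_nonneg (D.formsUe e k p X)]) (Complex.normSq_nonneg _))

/-- The forms e involve dz alone and complex linearly, so e ∘ J_3 = i e determines the base
component. -/
theorem cMapStructure_two_fst {p : TotalSpace m} (hp : p ∈ D.total) (X : TotalSpace m) :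
    (D.cMapStructure e 2 p X).1 = Complex.I • X.1 := by
  have h : ∀ β, formBase e β p (D.cMapStructure e 2 p X - (Complex.I • X.1, 0)) = 0 := by
    intro β
    have h1 := formsUe_cMapStructure_two he hp X β.succ
    have h2 : formBase e β p (D.cMapStructure e 2 p X) = Complex.I * formBase e β p X := h1
    have h3 : formBase e β p (D.cMapStructure e 2 p X - (Complex.I • X.1, 0))
        = formBase e β p (D.cMapStructure e 2 p X) - Complex.I * formBase e β p X := by
      simp only [formBase, Prod.fst_sub, Pi.sub_apply, Pi.smul_apply, smul_eq_mul, mul_sub,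
        Finset.sum_sub_distrib, Finset.mul_sum]
      congr 1
      exact Finset.sum_congr rfl fun a _ => by ring
    rw [h3, h2, sub_self]
  exact sub_eq_zero.1 (eq_zero_of_formBase_eq_zero he hp.1 h)

theorem formV_cMapStructure_two {p : TotalSpace m} (hp : p ∈ D.total) (X : TotalSpace m) :
    formV p (D.cMapStructure e 2 p X) = -(Complex.I * formV p X) :=
  formsVE_cMapStructure_two he hp X 0

/-- Since u is linear and E antilinear in W, the relations u ∘ J_3 = i u and E ∘ J_3 = -i E both
express W ∘ J_3 = i W, and u, E together determine W. -/
theorem baseVec_cMapStructure_two {p : TotalSpace m} (hp : p ∈ D.total) (X : TotalSpace m) :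
    D.baseVec p.1 (D.cMapStructure e 2 p X).2.2.2.1 (D.cMapStructure e 2 p X).2.2.2.2
      = Complex.I • D.baseVec p.1 X.2.2.2.1 X.2.2.2.2 := by
  set W' := D.baseVec p.1 (D.cMapStructure e 2 p X).2.2.2.1 (D.cMapStructure e 2 p X).2.2.2.2
  set W := D.baseVec p.1 X.2.2.2.1 X.2.2.2.2
  have hU : D.formU p (D.cMapStructure e 2 p X) = Complex.I * D.formU p X :=
    formsUe_cMapStructure_two he hp X 0
  have hE : ∀ β, D.formE e β p (D.cMapStructure e 2 p X) = -(Complex.I * D.formE e β p X) :=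
    fun β => formsVE_cMapStructure_two he hp X β.succ
  refine sub_eq_zero.1 (eq_zero_of_frameProj_raise_eq_zero he hp.1 ?_ fun β => ?_)
  · rw [formU_eq, formU_eq] at hU
    have hc : Complex.I * (Real.exp (kahlerPotential D.F p.1 / 2 + p.2.1) : ℂ) ≠ 0 :=
      mul_ne_zero Complex.I_ne_zero (Complex.ofReal_ne_zero.2 (Real.exp_ne_zero _))
    refine mul_left_cancel₀ hc ?_
    simp only [Pi.sub_apply, Pi.smul_apply, smul_eq_mul, mul_sub, Finset.sum_sub_distrib,
      mul_zero]
    refine sub_eq_zero.2 (hU.trans ?_)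
    rw [mul_left_comm, Finset.mul_sum]
    congr 1
    exact Finset.sum_congr rfl fun A _ => by rw [mul_left_comm]
  · have h := hE β
    rw [formE_eq, formE_eq] at h
    have hc : -(Complex.I / 2) * (Real.exp (p.2.1 - kahlerPotential D.F p.1 / 2) : ℂ) ≠ 0 :=
      mul_ne_zero (neg_ne_zero.2 (div_ne_zero Complex.I_ne_zero two_ne_zero))
        (Complex.ofReal_ne_zero.2 (Real.exp_ne_zero _))
    refine mul_left_cancel₀ hc ?_
    have : W' - Complex.I • W = W' + (-Complex.I) • W := by rw [neg_smul, sub_eq_add_neg]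
    rw [this, raise_add, raise_smul, frameProj_add, frameProj_smul, mul_add, h, map_neg,
      Complex.conj_I]
    ring

/-- On a horizontal vector u, v and E vanish. They also vanish on its image, which therefore has no
fibre component. -/
theorem cMapStructure_two_horizontal {z : Fin m → ℂ} (hz : z ∈ D.base) (y : FibreSpace m)
    (X : Fin m → ℂ) : D.cMapStructure e 2 (z, y) (X, 0) = (Complex.I • X, 0) := by
  have hp : ((z, y) : TotalSpace m) ∈ D.total := ⟨hz, trivial⟩
  have hW := baseVec_cMapStructure_two he hp (X, 0)
  have hV := formV_cMapStructure_two he hp (X, 0)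
  have h0 : D.baseVec z (0 : Fin (m + 1) → ℝ) 0 = 0 := by
    ext A
    simp [baseVec, fibreVec]
  have h0' : formV ((z, y) : TotalSpace m) (X, 0) = 0 := by
    simp [formV_eq]
  obtain ⟨ha, hb⟩ := fibreVec_eq_zero he hz (hW.trans (by
    change Complex.I • D.baseVec z (0 : Fin (m + 1) → ℝ) 0 = 0
    rw [h0, smul_zero]))
  rw [h0', mul_zero, neg_zero, formV_eq, ha, hb] at hV
  have h2 : (D.cMapStructure e 2 (z, y) (X, 0)).2.1 = 0 := by
    simpa [-Complex.ofReal_exp, -Complex.ofReal_mul] using congrArg Complex.re hV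
  have h3 : (D.cMapStructure e 2 (z, y) (X, 0)).2.2.1 = 0 := by
    have := congrArg Complex.im hV
    simpa [Real.exp_ne_zero, -Complex.ofReal_exp, -Complex.ofReal_mul] using this
  exact Prod.ext (cMapStructure_two_fst he hp _) (Prod.ext h2 (Prod.ext h3 (Prod.ext ha hb)))

theorem cMapStructure_two_vertical {z : Fin m → ℂ} (hz : z ∈ D.base) (y X : FibreSpace m) :
    D.cMapStructure e 2 (z, y) (0, X) = (0, fibreEndomorphism (D.cMapStructure e 2) z y X) := by
  have hp : ((z, y) : TotalSpace m) ∈ D.total := ⟨hz, trivial⟩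
  refine Prod.ext ?_ rfl
  rw [cMapStructure_two_fst he hp]
  simp

end ProjectiveSpecialKahlerDomain

/-! ### Linear coordinates for complex-valued charts -/

section Charts

variable {V E : Type*} [NormedAddCommGroup V] [NormedSpace ℝ V] [NormedAddCommGroup E]
  [NormedSpace ℝ E] [NormedSpace ℂ E] [IsScalarTower ℝ ℂ E]

/-- A holomorphic chart with values in a complex vector space, in linear coordinates. -/
theorem isHolomorphicChart_transHomeomorph {S : Set V} {J : V → V →L[ℝ] V} {d : ℕ}
    {Ψ : OpenPartialHomeomorph V E} (L : E ≃L[ℂ] (Fin d → ℂ)) (hS : Ψ.source ⊆ S)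
    (h : ContDiffOn ℝ ∞ Ψ Ψ.source) (hsymm : ContDiffOn ℝ ∞ Ψ.symm Ψ.target)
    (hJ : ∀ x ∈ Ψ.source, ∀ X, fderiv ℝ Ψ x (J x X) = Complex.I • fderiv ℝ Ψ x X) :
    IsHolomorphicChart S J (Ψ.transHomeomorph L.toHomeomorph) where
  source_subset := hS
  smooth := (L : E →L[ℂ] (Fin d → ℂ)).restrictScalars ℝ |>.contDiff.comp_contDiffOn h
  smooth_symm := hsymm.comp
    ((L.symm : (Fin d → ℂ) →L[ℂ] E).restrictScalars ℝ).contDiff.contDiffOn fun _ hx => hx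
  holomorphic x hx X := by
    have hd : DifferentiableAt ℝ Ψ x :=
      (h.contDiffAt (Ψ.open_source.mem_nhds hx)).differentiableAt (by simp)
    have h1 : fderiv ℝ (Ψ.transHomeomorph L.toHomeomorph) x
        = ((L : E →L[ℂ] (Fin d → ℂ)).restrictScalars ℝ).comp (fderiv ℝ Ψ x) :=
      (((L : E →L[ℂ] (Fin d → ℂ)).restrictScalars ℝ).hasFDerivAt.comp x hd.hasFDerivAt).fderiv
    rw [h1]
    simp only [ContinuousLinearMap.comp_apply, hJ x hx]
    exact L.map_smul _ _

end Charts

/-- Linear coordinates on `ℂ^k × ℂ`. -/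
noncomputable def snocCoord (k : ℕ) : ((Fin k → ℂ) × ℂ) ≃L[ℂ] (Fin (k + 1) → ℂ) :=
  LinearEquiv.toContinuousLinearEquiv
    { toFun := fun q => Fin.snoc (α := fun _ => ℂ) q.1 q.2
      invFun := fun f => (fun i => f i.castSucc, f (Fin.last k))
      map_add' := fun q q' => by
        ext i
        refine Fin.lastCases ?_ (fun j => ?_) i <;> simp
      map_smul' := fun c q => by
        ext i
        refine Fin.lastCases ?_ (fun j => ?_) i <;> simp
      left_inv := fun q => by simp
      right_inv := fun f => by
        ext i
        refine Fin.lastCases ?_ (fun j => ?_) i <;> simp }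

/-- Linear coordinates on `ℂ^k × ℂ^l`. -/
noncomputable def appendCoord (k l : ℕ) :
    ((Fin k → ℂ) × (Fin l → ℂ)) ≃L[ℂ] (Fin (k + l) → ℂ) :=
  LinearEquiv.toContinuousLinearEquiv
    { toFun := fun q => Fin.append q.1 q.2
      invFun := fun f => (fun i => f (Fin.castAdd l i), fun j => f (Fin.natAdd k j))
      map_add' := fun q q' => by
        ext i
        refine Fin.addCases (fun j => ?_) (fun j => ?_) i <;> simp
      map_smul' := fun c q => by
        ext i
        refine Fin.addCases (fun j => ?_) (fun j => ?_) i <;> simp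
      left_inv := fun q => by simp
      right_inv := fun f => by
        ext i
        refine Fin.addCases (fun j => ?_) (fun j => ?_) i <;> simp }

/-- Linear coordinates on `ℂ^k × ℂ^l × ℂ`. -/
noncomputable def totalCoord (k l : ℕ) :
    ((Fin k → ℂ) × ((Fin l → ℂ) × ℂ)) ≃L[ℂ] (Fin (k + (l + 1)) → ℂ) :=
  ((ContinuousLinearEquiv.refl ℂ (Fin k → ℂ)).prodCongr (snocCoord l)).trans
    (appendCoord k (l + 1))

theorem totalCoord_castAdd (k l : ℕ) (q : (Fin k → ℂ) × ((Fin l → ℂ) × ℂ)) (i : Fin k) :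
    totalCoord k l q (Fin.castAdd (l + 1) i) = q.1 i :=
  Fin.append_left _ _ i

theorem totalCoord_natAdd (k l : ℕ) (q : (Fin k → ℂ) × ((Fin l → ℂ) × ℂ)) (i : Fin (l + 1)) :
    totalCoord k l q (Fin.natAdd k i) = snocCoord l q.2 i :=
  Fin.append_right _ _ i

/-! ### Holomorphic coordinates (W, S) on the fibres -/

namespace ProjectiveSpecialKahlerDomain

variable {m : ℕ}

/-- Holomorphic coordinates on a fibre:
`W_A = b_A - H_{AB} a^B` and `S = e^{-2φ} + i (φ' + W_A a^A)`. -/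
noncomputable def fibreCoord (H : Matrix (Fin (m + 1)) (Fin (m + 1)) ℂ) (y : FibreSpace m) :
    (Fin (m + 1) → ℂ) × ℂ :=
  (fibreVec H y.2.2.1 y.2.2.2,
    (Real.exp (-2 * y.1) : ℂ)
      + Complex.I * ((y.2.1 : ℂ) + ∑ A, fibreVec H y.2.2.1 y.2.2.2 A * (y.2.2.1 A : ℂ)))

/-- The component `a` of the inverse of `fibreCoord`. -/
noncomputable def fibreCoordInvA (H : Matrix (Fin (m + 1)) (Fin (m + 1)) ℂ)
    (q : (Fin (m + 1) → ℂ) × ℂ) (A : Fin (m + 1)) : ℝ :=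
  -∑ B, (H.map Complex.im)⁻¹ A B * (q.1 B).im

/-- The function `e^{-2φ}` in the coordinates `fibreCoord`. -/
noncomputable def fibreHeight (H : Matrix (Fin (m + 1)) (Fin (m + 1)) ℂ)
    (q : (Fin (m + 1) → ℂ) × ℂ) : ℝ :=
  q.2.re + ∑ A, (q.1 A).im * fibreCoordInvA H q A

/-- The inverse of `fibreCoord`. -/
noncomputable def fibreCoordInv (H : Matrix (Fin (m + 1)) (Fin (m + 1)) ℂ)
    (q : (Fin (m + 1) → ℂ) × ℂ) : FibreSpace m :=
  (-Real.log (fibreHeight H q) / 2, q.2.im - ∑ A, (q.1 A).re * fibreCoordInvA H q A,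
    fibreCoordInvA H q, fun A => (q.1 A).re + ∑ B, (H A B).re * fibreCoordInvA H q B)

section Inverse

variable {H : Matrix (Fin (m + 1)) (Fin (m + 1)) ℂ}

theorem fibreVec_re (a b : Fin (m + 1) → ℝ) (A : Fin (m + 1)) :
    (fibreVec H a b A).re = b A - ∑ B, (H A B).re * a B := by
  simp [fibreVec]

theorem fibreVec_im (a b : Fin (m + 1) → ℝ) (A : Fin (m + 1)) :
    (fibreVec H a b A).im = -((H.map Complex.im).mulVec a A) := by
  simp [fibreVec, Matrix.mulVec, dotProduct]

theorem fibreCoordInvA_eq (q : (Fin (m + 1) → ℂ) × ℂ) :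
    fibreCoordInvA H q = -((H.map Complex.im)⁻¹.mulVec fun B => (q.1 B).im) := by
  ext A
  simp [fibreCoordInvA, Matrix.mulVec, dotProduct]

variable (hH : IsUnit (H.map Complex.im).det)
include hH

theorem fibreCoordInvA_fibreCoord (y : FibreSpace m) :
    fibreCoordInvA H (fibreCoord H y) = y.2.2.1 := by
  have h : (fun B => ((fibreCoord H y).1 B).im) = -((H.map Complex.im).mulVec y.2.2.1) :=
    funext fun B => fibreVec_im _ _ B
  rw [fibreCoordInvA_eq, h, Matrix.mulVec_neg, neg_neg, Matrix.mulVec_mulVec,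
    Matrix.nonsing_inv_mul _ hH, Matrix.one_mulVec]

/-- The term i W_A a^A contributes -Im W_A a^A to Re S, which the height adds back. Positivity of
the height thus describes the image of the coordinates. -/
theorem fibreHeight_fibreCoord (y : FibreSpace m) :
    fibreHeight H (fibreCoord H y) = Real.exp (-2 * y.1) := by
  rw [fibreHeight, fibreCoordInvA_fibreCoord hH]
  simp [fibreCoord, -Complex.ofReal_exp, -Complex.ofReal_mul, -Complex.ofReal_neg]

theorem fibreCoordInv_fibreCoord (y : FibreSpace m) :
    fibreCoordInv H (fibreCoord H y) = y := by
  refine Prod.ext ?_ (Prod.ext ?_ (Prod.ext ?_ (funext fun A => ?_)))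
  · simp only [fibreCoordInv, fibreHeight_fibreCoord hH, Real.log_exp]
    ring
  · simp only [fibreCoordInv, fibreCoordInvA_fibreCoord hH]
    simp [fibreCoord, -Complex.ofReal_exp, -Complex.ofReal_mul, -Complex.ofReal_neg]
  · exact fibreCoordInvA_fibreCoord hH y
  · simp only [fibreCoordInv, fibreCoordInvA_fibreCoord hH]
    simp [fibreCoord, fibreVec_re]

theorem fibreCoord_fibreCoordInv {q : (Fin (m + 1) → ℂ) × ℂ} (hq : 0 < fibreHeight H q) :
    fibreCoord H (fibreCoordInv H q) = q := by
  have h1 : fibreVec H (fibreCoordInv H q).2.2.1 (fibreCoordInv H q).2.2.2 = q.1 := by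
    ext A
    refine Complex.ext ?_ ?_
    · rw [fibreVec_re]
      simp [fibreCoordInv]
    · rw [fibreVec_im]
      simp only [fibreCoordInv, fibreCoordInvA_eq, Matrix.mulVec_neg, Matrix.mulVec_mulVec,
        Matrix.mul_nonsing_inv _ hH, Matrix.one_mulVec, Pi.neg_apply, neg_neg]
  refine Prod.ext h1 ?_
  have h2 : Real.exp (-2 * (fibreCoordInv H q).1) = fibreHeight H q := by
    rw [← Real.exp_log hq]
    congr 1
    simp only [fibreCoordInv]
    ring
  simp only [fibreCoord, h1, h2]
  refine Complex.ext ?_ ?_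
  · simp [fibreHeight, fibreCoordInv]
  · simp [fibreCoordInv]

end Inverse

section Smooth

variable {P : Type*} [NormedAddCommGroup P] [NormedSpace ℝ P] {S : Set P}
  {H : P → Matrix (Fin (m + 1)) (Fin (m + 1)) ℂ}
  (hH : ∀ A B, ContDiffOn ℝ ∞ (fun p => H p A B) S)
include hH

theorem contDiffOn_fibreVec {a b : P → Fin (m + 1) → ℝ} (ha : ContDiffOn ℝ ∞ a S)
    (hb : ContDiffOn ℝ ∞ b S) (A : Fin (m + 1)) :
    ContDiffOn ℝ ∞ (fun p => fibreVec (H p) (a p) (b p) A) S :=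
  (Complex.ofRealCLM.contDiff.comp_contDiffOn (contDiffOn_pi.1 hb A)).sub
    (ContDiffOn.sum fun B _ => (hH A B).mul
      (Complex.ofRealCLM.contDiff.comp_contDiffOn (contDiffOn_pi.1 ha B)))

theorem contDiffOn_fibreCoord {y : P → FibreSpace m} (hy : ContDiffOn ℝ ∞ y S) :
    ContDiffOn ℝ ∞ (fun p => fibreCoord (H p) (y p)) S := by
  have hr := Complex.ofRealCLM.contDiff (n := ∞)
  have h1 : ContDiffOn ℝ ∞ (fun p => (y p).1) S := hy.fst
  have h2 : ContDiffOn ℝ ∞ (fun p => (y p).2.1) S := hy.snd.fst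
  have h3 : ContDiffOn ℝ ∞ (fun p => (y p).2.2.1) S := hy.snd.snd.fst
  have h4 : ContDiffOn ℝ ∞ (fun p => (y p).2.2.2) S := hy.snd.snd.snd
  have hW := contDiffOn_fibreVec hH h3 h4
  refine ContDiffOn.prodMk (contDiffOn_pi.2 hW) (ContDiffOn.add ?_ (contDiffOn_const.mul ?_))
  · exact hr.comp_contDiffOn (contDiffOn_const.mul h1).exp
  · exact (hr.comp_contDiffOn h2).add (ContDiffOn.sum fun A _ =>
      (hW A).mul (hr.comp_contDiffOn (contDiffOn_pi.1 h3 A)))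

variable (hu : ∀ p ∈ S, IsUnit ((H p).map Complex.im).det) {q : P → (Fin (m + 1) → ℂ) × ℂ}
  (hq : ContDiffOn ℝ ∞ q S)
include hu hq

theorem contDiffOn_fibreCoordInvA (A : Fin (m + 1)) :
    ContDiffOn ℝ ∞ (fun p => fibreCoordInvA (H p) (q p) A) S := by
  have hi := Complex.imCLM.contDiff (n := ∞)
  exact (ContDiffOn.sum fun B _ =>
    (ContDiffOn.matrix_inv (M := fun p => (H p).map Complex.im)
      (fun A B => hi.comp_contDiffOn (hH A B)) hu A B).mul
      (hi.comp_contDiffOn (contDiffOn_pi.1 hq.fst B))).neg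

theorem contDiffOn_fibreHeight : ContDiffOn ℝ ∞ (fun p => fibreHeight (H p) (q p)) S := by
  have hi := Complex.imCLM.contDiff (n := ∞)
  have hr := Complex.reCLM.contDiff (n := ∞)
  exact (hr.comp_contDiffOn hq.snd).add (ContDiffOn.sum fun A _ =>
    (hi.comp_contDiffOn (contDiffOn_pi.1 hq.fst A)).mul (contDiffOn_fibreCoordInvA hH hu hq A))

theorem contDiffOn_fibreCoordInv (hpos : ∀ p ∈ S, 0 < fibreHeight (H p) (q p)) :
    ContDiffOn ℝ ∞ (fun p => fibreCoordInv (H p) (q p)) S := by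
  have hi := Complex.imCLM.contDiff (n := ∞)
  have hr := Complex.reCLM.contDiff (n := ∞)
  have hA := contDiffOn_fibreCoordInvA hH hu hq
  refine ContDiffOn.prodMk ?_ (ContDiffOn.prodMk ?_ (ContDiffOn.prodMk ?_ ?_))
  · exact ((contDiffOn_fibreHeight hH hu hq).log fun p hp => (hpos p hp).ne').neg.div_const 2
  · exact (hi.comp_contDiffOn hq.snd).sub (ContDiffOn.sum fun A _ =>
      (hr.comp_contDiffOn (contDiffOn_pi.1 hq.fst A)).mul (hA A))
  · exact contDiffOn_pi.2 hA
  · exact contDiffOn_pi.2 fun A => (hr.comp_contDiffOn (contDiffOn_pi.1 hq.fst A)).add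
      (ContDiffOn.sum fun B _ => (hr.comp_contDiffOn (hH A B)).mul (hA B))

end Smooth

section Derivative

/-- The differential of `fibreCoord` as a function of the matrix and the point of the fibre. -/
noncomputable def fibreCoordDeriv (H H' : Matrix (Fin (m + 1)) (Fin (m + 1)) ℂ)
    (y y' : FibreSpace m) : (Fin (m + 1) → ℂ) × ℂ :=
  (fun A => fibreVec H y'.2.2.1 y'.2.2.2 A - ∑ B, H' A B * (y.2.2.1 B : ℂ),
    ((-2 * Real.exp (-2 * y.1) * y'.1 : ℝ) : ℂ)
      + Complex.I * ((y'.2.1 + ∑ A, (y.2.2.2 A * y'.2.2.1 A - y.2.2.1 A * y'.2.2.2 A) : ℝ) : ℂ)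
      + Complex.I * ∑ A, (y.2.2.1 A : ℂ) *
          (2 * fibreVec H y'.2.2.1 y'.2.2.2 A - ∑ B, H' A B * (y.2.2.1 B : ℂ)))


variable {H : ℝ → Matrix (Fin (m + 1)) (Fin (m + 1)) ℂ}
  {H' : Matrix (Fin (m + 1)) (Fin (m + 1)) ℂ} {y : ℝ → FibreSpace m} {y' : FibreSpace m} {t : ℝ}

/-- The derivative of `fibreCoord` along a curve. -/
theorem hasDerivAt_fibreCoord (hH : ∀ A B, HasDerivAt (fun s => H s A B) (H' A B) t)
    (hsymm : ∀ A B, H t A B = H t B A) (hy : HasDerivAt y y' t) :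
    HasDerivAt (fun s => fibreCoord (H s) (y s)) (fibreCoordDeriv (H t) H' (y t) y') t := by
  have h1 : HasDerivAt (fun s => (y s).1) y'.1 t := hy.fst
  have h2 : HasDerivAt (fun s => (y s).2.1) y'.2.1 t := hy.snd.fst
  have h3 : ∀ A, HasDerivAt (fun s => (y s).2.2.1 A) (y'.2.2.1 A) t :=
    hasDerivAt_pi.1 hy.snd.snd.fst
  have h4 : ∀ A, HasDerivAt (fun s => (y s).2.2.2 A) (y'.2.2.2 A) t :=
    hasDerivAt_pi.1 hy.snd.snd.snd
  have hW : ∀ A, HasDerivAt (fun s => fibreVec (H s) (y s).2.2.1 (y s).2.2.2 A)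
      (fibreVec (H t) y'.2.2.1 y'.2.2.2 A - ∑ B, H' A B * ((y t).2.2.1 B : ℂ)) t := by
    intro A
    have h := (h4 A).ofReal_comp.sub
      (HasDerivAt.fun_sum fun B (_ : B ∈ Finset.univ) => (hH A B).mul (h3 B).ofReal_comp)
    refine h.congr_deriv ?_
    simp only [fibreVec, Finset.sum_add_distrib]
    ring
  refine (hasDerivAt_pi.2 hW).prodMk ?_
  have hS := ((h1.const_mul (-2)).exp.ofReal_comp).add ((h2.ofReal_comp.add
    (HasDerivAt.fun_sum fun A (_ : A ∈ Finset.univ) =>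
      (hW A).mul (h3 A).ofReal_comp)).const_mul Complex.I)
  refine hS.congr_deriv ?_
  -- The derivative of W_A a^A is rearranged so that the contact term b da - a db of v splits off;
  -- the remainder is linear in W(y') and H'. Symmetry of H is used to move it from a' to a.
  have hsum : ∑ A, ((fibreVec (H t) y'.2.2.1 y'.2.2.2 A
        - ∑ B, H' A B * ((y t).2.2.1 B : ℂ)) * ((y t).2.2.1 A : ℂ)
        + fibreVec (H t) (y t).2.2.1 (y t).2.2.2 A * (y'.2.2.1 A : ℂ))
      = ∑ A, (((y t).2.2.2 A : ℂ) * (y'.2.2.1 A : ℂ) - ((y t).2.2.1 A : ℂ) * (y'.2.2.2 A : ℂ))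
        + ∑ A, ((y t).2.2.1 A : ℂ) * (2 * fibreVec (H t) y'.2.2.1 y'.2.2.2 A
                - ∑ B, H' A B * ((y t).2.2.1 B : ℂ)) := by
    have hsw : ∑ A, (∑ B, H t A B * ((y t).2.2.1 B : ℂ)) * (y'.2.2.1 A : ℂ)
        = ∑ A, ((y t).2.2.1 A : ℂ) * ∑ B, H t A B * (y'.2.2.1 B : ℂ) := by
      simp only [Finset.sum_mul, Finset.mul_sum]
      rw [Finset.sum_comm]
      refine Finset.sum_congr rfl fun A _ => Finset.sum_congr rfl fun B _ => ?_
      rw [hsymm]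
      ring
    rw [← Finset.sum_add_distrib, ← sub_eq_zero, ← Finset.sum_sub_distrib]
    rw [← sub_eq_zero, ← Finset.sum_sub_distrib] at hsw
    rw [← neg_eq_zero, ← Finset.sum_neg_distrib, ← hsw]
    refine Finset.sum_congr rfl fun A _ => ?_
    simp only [fibreVec]
    ring
  rw [hsum]
  push_cast
  ring

/-- At a fixed point the differential is a complex linear expression in W(y'), H' and 2 e^{-2φ} conj
v, so it suffices that each of these is multiplied by i. Hypothesis `hτ` is the condition on conj v.
-/
theorem fibreCoordDeriv_smul_I {H H' : Matrix (Fin (m + 1)) (Fin (m + 1)) ℂ}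
    {y y' y'' : FibreSpace m}
    (hW : fibreVec H y''.2.2.1 y''.2.2.2 = Complex.I • fibreVec H y'.2.2.1 y'.2.2.2)
    (hτ : ((-2 * Real.exp (-2 * y.1) * y''.1 : ℝ) : ℂ) + Complex.I *
        ((y''.2.1 + ∑ A, (y.2.2.2 A * y''.2.2.1 A - y.2.2.1 A * y''.2.2.2 A) : ℝ) : ℂ)
      = Complex.I * (((-2 * Real.exp (-2 * y.1) * y'.1 : ℝ) : ℂ) + Complex.I *
        ((y'.2.1 + ∑ A, (y.2.2.2 A * y'.2.2.1 A - y.2.2.1 A * y'.2.2.2 A) : ℝ) : ℂ))) :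
    fibreCoordDeriv H (Complex.I • H') y y'' = Complex.I • fibreCoordDeriv H H' y y' := by
  have h1 : ∀ A, ∑ B, (Complex.I • H') A B * (y.2.2.1 B : ℂ)
      = Complex.I * ∑ B, H' A B * (y.2.2.1 B : ℂ) := fun A => by
    rw [Finset.mul_sum]
    exact Finset.sum_congr rfl fun B _ => by
      rw [Matrix.smul_apply, smul_eq_mul, mul_assoc]
  refine Prod.ext (funext fun A => ?_) ?_
  · simp only [fibreCoordDeriv, hW, h1, Prod.smul_fst, Pi.smul_apply, smul_eq_mul]
    ring
  · simp only [fibreCoordDeriv, hW, hτ, h1, Prod.smul_snd, Pi.smul_apply, smul_eq_mul]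
    rw [mul_add Complex.I (_ + _)]
    congr 2
    rw [Finset.mul_sum]
    exact Finset.sum_congr rfl fun A _ => by ring

end Derivative

end ProjectiveSpecialKahlerDomain

/-! ### Integrability of J_3 and the complex submanifolds -/

namespace ProjectiveSpecialKahlerDomain

variable {m : ℕ} (D : ProjectiveSpecialKahlerDomain m)
  {e : (Fin m → ℂ) → Matrix (Fin m) (Fin m) ℂ}

/-- Holomorphic coordinates on the total space, centred so that `M_sk × {y₀}` and `{z₀} × G` are
coordinate subspaces. -/
noncomputable def chartMap (z₀ : Fin m → ℂ) (y₀ : FibreSpace m) (p : TotalSpace m) :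
    (Fin m → ℂ) × ((Fin (m + 1) → ℂ) × ℂ) :=
  (p.1 - z₀, fibreCoord (prepotentialHessian D.F (homogeneous p.1)) p.2
    - fibreCoord (prepotentialHessian D.F (homogeneous p.1)) y₀)

/-- The fibre part of a point in the coordinates `chartMap`, before centring. -/
noncomputable def uncentre (z₀ : Fin m → ℂ) (y₀ : FibreSpace m)
    (q : (Fin m → ℂ) × ((Fin (m + 1) → ℂ) × ℂ)) : (Fin (m + 1) → ℂ) × ℂ :=
  q.2 + fibreCoord (prepotentialHessian D.F (homogeneous (q.1 + z₀))) y₀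

/-- The inverse of `chartMap`. -/
noncomputable def chartInv (z₀ : Fin m → ℂ) (y₀ : FibreSpace m)
    (q : (Fin m → ℂ) × ((Fin (m + 1) → ℂ) × ℂ)) : TotalSpace m :=
  (q.1 + z₀, fibreCoordInv (prepotentialHessian D.F (homogeneous (q.1 + z₀)))
    (D.uncentre z₀ y₀ q))

/-- The points of `chartTarget` without the height condition. -/
def chartDomain (z₀ : Fin m → ℂ) : Set ((Fin m → ℂ) × ((Fin (m + 1) → ℂ) × ℂ)) :=
  {q | q.1 + z₀ ∈ D.base}

/-- The image of `chartMap`. -/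
def chartTarget (z₀ : Fin m → ℂ) (y₀ : FibreSpace m) :
    Set ((Fin m → ℂ) × ((Fin (m + 1) → ℂ) × ℂ)) :=
  D.chartDomain z₀ ∩ {q | 0 < fibreHeight (prepotentialHessian D.F (homogeneous (q.1 + z₀)))
    (D.uncentre z₀ y₀ q)}

theorem isOpen_chartDomain (z₀ : Fin m → ℂ) : IsOpen (D.chartDomain z₀) :=
  D.isOpen_base.preimage (by fun_prop)

theorem contDiffOn_chartMap (z₀ : Fin m → ℂ) (y₀ : FibreSpace m) :
    ContDiffOn ℝ ∞ (D.chartMap z₀ y₀) D.total := by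
  have hH : ∀ A B, ContDiffOn ℝ ∞
      (fun p : TotalSpace m => prepotentialHessian D.F (homogeneous p.1) A B) D.total :=
    fun A B => D.comp_fst_contDiffOn ((D.contDiffOn_hessian A B).restrict_scalars ℝ)
  exact ContDiffOn.prodMk (by fun_prop) ((contDiffOn_fibreCoord hH contDiff_snd.contDiffOn).sub
    (contDiffOn_fibreCoord hH contDiffOn_const))

theorem contDiffOn_hessian_add (z₀ : Fin m → ℂ) (A B : Fin (m + 1)) : ContDiffOn ℝ ∞
    (fun q : (Fin m → ℂ) × ((Fin (m + 1) → ℂ) × ℂ) =>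
      prepotentialHessian D.F (homogeneous (q.1 + z₀)) A B) (D.chartDomain z₀) :=
  ((D.contDiffOn_hessian A B).restrict_scalars ℝ).comp
    (contDiff_fst.add contDiff_const).contDiffOn fun _ hq => hq

theorem contDiffOn_uncentre (z₀ : Fin m → ℂ) (y₀ : FibreSpace m) :
    ContDiffOn ℝ ∞ (D.uncentre z₀ y₀) (D.chartDomain z₀) :=
  contDiff_snd.contDiffOn.add
    (contDiffOn_fibreCoord (D.contDiffOn_hessian_add z₀) contDiffOn_const)

variable {D} (he : D.IsVielbein e)
include he

theorem isUnit_det_chart {z₀ : Fin m → ℂ} {q : (Fin m → ℂ) × ((Fin (m + 1) → ℂ) × ℂ)}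
    (hq : q ∈ D.chartDomain z₀) :
    IsUnit ((prepotentialHessian D.F (homogeneous (q.1 + z₀))).map Complex.im).det :=
  isUnit_det_imHessian he hq

theorem isOpen_chartTarget (z₀ : Fin m → ℂ) (y₀ : FibreSpace m) :
    IsOpen (D.chartTarget z₀ y₀) :=
  ContinuousOn.isOpen_inter_preimage (contDiffOn_fibreHeight (D.contDiffOn_hessian_add z₀)
    (fun _ hq => isUnit_det_chart he hq) (D.contDiffOn_uncentre z₀ y₀)).continuousOn
    (D.isOpen_chartDomain z₀) isOpen_Ioi

theorem contDiffOn_chartInv (z₀ : Fin m → ℂ) (y₀ : FibreSpace m) :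
    ContDiffOn ℝ ∞ (D.chartInv z₀ y₀) (D.chartTarget z₀ y₀) :=
  ContDiffOn.prodMk (by fun_prop) (contDiffOn_fibreCoordInv
    (fun A B => (D.contDiffOn_hessian_add z₀ A B).mono Set.inter_subset_left)
    (fun _ hq => isUnit_det_chart he hq.1)
    ((D.contDiffOn_uncentre z₀ y₀).mono Set.inter_subset_left) fun _ hq => hq.2)

/-- `chartMap` as a homeomorphism between open sets. -/
noncomputable def totalChart (z₀ : Fin m → ℂ) (y₀ : FibreSpace m) :
    OpenPartialHomeomorph (TotalSpace m) ((Fin m → ℂ) × ((Fin (m + 1) → ℂ) × ℂ)) where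
  toFun := D.chartMap z₀ y₀
  invFun := D.chartInv z₀ y₀
  source := D.total
  target := D.chartTarget z₀ y₀
  map_source' p hp := by
    refine ⟨?_, ?_⟩
    · simpa [chartDomain, chartMap] using hp.1
    · simp only [Set.mem_ofPred_eq, uncentre, chartMap, sub_add_cancel]
      rw [fibreHeight_fibreCoord (isUnit_det_imHessian he hp.1)]
      exact Real.exp_pos _
  map_target' q hq := ⟨hq.1, trivial⟩
  left_inv' p hp := by
    refine Prod.ext (sub_add_cancel _ _) ?_
    simp only [chartInv, uncentre, chartMap, sub_add_cancel]
    exact fibreCoordInv_fibreCoord (isUnit_det_imHessian he hp.1) _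
  right_inv' q hq := by
    refine Prod.ext (add_sub_cancel_right _ _) ?_
    simp only [chartInv, chartMap]
    rw [fibreCoord_fibreCoordInv (isUnit_det_imHessian he hq.1) hq.2, uncentre, add_sub_cancel_right]
  open_source := D.isOpen_total
  open_target := isOpen_chartTarget he z₀ y₀
  continuousOn_toFun := (D.contDiffOn_chartMap z₀ y₀).continuousOn
  continuousOn_invFun := (contDiffOn_chartInv he z₀ y₀).continuousOn


-- Computed along the line p + tX. The entries of H vary holomorphically with z, so their
-- derivatives are complex linear in X.1; the centring term sees only this variation, since y₀ is
-- constant.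
omit he in
theorem fderiv_chartMap {p : TotalSpace m} (hp : p ∈ D.total) (z₀ : Fin m → ℂ)
    (y₀ : FibreSpace m) (X : TotalSpace m) :
    fderiv ℝ (D.chartMap z₀ y₀) p X = (X.1,
      fibreCoordDeriv (prepotentialHessian D.F (homogeneous p.1)) (Matrix.of fun A B =>
        fderiv ℂ (fun w => prepotentialHessian D.F (homogeneous w) A B) p.1 X.1) p.2 X.2
      - fibreCoordDeriv (prepotentialHessian D.F (homogeneous p.1)) (Matrix.of fun A B =>
        fderiv ℂ (fun w => prepotentialHessian D.F (homogeneous w) A B) p.1 X.1) y₀ 0) := by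
  have hline : HasDerivAt (fun t : ℝ => p + t • X) X 0 := by
    simpa using ((hasDerivAt_id (0 : ℝ)).smul_const X).const_add p
  have hl1 : HasDerivAt (fun t : ℝ => (p + t • X).1) X.1 0 := hline.fst
  have hl2 : HasDerivAt (fun t : ℝ => (p + t • X).2) X.2 0 := hline.snd
  have hd : HasFDerivAt (D.chartMap z₀ y₀) (fderiv ℝ (D.chartMap z₀ y₀) p) (p + (0 : ℝ) • X) := by
    rw [zero_smul, add_zero]
    exact (((D.contDiffOn_chartMap z₀ y₀).contDiffAt (D.isOpen_total.mem_nhds hp)).differentiableAt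
      (by simp)).hasFDerivAt
  have hH : ∀ A B, HasDerivAt
      (fun t : ℝ => prepotentialHessian D.F (homogeneous (p + t • X).1) A B)
      (fderiv ℂ (fun w => prepotentialHessian D.F (homogeneous w) A B) p.1 X.1) 0 := by
    intro A B
    have h1 : HasFDerivAt (fun w => prepotentialHessian D.F (homogeneous w) A B)
        ((fderiv ℂ (fun w => prepotentialHessian D.F (homogeneous w) A B) p.1).restrictScalars ℝ)
        ((p + (0 : ℝ) • X).1) := by
      rw [zero_smul, add_zero]
      exact (differentiableAt_hessian_homogeneous hp.1 A B).hasFDerivAt.restrictScalars ℝ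
    exact h1.comp_hasDerivAt (0 : ℝ) hl1
  have hs : ∀ A B, prepotentialHessian D.F (homogeneous (p + (0 : ℝ) • X).1) A B
      = prepotentialHessian D.F (homogeneous (p + (0 : ℝ) • X).1) B A := by
    rw [zero_smul, add_zero]
    exact D.hessian_symm hp.1
  have h2 := (hl1.sub_const z₀).prodMk
    ((hasDerivAt_fibreCoord (H' := Matrix.of fun A B =>
        fderiv ℂ (fun w => prepotentialHessian D.F (homogeneous w) A B) p.1 X.1)
      hH hs hl2).sub (hasDerivAt_fibreCoord (H' := Matrix.of fun A B =>
        fderiv ℂ (fun w => prepotentialHessian D.F (homogeneous w) A B) p.1 X.1)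
      hH hs (hasDerivAt_const (0 : ℝ) y₀)))
  have h3 := (hd.comp_hasDerivAt (0 : ℝ) hline).unique h2
  rw [zero_smul, add_zero] at h3
  exact h3

/-- J_3 multiplies dz, the vector db - F da and conj v by i, and the differential of the chart is
complex linear in these. The centring term falls under the same lemma with zero fibre velocity. -/
theorem fderiv_chartMap_cMapStructure {p : TotalSpace m} (hp : p ∈ D.total) (z₀ : Fin m → ℂ)
    (y₀ : FibreSpace m) (X : TotalSpace m) :
    fderiv ℝ (D.chartMap z₀ y₀) p (D.cMapStructure e 2 p X)
      = Complex.I • fderiv ℝ (D.chartMap z₀ y₀) p X := by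
  have hH : (Matrix.of fun A B => fderiv ℂ (fun w => prepotentialHessian D.F (homogeneous w) A B)
        p.1 (Complex.I • X.1))
      = Complex.I • (Matrix.of fun A B =>
        fderiv ℂ (fun w => prepotentialHessian D.F (homogeneous w) A B) p.1 X.1) := by
    ext A B
    simp
  have hV := congrArg conj (formV_cMapStructure_two he hp X)
  have hconj : ∀ Y : TotalSpace m, (2 * Real.exp (-2 * p.2.1) : ℂ) * conj (formV p Y)
      = ((-2 * Real.exp (-2 * p.2.1) * Y.2.1 : ℝ) : ℂ) + Complex.I *
        ((Y.2.2.1 + ∑ A, (p.2.2.2.2 A * Y.2.2.2.1 A - p.2.2.2.1 A * Y.2.2.2.2 A) : ℝ) : ℂ) := by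
    intro Y
    have h2 : (Real.exp (-2 * p.2.1) : ℂ) * (Real.exp (2 * p.2.1) : ℂ) = 1 := by
      rw [← Complex.ofReal_mul, ← Real.exp_add]
      simp
    rw [formV_eq]
    simp only [map_sub, map_neg, map_mul, Complex.conj_ofReal, Complex.conj_I]
    simp only [Complex.ofReal_mul, Complex.ofReal_div, Complex.ofReal_neg, Complex.ofReal_ofNat]
    linear_combination (Complex.I * ((Y.2.2.1
      + ∑ A, (p.2.2.2.2 A * Y.2.2.2.1 A - p.2.2.2.1 A * Y.2.2.2.2 A) : ℝ) : ℂ)) * h2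
  rw [fderiv_chartMap hp, fderiv_chartMap hp, cMapStructure_two_fst he hp, hH,
    fibreCoordDeriv_smul_I (baseVec_cMapStructure_two he hp X),
    fibreCoordDeriv_smul_I (y' := 0) (y'' := 0), ← smul_sub]
  · rfl
  · ext A
    simp [fibreVec]
  · simp
  · rw [← hconj, ← hconj, hV]
    simp only [map_neg, map_mul, Complex.conj_I]
    ring

theorem isHolomorphicChart_totalChart (z₀ : Fin m → ℂ) (y₀ : FibreSpace m) :
    IsHolomorphicChart D.total (D.cMapStructure e 2)
      ((totalChart he z₀ y₀).transHomeomorph (totalCoord m (m + 1)).toHomeomorph) :=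
  isHolomorphicChart_transHomeomorph _ subset_rfl (D.contDiffOn_chartMap z₀ y₀)
    (contDiffOn_chartInv he z₀ y₀) fun _ hp X => fderiv_chartMap_cMapStructure he hp z₀ y₀ X

theorem isIntegrableComplex_cMapStructure_two :
    IsIntegrableComplex D.total (D.cMapStructure e 2) where
  almostComplex := isAlmostComplex_cMapStructure_two he
  exists_chart _ hp := ⟨_, _, isHolomorphicChart_totalChart he 0 0, hp⟩

theorem isHermitianStructure_cMapStructure_two :
    IsHermitianStructure D.total (D.metric e) (D.cMapStructure e 2) where
  metric := isRiemannianMetric_metric he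
  integrable := isIntegrableComplex_cMapStructure_two he
  compatible _ hp X Y := metric_cMapStructure_two he hp X Y

theorem totalChart_coord_castAdd (z₀ : Fin m → ℂ) (y₀ : FibreSpace m) (p : TotalSpace m)
    (i : Fin m) : ((totalChart he z₀ y₀).transHomeomorph (totalCoord m (m + 1)).toHomeomorph) p
      (Fin.castAdd (m + 1 + 1) i) = p.1 i - z₀ i :=
  totalCoord_castAdd _ _ _ _

theorem totalChart_coord_natAdd (z₀ : Fin m → ℂ) (y₀ : FibreSpace m) (p : TotalSpace m)
    (i : Fin (m + 1 + 1)) :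
    ((totalChart he z₀ y₀).transHomeomorph (totalCoord m (m + 1)).toHomeomorph) p
      (Fin.natAdd m i) = snocCoord (m + 1)
        (fibreCoord (prepotentialHessian D.F (homogeneous p.1)) p.2
          - fibreCoord (prepotentialHessian D.F (homogeneous p.1)) y₀) i :=
  totalCoord_natAdd _ _ _ _

/-- In the chart centred at y the last m + 2 coordinates vanish exactly where the fibre coordinates
of the point and of y agree; these coordinates are injective over each base point. -/
theorem isComplexSubmanifold_base (y : FibreSpace m) :
    IsComplexSubmanifold D.total (D.cMapStructure e 2) (D.base ×ˢ {y}) := by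
  refine ⟨Set.prod_mono subset_rfl (Set.subset_univ _), fun p hp =>
    ⟨_, _, Set.range (Fin.natAdd m), isHolomorphicChart_totalChart he 0 y, ⟨hp.1, trivial⟩, ?_⟩⟩
  rintro x hx
  have hx1 : x.1 ∈ D.base := hx.1
  rw [Set.forall_mem_range]
  simp only [totalChart_coord_natAdd]
  constructor
  · rintro ⟨-, hy⟩ i
    rw [Set.mem_singleton_iff] at hy
    rw [hy, sub_self, map_zero, Pi.zero_apply]
  · intro h
    refine ⟨hx1, ?_⟩
    have h1 := (map_eq_zero_iff (snocCoord (m + 1)) (snocCoord (m + 1)).injective).1 (funext h)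
    have h2 := sub_eq_zero.1 h1
    rw [Set.mem_singleton_iff, ← fibreCoordInv_fibreCoord (isUnit_det_imHessian he hx1) x.2]
    exact (congrArg _ h2).trans (fibreCoordInv_fibreCoord (isUnit_det_imHessian he hx1) y)

theorem isComplexSubmanifold_fibre {z : Fin m → ℂ} (hz : z ∈ D.base) :
    IsComplexSubmanifold D.total (D.cMapStructure e 2) ({z} ×ˢ Set.univ) := by
  refine ⟨Set.prod_mono (Set.singleton_subset_iff.2 hz) subset_rfl, fun p hp =>
    ⟨_, _, Set.range (Fin.castAdd (m + 1 + 1)), isHolomorphicChart_totalChart he z 0,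
      ⟨by rw [Set.mem_singleton_iff.1 hp.1]; exact hz, trivial⟩, ?_⟩⟩
  rintro x -
  rw [Set.forall_mem_range]
  simp only [totalChart_coord_castAdd, sub_eq_zero]
  simp [Set.mem_prod, funext_iff]

end ProjectiveSpecialKahlerDomain

/-! ### The induced structure on a fibre is Hermitian and not Kähler -/

namespace ProjectiveSpecialKahlerDomain

section

variable {m : ℕ} (H : Matrix (Fin (m + 1)) (Fin (m + 1)) ℂ)

theorem contDiff_fibreCoord : ContDiff ℝ ∞ (fibreCoord H) :=
  contDiffOn_univ.1 (contDiffOn_fibreCoord (H := fun _ : FibreSpace m => H)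
    (fun _ _ => contDiffOn_const) contDiffOn_id)

variable {H} (hH : IsUnit (H.map Complex.im).det)
include hH

theorem isOpen_setOf_fibreHeight_pos : IsOpen {q | 0 < fibreHeight H q} :=
  isOpen_Ioi.preimage (contDiffOn_univ.1 (contDiffOn_fibreHeight
    (H := fun _ : (Fin (m + 1) → ℂ) × ℂ => H) (fun _ _ => contDiffOn_const) (fun _ _ => hH)
    contDiffOn_id)).continuous

theorem contDiffOn_fibreCoordInv_const :
    ContDiffOn ℝ ∞ (fibreCoordInv H) {q | 0 < fibreHeight H q} :=
  contDiffOn_fibreCoordInv (H := fun _ : (Fin (m + 1) → ℂ) × ℂ => H)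
    (fun _ _ => contDiffOn_const) (fun _ _ => hH) contDiffOn_id fun _ hq => hq

end

variable {m : ℕ} {D : ProjectiveSpecialKahlerDomain m}
  {e : (Fin m → ℂ) → Matrix (Fin m) (Fin m) ℂ} (he : D.IsVielbein e)
  {z : Fin m → ℂ} (hz : z ∈ D.base)
include he hz

theorem isRiemannianMetric_fibreMetric :
    IsRiemannianMetric Set.univ (D.fibreMetric e z) where
  smooth X Y := ((isRiemannianMetric_metric he).smooth (0, X) (0, Y)).comp
    (contDiff_const.prodMk contDiff_id).contDiffOn fun _ _ => ⟨hz, trivial⟩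
  add_left y _ X X' Y := by
    have := (isRiemannianMetric_metric he).add_left (z, y) ⟨hz, trivial⟩ (0, X) (0, X') (0, Y)
    rw [Prod.mk_add_mk, add_zero] at this
    exact this
  smul_left y _ c X Y := by
    have := (isRiemannianMetric_metric he).smul_left (z, y) ⟨hz, trivial⟩ c (0, X) (0, Y)
    rw [Prod.smul_mk, smul_zero] at this
    exact this
  symm y _ X Y := (isRiemannianMetric_metric he).symm (z, y) ⟨hz, trivial⟩ _ _
  pos y _ X hX := (isRiemannianMetric_metric he).pos (z, y) ⟨hz, trivial⟩ _ fun h =>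
    hX (congrArg Prod.snd h)

/-- `fibreCoord` at a fixed base point as a homeomorphism between open sets. -/
noncomputable def fibreChart :
    OpenPartialHomeomorph (FibreSpace m) ((Fin (m + 1) → ℂ) × ℂ) where
  toFun := fibreCoord (prepotentialHessian D.F (homogeneous z))
  invFun := fibreCoordInv (prepotentialHessian D.F (homogeneous z))
  source := Set.univ
  target := {q | 0 < fibreHeight (prepotentialHessian D.F (homogeneous z)) q}
  map_source' y _ := by
    rw [Set.mem_ofPred_eq, fibreHeight_fibreCoord (isUnit_det_imHessian he hz)]
    exact Real.exp_pos _
  map_target' _ _ := trivial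
  left_inv' y _ := fibreCoordInv_fibreCoord (isUnit_det_imHessian he hz) y
  right_inv' q hq := fibreCoord_fibreCoordInv (isUnit_det_imHessian he hz) hq
  open_source := isOpen_univ
  open_target := isOpen_setOf_fibreHeight_pos (isUnit_det_imHessian he hz)
  continuousOn_toFun := (contDiff_fibreCoord _).continuous.continuousOn
  continuousOn_invFun :=
    (contDiffOn_fibreCoordInv_const (isUnit_det_imHessian he hz)).continuousOn

/-- Over a fixed base point the centring term is constant, so the fibre coordinates inherit
holomorphy from the chart of the total space. -/
theorem fderiv_fibreCoord_fibreEndomorphism (y X : FibreSpace m) :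
    fderiv ℝ (fibreCoord (prepotentialHessian D.F (homogeneous z))) y
        (fibreEndomorphism (D.cMapStructure e 2) z y X)
      = Complex.I • fderiv ℝ (fibreCoord (prepotentialHessian D.F (homogeneous z))) y X := by
  have hp : ((z, y) : TotalSpace m) ∈ D.total := ⟨hz, trivial⟩
  have hd : HasFDerivAt (D.chartMap 0 0) (fderiv ℝ (D.chartMap 0 0) (z, y)) (z, y) :=
    (((D.contDiffOn_chartMap 0 0).contDiffAt (D.isOpen_total.mem_nhds hp)).differentiableAt
      (by simp)).hasFDerivAt
  have h1 := (hd.snd.comp y (hasFDerivAt_prodMk_right z y)).add_const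
    (fibreCoord (prepotentialHessian D.F (homogeneous z)) 0)
  have h2 : (fun y => ((fun p => (D.chartMap 0 0 p).2) ∘ Prod.mk z) y
      + fibreCoord (prepotentialHessian D.F (homogeneous z)) 0)
      = fibreCoord (prepotentialHessian D.F (homogeneous z)) := by
    ext1 y
    exact sub_add_cancel _ _
  rw [h2] at h1
  have h3 : ∀ X, fderiv ℝ (fibreCoord (prepotentialHessian D.F (homogeneous z))) y X
      = (fderiv ℝ (D.chartMap 0 0) (z, y) (0, X)).2 := fun X => by
    rw [h1.fderiv]
    rfl
  rw [h3, h3, ← cMapStructure_two_vertical he hz, fderiv_chartMap_cMapStructure he hp]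
  rfl

theorem fibreEndomorphism_sq (y X : FibreSpace m) :
    fibreEndomorphism (D.cMapStructure e 2) z y
      (fibreEndomorphism (D.cMapStructure e 2) z y X) = -X := by
  have h := (isAlmostComplex_cMapStructure_two he).sq (z, y) ⟨hz, trivial⟩ (0, X)
  rw [cMapStructure_two_vertical he hz, cMapStructure_two_vertical he hz] at h
  exact congrArg Prod.snd h

theorem isHermitianStructure_fibre :
    IsHermitianStructure Set.univ (D.fibreMetric e z)
      (fibreEndomorphism (D.cMapStructure e 2) z) where
  metric := isRiemannianMetric_fibreMetric he hz
  integrable :=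
    { almostComplex :=
        { smooth := by
            have h : ContDiffOn ℝ ∞ (fun y : FibreSpace m => D.cMapStructure e 2 (z, y))
                Set.univ := (contDiffOn_cMapStructure he 2).comp
              (contDiff_const.prodMk contDiff_id).contDiffOn fun _ _ => ⟨hz, trivial⟩
            exact contDiffOn_const.clm_comp (h.clm_comp contDiffOn_const)
          sq := fun y _ X => fibreEndomorphism_sq he hz y X }
      exists_chart := fun y _ => ⟨_, _, isHolomorphicChart_transHomeomorph
        (Ψ := fibreChart he hz) (snocCoord (m + 1)) (Set.subset_univ _)
        (contDiff_fibreCoord _).contDiffOn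
        (contDiffOn_fibreCoordInv_const (isUnit_det_imHessian he hz))
        (fun y _ X => fderiv_fibreCoord_fibreEndomorphism he hz y X), trivial⟩ }
  compatible y _ X Y := by
    have h := metric_cMapStructure_two he (p := (z, y)) ⟨hz, trivial⟩ (0, X) (0, Y)
    rw [cMapStructure_two_vertical he hz, cMapStructure_two_vertical he hz] at h
    exact h

/-- The signs of J_3 give Im(u ū) - Im(v v̄) - ∑ Im(E Ē). Writing the last sum through
`im_formU_add_sum_formE` eliminates E, at the price of doubling the u-term. -/
theorem fundamentalForm_fibre (y X Y : FibreSpace m) :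
    fundamentalForm (D.fibreMetric e z) (fibreEndomorphism (D.cMapStructure e 2) z) y X Y
      = Real.exp (2 * y.1) *
        (2 * Real.exp (kahlerPotential D.F z) *
            ((∑ A, homogeneous z A * D.baseVec z X.2.2.1 X.2.2.2 A)
              * conj (∑ A, homogeneous z A * D.baseVec z Y.2.2.1 Y.2.2.2 A)).im
          + (∑ A, (X.2.2.2 A * Y.2.2.1 A - X.2.2.1 A * Y.2.2.2 A)) / 2
          + (X.1 * (Y.2.1 + ∑ A, (y.2.2.2 A * Y.2.2.1 A - y.2.2.1 A * Y.2.2.2 A))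
            - (X.2.1 + ∑ A, (y.2.2.2 A * X.2.2.1 A - y.2.2.1 A * X.2.2.2 A)) * Y.1) / 2) := by
  have hp : ((z, y) : TotalSpace m) ∈ D.total := ⟨hz, trivial⟩
  have h1 : fundamentalForm (D.fibreMetric e z) (fibreEndomorphism (D.cMapStructure e 2) z) y X Y
      = ∑ k, ((D.formsUe e k (z, y) (0, X) * conj (D.formsUe e k (z, y) (0, Y))).im
        - (D.formsVE e k (z, y) (0, X) * conj (D.formsVE e k (z, y) (0, Y))).im) := by
    rw [fundamentalForm, fibreMetric, ← cMapStructure_two_vertical he hz, metric]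
    refine Finset.sum_congr rfl fun k _ => ?_
    rw [formsUe_cMapStructure_two he hp, formsVE_cMapStructure_two he hp]
    simp [Complex.mul_re, Complex.mul_im]
    ring
  have h2 := im_formU_add_sum_formE he hz (z, y) (0, X) (0, Y) rfl
  have h3 : ∑ k, ((D.formsUe e k (z, y) (0, X) * conj (D.formsUe e k (z, y) (0, Y))).im
        - (D.formsVE e k (z, y) (0, X) * conj (D.formsVE e k (z, y) (0, Y))).im)
      = 2 * (D.formU (z, y) (0, X) * conj (D.formU (z, y) (0, Y))).im
        - (formV ((z, y) : TotalSpace m) (0, X) * conj (formV ((z, y) : TotalSpace m) (0, Y))).im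
        - (D.formU (z, y) (0, X) * conj (D.formU (z, y) (0, Y))
          + ∑ β, D.formE e β (z, y) (0, X) * conj (D.formE e β (z, y) (0, Y))).im := by
    rw [Fin.sum_univ_succ]
    simp only [formsUe, formsVE, Fin.cons_zero, Fin.cons_succ]
    have hB : ∀ β X, formBase e β ((z, y) : TotalSpace m) (0, X) = 0 := fun β X => by
      simp [formBase]
    simp only [hB, zero_mul, Complex.zero_im, zero_sub, Complex.add_im, Complex.im_sum,
      Finset.sum_neg_distrib]
    ring
  have h4 : (D.formU (z, y) (0, X) * conj (D.formU (z, y) (0, Y))).im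
      = Real.exp (2 * y.1) * Real.exp (kahlerPotential D.F z) *
        ((∑ A, homogeneous z A * D.baseVec z X.2.2.1 X.2.2.2 A)
              * conj (∑ A, homogeneous z A * D.baseVec z Y.2.2.1 Y.2.2.2 A)).im := by
    rw [← Complex.im_ofReal_mul]
    congr 1
    have hx : Real.exp (2 * y.1) * Real.exp (kahlerPotential D.F z)
        = Real.exp (kahlerPotential D.F z / 2 + y.1) * Real.exp (kahlerPotential D.F z / 2 + y.1) := by
      rw [← Real.exp_add, ← Real.exp_add]
      congr 1
      ring
    rw [hx, formU_eq, formU_eq]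
    simp only [map_mul, Complex.conj_I, Complex.conj_ofReal, Complex.ofReal_mul]
    linear_combination (-(Real.exp (kahlerPotential D.F z / 2 + y.1) : ℂ)
      * (Real.exp (kahlerPotential D.F z / 2 + y.1) : ℂ)
      * (∑ A, homogeneous z A * D.baseVec z X.2.2.1 X.2.2.2 A)
      * conj (∑ A, homogeneous z A * D.baseVec z Y.2.2.1 Y.2.2.2 A)) * Complex.I_sq
  have h5 : ∀ X, (formV ((z, y) : TotalSpace m) (0, X)).re = -X.1 := fun X => by
    simp [formV_eq, -Complex.ofReal_exp, -Complex.ofReal_mul]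
  have h6 : ∀ X, (formV ((z, y) : TotalSpace m) (0, X)).im = -(Real.exp (2 * y.1) / 2 *
      (X.2.1 + ∑ A, (y.2.2.2 A * X.2.2.1 A - y.2.2.1 A * X.2.2.2 A))) := fun X => by
    rw [formV_eq, Complex.sub_im, Complex.I_mul_im, Complex.ofReal_re]
    simp
  have h7 : (formV ((z, y) : TotalSpace m) (0, X) * conj (formV ((z, y) : TotalSpace m) (0, Y))).im
      = Real.exp (2 * y.1) / 2
        * ((X.2.1 + ∑ A, (y.2.2.2 A * X.2.2.1 A - y.2.2.1 A * X.2.2.2 A)) * Y.1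
          - X.1 * (Y.2.1 + ∑ A, (y.2.2.2 A * Y.2.2.1 A - y.2.2.1 A * Y.2.2.2 A))) := by
    rw [Complex.mul_im, Complex.conj_re, Complex.conj_im, h5, h5, h6, h6]
    ring
  rw [h1, h3, h2, h4, h7]
  ring

-- The three coefficient functions occurring in the exterior derivative at the origin all have this
-- shape.
omit he hz in
theorem fderiv_exp_mul_apply (c : ℝ) (α β : Fin (m + 1) → ℝ) (X : FibreSpace m) :
    fderiv ℝ (fun y : FibreSpace m => Real.exp (2 * y.1) *
      (c + ∑ A, (y.2.2.2 A * α A - y.2.2.1 A * β A) / 2)) 0 X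
      = 2 * X.1 * c + ∑ A, (X.2.2.2 A * α A - X.2.2.1 A * β A) / 2 := by
  set f : FibreSpace m → ℝ := fun y => Real.exp (2 * y.1) *
      (c + ∑ A, (y.2.2.2 A * α A - y.2.2.1 A * β A) / 2) with hf
  have hd : DifferentiableAt ℝ f ((0 : ℝ) • X) := by
    have : Differentiable ℝ f := by
      simp only [hf]
      fun_prop
    exact this _
  have hline : HasDerivAt (fun t : ℝ => t • X) X 0 := by
    simpa using (hasDerivAt_id (0 : ℝ)).smul_const X
  have h1 := hd.hasFDerivAt.comp_hasDerivAt (0 : ℝ) hline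
  have h2 : HasDerivAt (fun t : ℝ => Real.exp (2 * (t * X.1)) *
      (c + t * ∑ A, (X.2.2.2 A * α A - X.2.2.1 A * β A) / 2))
      (2 * X.1 * c + ∑ A, (X.2.2.2 A * α A - X.2.2.1 A * β A) / 2) 0 := by
    have := ((((hasDerivAt_id (0 : ℝ)).mul_const X.1).const_mul 2).exp).fun_mul
      (((hasDerivAt_id (0 : ℝ)).mul_const
        (∑ A, (X.2.2.2 A * α A - X.2.2.1 A * β A) / 2)).const_add c)
    simpa using this
  have h3 : (f ∘ fun t : ℝ => t • X) = fun t : ℝ => Real.exp (2 * (t * X.1)) *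
      (c + t * ∑ A, (X.2.2.2 A * α A - X.2.2.1 A * β A) / 2) := by
    ext t
    simp only [hf, Function.comp, Prod.smul_fst, Prod.smul_snd, Pi.smul_apply, smul_eq_mul,
      Finset.mul_sum]
    congr 2
    exact Finset.sum_congr rfl fun A _ => by ring
  rw [h3] at h1
  have h4 := h1.unique h2
  rwa [zero_smul] at h4

/-- The exterior derivative is evaluated at the origin on ∂_φ, Y₀ and a vector (0, 0, a', b') whose
W is i times that of Y₀. The contributions of the symplectic form cancel, leaving -4 e^K from the
doubled u-term. -/
theorem not_isKahlerStructure_fibre :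
    ¬ IsKahlerStructure Set.univ (D.fibreMetric e z)
      (fibreEndomorphism (D.cMapStructure e 2) z) := by
  intro hK
  have hp : ((z, (0 : FibreSpace m)) : TotalSpace m) ∈ D.total := ⟨hz, trivial⟩
  -- The last coordinate of Z is 1, so this direction has Z^A W_A = 1 and u does not vanish on it.
  set b : Fin (m + 1) → ℝ := Pi.single (Fin.last m) 1 with hb
  set Y₀ : FibreSpace m := (0, 0, 0, b) with hY₀
  obtain ⟨a', b', hW⟩ : ∃ a' b', D.baseVec z a' b' = Complex.I • D.baseVec z 0 b :=
    ⟨_, _, baseVec_cMapStructure_two he hp (0, Y₀)⟩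
  have hZ : ∑ A, homogeneous z A * D.baseVec z 0 b A = 1 := by
    have h0 : ∀ A, D.baseVec z 0 b A = (Pi.single (Fin.last m) 1 : Fin (m + 1) → ℂ) A := by
      intro A
      simp only [baseVec, fibreVec, hb, Pi.single_apply]
      split_ifs <;> simp
    simp only [h0, Pi.single_apply, mul_ite, mul_one, mul_zero, Finset.sum_ite_eq',
      Finset.mem_univ, if_true, homogeneous_last]
  have hZ' : ∑ A, homogeneous z A * D.baseVec z a' b' A = Complex.I := by
    calc _ = Complex.I * ∑ A, homogeneous z A * D.baseVec z 0 b A := by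
          rw [hW, Finset.mul_sum]
          exact Finset.sum_congr rfl fun A _ => mul_left_comm _ _ _
      _ = Complex.I := by rw [hZ, mul_one]
  have h := hK.closed 0 trivial (1, 0, 0, 0) Y₀ (0, 0, a', b')
  have hzero : ∑ A, homogeneous z A * D.baseVec z 0 0 A = 0 := by
    simp [baseVec, fibreVec]
  have e1 : (fun y => fundamentalForm (D.fibreMetric e z)
      (fibreEndomorphism (D.cMapStructure e 2) z) y Y₀ (0, 0, a', b'))
      = fun y : FibreSpace m => Real.exp (2 * y.1) *
        ((-2 * Real.exp (kahlerPotential D.F z) + (∑ A, b A * a' A) / 2)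
          + ∑ A, (y.2.2.2 A * (0 : Fin (m + 1) → ℝ) A
            - y.2.2.1 A * (0 : Fin (m + 1) → ℝ) A) / 2) := by
    ext y
    rw [fundamentalForm_fibre he hz]
    simp only [hY₀, hZ, hZ']
    simp
  have e2 : (fun y => fundamentalForm (D.fibreMetric e z)
      (fibreEndomorphism (D.cMapStructure e 2) z) y (0, 0, a', b') (1, 0, 0, 0))
      = fun y : FibreSpace m => Real.exp (2 * y.1) *
        (0 + ∑ A, (y.2.2.2 A * (-a') A - y.2.2.1 A * (-b') A) / 2) := by
    ext y
    rw [fundamentalForm_fibre he hz]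
    simp only [hzero]
    simp [← Finset.sum_div, Finset.sum_add_distrib, Finset.sum_sub_distrib]
    ring
  have e3 : (fun y => fundamentalForm (D.fibreMetric e z)
      (fibreEndomorphism (D.cMapStructure e 2) z) y (1, 0, 0, 0) Y₀)
      = fun y : FibreSpace m => Real.exp (2 * y.1) *
        (0 + ∑ A, (y.2.2.2 A * (0 : Fin (m + 1) → ℝ) A - y.2.2.1 A * b A) / 2) := by
    ext y
    rw [fundamentalForm_fibre he hz]
    simp only [hzero, hY₀]
    simp [← Finset.sum_div]
  -- The three derivatives are -4 e^K + b·a', -b·a'/2 and -a'·b/2.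
  rw [extDerivTwoForm, e1, e2, e3, fderiv_exp_mul_apply, fderiv_exp_mul_apply,
    fderiv_exp_mul_apply] at h
  simp [hY₀, ← Finset.sum_div] at h
  have hc : ∑ A, a' A * b A = ∑ A, b A * a' A := Finset.sum_congr rfl fun A _ => mul_comm _ _
  rw [hc] at h
  linarith [Real.exp_pos (kahlerPotential D.F z)]

end ProjectiveSpecialKahlerDomain

/-! ### The Cayley transform from horospherical coordinates to the ball -/

section Horospherical

variable {k : ℕ}

/-- The contact form `dφ' - 2 Im(ζ · \bar{dζ})` in horospherical coordinates `(φ, φ', ζ)`. -/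
noncomputable def contactForm (x X : ℝ × ℝ × (Fin k → ℂ)) : ℝ :=
  X.2.1 - 2 * (∑ i, x.2.2 i * conj (X.2.2 i)).im

/-- The complex hyperbolic metric in horospherical coordinates. -/
noncomputable def horosphericalMetric (x X Y : ℝ × ℝ × (Fin k → ℂ)) : ℝ :=
  X.1 * Y.1 + Real.exp (2 * x.1) ^ 2 / 4 * (contactForm x X * contactForm x Y)
    + Real.exp (2 * x.1) * (∑ i, X.2.2 i * conj (Y.2.2 i)).re

/-- The Siegel coordinate `e^{-2φ} + |ζ|² - i φ'`. -/
noncomputable def siegelCoord (x : ℝ × ℝ × (Fin k → ℂ)) : ℂ :=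
  ((Real.exp (-2 * x.1) + ∑ i, Complex.normSq (x.2.2 i) : ℝ) : ℂ) - Complex.I * (x.2.1 : ℂ)

/-- The differential of the Siegel coordinate. -/
noncomputable def siegelDeriv (x X : ℝ × ℝ × (Fin k → ℂ)) : ℂ :=
  ((-2 * Real.exp (-2 * x.1) * X.1 : ℝ) : ℂ)
    + ∑ i, (conj (x.2.2 i) * X.2.2 i + x.2.2 i * conj (X.2.2 i)) - Complex.I * (X.2.1 : ℂ)

/-- The Cayley transform from horospherical coordinates to the unit ball. -/
noncomputable def toBall (x : ℝ × ℝ × (Fin k → ℂ)) : EuclideanSpace ℂ (Fin (k + 1)) :=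
  WithLp.toLp 2 (Fin.cons ((siegelCoord x - 1) / (siegelCoord x + 1))
    fun i => 2 * x.2.2 i / (siegelCoord x + 1))

/-- The Siegel coordinate of a point of the unit ball. -/
noncomputable def ballSiegel (w : EuclideanSpace ℂ (Fin (k + 1))) : ℂ := (1 + w 0) / (1 - w 0)

/-- The inverse of the Cayley transform. -/
noncomputable def ofBall (w : EuclideanSpace ℂ (Fin (k + 1))) : ℝ × ℝ × (Fin k → ℂ) :=
  (-Real.log ((ballSiegel w).re - ∑ i : Fin k, Complex.normSq (w i.succ / (1 - w 0))) / 2,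
    -(ballSiegel w).im, fun i => w i.succ / (1 - w 0))

theorem siegelCoord_re (x : ℝ × ℝ × (Fin k → ℂ)) :
    (siegelCoord x).re = Real.exp (-2 * x.1) + ∑ i, Complex.normSq (x.2.2 i) := by
  rw [siegelCoord, Complex.sub_re, Complex.ofReal_re]
  simp

theorem siegelCoord_im (x : ℝ × ℝ × (Fin k → ℂ)) : (siegelCoord x).im = -x.2.1 := by
  rw [siegelCoord, Complex.sub_im, Complex.ofReal_im]
  simp

theorem siegelCoord_re_pos (x : ℝ × ℝ × (Fin k → ℂ)) : 0 < (siegelCoord x).re := by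
  rw [siegelCoord_re]
  exact add_pos_of_pos_of_nonneg (Real.exp_pos _)
    (Finset.sum_nonneg fun i _ => Complex.normSq_nonneg _)

theorem siegelCoord_add_one_ne_zero (x : ℝ × ℝ × (Fin k → ℂ)) : siegelCoord x + 1 ≠ 0 := by
  intro h
  have h1 := congrArg Complex.re h
  have h2 := siegelCoord_re_pos x
  simp only [Complex.add_re, Complex.one_re, Complex.zero_re] at h1
  linarith

/-- From |S+1|² - |S-1|² = 4 Re S, and Re S - |ζ|² = e^{-2φ}. -/
theorem one_sub_norm_sq_toBall (x : ℝ × ℝ × (Fin k → ℂ)) :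
    1 - ‖toBall x‖ ^ 2 = 4 * Real.exp (-2 * x.1) / Complex.normSq (siegelCoord x + 1) := by
  have ht : Complex.normSq (siegelCoord x + 1) ≠ 0 := fun h =>
    siegelCoord_add_one_ne_zero x (Complex.normSq_eq_zero.1 h)
  have h1 : ‖toBall x‖ ^ 2 = (Complex.normSq (siegelCoord x - 1)
      + 4 * ∑ i, Complex.normSq (x.2.2 i)) / Complex.normSq (siegelCoord x + 1) := by
    rw [EuclideanSpace.norm_sq_eq, Fin.sum_univ_succ]
    simp only [toBall, Fin.cons_zero, Fin.cons_succ, ← Complex.normSq_eq_norm_sq,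
      Complex.normSq_div, Complex.normSq_mul]
    rw [add_div, Finset.mul_sum, Finset.sum_div]
    norm_num [Complex.normSq_ofNat]
  have h2 : Complex.normSq (siegelCoord x + 1) - Complex.normSq (siegelCoord x - 1)
      = 4 * (siegelCoord x).re := by
    simp [Complex.normSq_apply]
    ring
  rw [h1, eq_div_iff ht, sub_mul, div_mul_cancel₀ _ ht]
  linear_combination h2 + 4 * siegelCoord_re x

theorem toBall_mem_ball (x : ℝ × ℝ × (Fin k → ℂ)) :
    toBall x ∈ Metric.ball (0 : EuclideanSpace ℂ (Fin (k + 1))) 1 := by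
  have h : 0 < 1 - ‖toBall x‖ ^ 2 := by
    rw [one_sub_norm_sq_toBall]
    have := Complex.normSq_pos.2 (siegelCoord_add_one_ne_zero x)
    positivity
  rw [mem_ball_zero_iff]
  nlinarith [norm_nonneg (toBall x)]

theorem norm_sq_eq_of_ball (w : EuclideanSpace ℂ (Fin (k + 1))) :
    ‖w‖ ^ 2 = Complex.normSq (w 0) + ∑ i : Fin k, Complex.normSq (w i.succ) := by
  rw [EuclideanSpace.norm_sq_eq, Fin.sum_univ_succ]
  simp only [Complex.normSq_eq_norm_sq]

theorem one_sub_apply_zero_ne_zero {w : EuclideanSpace ℂ (Fin (k + 1))}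
    (hw : w ∈ Metric.ball (0 : EuclideanSpace ℂ (Fin (k + 1))) 1) : 1 - w 0 ≠ 0 := by
  intro h
  rw [mem_ball_zero_iff] at hw
  have h1 := norm_sq_eq_of_ball w
  rw [← sub_eq_zero.1 h, Complex.normSq_one] at h1
  have h2 : 0 ≤ ∑ i : Fin k, Complex.normSq (w i.succ) :=
    Finset.sum_nonneg fun i _ => Complex.normSq_nonneg _
  nlinarith [norm_nonneg w]

/-- Shows that the logarithm in the inverse has a positive argument on the ball. -/
theorem height_ball {w : EuclideanSpace ℂ (Fin (k + 1))}
    (hw : w ∈ Metric.ball (0 : EuclideanSpace ℂ (Fin (k + 1))) 1) :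
    (ballSiegel w).re - ∑ i : Fin k, Complex.normSq (w i.succ / (1 - w 0))
      = (1 - ‖w‖ ^ 2) / Complex.normSq (1 - w 0) := by
  have hn : Complex.normSq (1 - w 0) ≠ 0 := fun h =>
    one_sub_apply_zero_ne_zero hw (Complex.normSq_eq_zero.1 h)
  have h1 : (ballSiegel w).re = (1 - Complex.normSq (w 0)) / Complex.normSq (1 - w 0) := by
    rw [ballSiegel, Complex.div_re, ← add_div]
    congr 1
    simp [Complex.normSq_apply]
    ring
  simp only [Complex.normSq_div, ← Finset.sum_div]
  rw [h1, norm_sq_eq_of_ball, ← sub_div]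
  ring

theorem height_ball_pos {w : EuclideanSpace ℂ (Fin (k + 1))}
    (hw : w ∈ Metric.ball (0 : EuclideanSpace ℂ (Fin (k + 1))) 1) :
    0 < (ballSiegel w).re - ∑ i : Fin k, Complex.normSq (w i.succ / (1 - w 0)) := by
  rw [height_ball hw]
  have := Complex.normSq_pos.2 (one_sub_apply_zero_ne_zero hw)
  rw [mem_ball_zero_iff] at hw
  have : ‖w‖ ^ 2 < 1 := by nlinarith [norm_nonneg w]
  exact div_pos (by linarith) (by assumption)

theorem ofBall_toBall (x : ℝ × ℝ × (Fin k → ℂ)) : ofBall (toBall x) = x := by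
  have ht := siegelCoord_add_one_ne_zero x
  have h0 : (toBall x) 0 = (siegelCoord x - 1) / (siegelCoord x + 1) := rfl
  have hi : ∀ i : Fin k, (toBall x) i.succ = 2 * x.2.2 i / (siegelCoord x + 1) := fun i => rfl
  have h1 : 1 - (toBall x) 0 = 2 / (siegelCoord x + 1) := by
    rw [h0]
    field_simp
    ring
  have hS : ballSiegel (toBall x) = siegelCoord x := by
    rw [ballSiegel, h1, h0]
    field_simp
    ring
  have hζ : ∀ i : Fin k, (toBall x) i.succ / (1 - (toBall x) 0) = x.2.2 i := by
    intro i
    rw [h1, hi]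
    field_simp
  refine Prod.ext ?_ (Prod.ext ?_ (funext fun i => hζ i))
  · simp only [ofBall, hS, hζ, siegelCoord_re, add_sub_cancel_right, Real.log_exp]
    ring
  · simp only [ofBall, hS, siegelCoord_im, neg_neg]

theorem toBall_ofBall {w : EuclideanSpace ℂ (Fin (k + 1))}
    (hw : w ∈ Metric.ball (0 : EuclideanSpace ℂ (Fin (k + 1))) 1) : toBall (ofBall w) = w := by
  have hn := one_sub_apply_zero_ne_zero hw
  have hS : siegelCoord (ofBall w) = ballSiegel w := by
    have hexp : Real.exp (-2 * (ofBall w).1)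
        = (ballSiegel w).re - ∑ i : Fin k, Complex.normSq (w i.succ / (1 - w 0)) := by
      rw [← Real.exp_log (height_ball_pos hw)]
      congr 1
      simp only [ofBall]
      ring
    refine Complex.ext ?_ ?_
    · rw [siegelCoord_re, hexp]
      simp only [ofBall, sub_add_cancel]
    · rw [siegelCoord_im]
      simp only [ofBall, neg_neg]
  have hS1 : siegelCoord (ofBall w) + 1 = 2 / (1 - w 0) := by
    rw [hS, ballSiegel]
    field_simp
    ring
  ext i
  refine Fin.cases ?_ (fun j => ?_) i
  · change (siegelCoord (ofBall w) - 1) / (siegelCoord (ofBall w) + 1) = w 0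
    rw [hS1, hS, ballSiegel]
    field_simp
    ring
  · change 2 * (w j.succ / (1 - w 0)) / (siegelCoord (ofBall w) + 1) = w j.succ
    rw [hS1]
    field_simp

theorem contDiff_siegelCoord : ContDiff ℝ ∞ (siegelCoord (k := k)) := by
  have h : ∀ i, ContDiff ℝ ∞ fun x : ℝ × ℝ × (Fin k → ℂ) => Complex.normSq (x.2.2 i) := by
    intro i
    simp only [Complex.normSq_apply]
    have hre := Complex.reCLM.contDiff (n := ∞)
    have him := Complex.imCLM.contDiff (n := ∞)
    have hx : ContDiff ℝ ∞ fun x : ℝ × ℝ × (Fin k → ℂ) => x.2.2 i := by fun_prop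
    exact ((hre.comp hx).mul (hre.comp hx)).add ((him.comp hx).mul (him.comp hx))
  have hr := Complex.ofRealCLM.contDiff (n := ∞)
  exact (hr.comp ((contDiff_const.mul contDiff_fst).exp.add (ContDiff.sum fun i _ => h i))).sub
    (contDiff_const.mul (hr.comp (by fun_prop)))

theorem contDiff_toBall : ContDiff ℝ ∞ (toBall (k := k)) := by
  refine PiLp.contDiff_toLp.comp (contDiff_pi.2 fun i => ?_)
  have hS := contDiff_siegelCoord (k := k)
  have h1 := hS.add (contDiff_const (c := (1 : ℂ)))
  refine Fin.cases ?_ (fun j => ?_) i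
  · have := (hS.sub (contDiff_const (c := (1 : ℂ)))).mul (h1.inv siegelCoord_add_one_ne_zero)
    exact contDiffOn_univ.1 (this.contDiffOn.congr fun _ _ => div_eq_mul_inv _ _)
  · have h2 : ContDiff ℝ ∞ fun x : ℝ × ℝ × (Fin k → ℂ) => 2 * x.2.2 j := by fun_prop
    have := h2.mul (h1.inv siegelCoord_add_one_ne_zero)
    exact contDiffOn_univ.1 (this.contDiffOn.congr fun _ _ => div_eq_mul_inv _ _)

theorem contDiffOn_ofBall : ContDiffOn ℝ ∞ (ofBall (k := k))
    (Metric.ball (0 : EuclideanSpace ℂ (Fin (k + 1))) 1) := by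
  have hre := Complex.reCLM.contDiff (n := ∞)
  have him := Complex.imCLM.contDiff (n := ∞)
  have hw : ∀ i, ContDiff ℝ ∞ fun w : EuclideanSpace ℂ (Fin (k + 1)) => w i := fun i =>
    (contDiff_pi.1 (PiLp.contDiff_ofLp (𝕜 := ℝ)) i)
  have hd : ContDiff ℝ ∞ fun w : EuclideanSpace ℂ (Fin (k + 1)) => 1 - w 0 :=
    contDiff_const.sub (hw 0)
  have hS : ContDiffOn ℝ ∞ (ballSiegel (k := k))
      (Metric.ball (0 : EuclideanSpace ℂ (Fin (k + 1))) 1) := by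
    have := (contDiff_const (c := (1 : ℂ)).add (hw 0)).contDiffOn.mul
      (hd.contDiffOn.inv fun w hw => one_sub_apply_zero_ne_zero hw)
    exact this.congr fun _ _ => div_eq_mul_inv _ _
  have hζ : ∀ i : Fin k, ContDiffOn ℝ ∞
      (fun w : EuclideanSpace ℂ (Fin (k + 1)) => w i.succ / (1 - w 0))
      (Metric.ball (0 : EuclideanSpace ℂ (Fin (k + 1))) 1) := fun i => by
    have := (hw i.succ).contDiffOn.mul
      (hd.contDiffOn.inv fun w hw => one_sub_apply_zero_ne_zero hw)
    exact this.congr fun _ _ => div_eq_mul_inv _ _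
  have hn : ∀ i : Fin k, ContDiffOn ℝ ∞
      (fun w : EuclideanSpace ℂ (Fin (k + 1)) => Complex.normSq (w i.succ / (1 - w 0)))
      (Metric.ball (0 : EuclideanSpace ℂ (Fin (k + 1))) 1) := fun i => by
    simp only [Complex.normSq_apply]
    exact ((hre.comp_contDiffOn (hζ i)).mul (hre.comp_contDiffOn (hζ i))).add
      ((him.comp_contDiffOn (hζ i)).mul (him.comp_contDiffOn (hζ i)))
  refine ContDiffOn.prodMk ?_ (ContDiffOn.prodMk (him.comp_contDiffOn hS).neg
    (contDiffOn_pi.2 hζ))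
  exact (ContDiffOn.log ((hre.comp_contDiffOn hS).sub (ContDiffOn.sum fun i _ => hn i))
    fun w hw => (height_ball_pos hw).ne').neg.div_const 2

/-- The Cayley transform as a homeomorphism onto the unit ball. -/
noncomputable def cayley (k : ℕ) :
    OpenPartialHomeomorph (ℝ × ℝ × (Fin k → ℂ)) (EuclideanSpace ℂ (Fin (k + 1))) where
  toFun := toBall
  invFun := ofBall
  source := Set.univ
  target := Metric.ball 0 1
  map_source' x _ := toBall_mem_ball x
  map_target' _ _ := trivial
  left_inv' x _ := ofBall_toBall x
  right_inv' _ hw := toBall_ofBall hw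
  open_source := isOpen_univ
  open_target := Metric.isOpen_ball
  continuousOn_toFun := contDiff_toBall.continuous.continuousOn
  continuousOn_invFun := contDiffOn_ofBall.continuousOn

theorem hasDerivAt_siegelCoord (x X : ℝ × ℝ × (Fin k → ℂ)) :
    HasDerivAt (fun t : ℝ => siegelCoord (x + t • X)) (siegelDeriv x X) 0 := by
  have hline : HasDerivAt (fun t : ℝ => x + t • X) X 0 := by
    simpa using ((hasDerivAt_id (0 : ℝ)).smul_const X).const_add x
  have h1 : HasDerivAt (fun t : ℝ => (x + t • X).1) X.1 0 := hline.fst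
  have h2 : HasDerivAt (fun t : ℝ => (x + t • X).2.1) X.2.1 0 := hline.snd.fst
  have h3 : ∀ i, HasDerivAt (fun t : ℝ => (x + t • X).2.2 i) (X.2.2 i) 0 :=
    hasDerivAt_pi.1 hline.snd.snd
  have h4 : ∀ i, HasDerivAt (fun t : ℝ => conj ((x + t • X).2.2 i)) (conj (X.2.2 i)) 0 :=
    fun i => Complex.conjCLE.toContinuousLinearMap.hasFDerivAt.comp_hasDerivAt (0 : ℝ) (h3 i)
  have h5 := (((h1.const_mul (-2)).exp.ofReal_comp).add
    (HasDerivAt.fun_sum fun i (_ : i ∈ Finset.univ) => (h4 i).fun_mul (h3 i))).sub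
      (h2.ofReal_comp.const_mul Complex.I)
  refine (h5.congr_deriv ?_).congr_of_eventuallyEq (Filter.Eventually.of_forall fun t => ?_)
  · rw [siegelDeriv, zero_smul, add_zero]
    congr 2
    · push_cast
      ring
    · exact Finset.sum_congr rfl fun i _ => by ring
  · simp only [siegelCoord, Complex.ofReal_add, Complex.ofReal_sum, Complex.normSq_eq_conj_mul_self]
    rfl

theorem fderiv_toBall (x X : ℝ × ℝ × (Fin k → ℂ)) :
    fderiv ℝ toBall x X = WithLp.toLp 2 (Fin.cons (2 * siegelDeriv x X / (siegelCoord x + 1) ^ 2)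
      fun i => 2 * X.2.2 i / (siegelCoord x + 1)
        - 2 * x.2.2 i * siegelDeriv x X / (siegelCoord x + 1) ^ 2) := by
  have hline : HasDerivAt (fun t : ℝ => x + t • X) X 0 := by
    simpa using ((hasDerivAt_id (0 : ℝ)).smul_const X).const_add x
  have h3 : ∀ i, HasDerivAt (fun t : ℝ => (x + t • X).2.2 i) (X.2.2 i) 0 :=
    hasDerivAt_pi.1 hline.snd.snd
  have hS := hasDerivAt_siegelCoord x X
  have hd : HasFDerivAt toBall (fderiv ℝ toBall x) (x + (0 : ℝ) • X) := by
    rw [zero_smul, add_zero]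
    exact (contDiff_toBall.differentiable (by simp) x).hasFDerivAt
  have h1 := hd.comp_hasDerivAt (0 : ℝ) hline
  have hofLp := (PiLp.continuousLinearEquiv 2 ℝ (fun _ : Fin (k + 1) => ℂ))
    |>.toContinuousLinearMap.hasFDerivAt.comp_hasDerivAt (0 : ℝ) h1
  have h2 := hasDerivAt_pi.1 hofLp
  have ht := siegelCoord_add_one_ne_zero (x + (0 : ℝ) • X)
  have hx : x + (0 : ℝ) • X = x := by rw [zero_smul, add_zero]
  ext i
  refine (h2 i).unique ?_
  refine Fin.cases ?_ (fun j => ?_) i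
  · refine ((hS.sub_const 1).fun_div (hS.add_const 1) ht).congr_deriv ?_
    rw [hx] at ht ⊢
    simp only [Fin.cons_zero]
    field_simp
    ring
  · refine (((h3 j).const_mul 2).fun_div (hS.add_const 1) ht).congr_deriv ?_
    rw [hx] at ht ⊢
    simp only [Fin.cons_succ]
    field_simp

/-- Subtracting conj ζ · dζ removes the ζ-part of the real differential and completes dφ̃ to the
contact form. In the application to the fibres this is e^{-2φ} v. -/
theorem half_siegelDeriv_sub (x X : ℝ × ℝ × (Fin k → ℂ)) :
    siegelDeriv x X / 2 - ∑ i, conj (x.2.2 i) * X.2.2 i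
      = ((-(Real.exp (-2 * x.1) * X.1) : ℝ) : ℂ) + ((-(contactForm x X / 2) : ℝ) : ℂ) * Complex.I := by
  have h : ∑ i, conj (x.2.2 i) * X.2.2 i = conj (∑ i, x.2.2 i * conj (X.2.2 i)) := by
    simp only [map_sum, map_mul, Complex.conj_conj]
  rw [siegelDeriv, Finset.sum_add_distrib, contactForm, h]
  set s := ∑ i, x.2.2 i * conj (X.2.2 i)
  have h1 : conj s = s - 2 * s.im * Complex.I := by
    refine Complex.ext ?_ ?_ <;> simp
    ring
  rw [h1]
  push_cast
  ring

theorem sum_affine_mul_conj (ζ X Y : Fin k → ℂ) (a b c d : ℂ) :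
    ∑ i, (a * Y i - b * ζ i) * conj (c * X i - d * ζ i)
      = a * conj c * ∑ i, Y i * conj (X i) - a * conj d * ∑ i, conj (ζ i) * Y i
        - b * conj c * ∑ i, ζ i * conj (X i) + b * conj d * ∑ i, ζ i * conj (ζ i) := by
  simp only [Finset.mul_sum, ← Finset.sum_sub_distrib, ← Finset.sum_add_distrib]
  refine Finset.sum_congr rfl fun i _ => ?_
  simp only [map_sub, map_mul]
  ring

theorem inner_fderiv_toBall (x X Y : ℝ × ℝ × (Fin k → ℂ)) :
    inner ℂ (fderiv ℝ toBall x X) (fderiv ℝ toBall x Y)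
      = 2 * siegelDeriv x Y / (siegelCoord x + 1) ^ 2
          * (2 * conj (siegelDeriv x X) / conj (siegelCoord x + 1) ^ 2)
        + (2 / (siegelCoord x + 1) * (2 / conj (siegelCoord x + 1))
            * (∑ i, Y.2.2 i * conj (X.2.2 i))
          - 2 / (siegelCoord x + 1) * (2 * conj (siegelDeriv x X) / conj (siegelCoord x + 1) ^ 2)
            * (∑ i, conj (x.2.2 i) * Y.2.2 i)
          - 2 * siegelDeriv x Y / (siegelCoord x + 1) ^ 2 * (2 / conj (siegelCoord x + 1))
            * (∑ i, x.2.2 i * conj (X.2.2 i))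
          + 2 * siegelDeriv x Y / (siegelCoord x + 1) ^ 2
            * (2 * conj (siegelDeriv x X) / conj (siegelCoord x + 1) ^ 2)
            * (∑ i, x.2.2 i * conj (x.2.2 i))) := by
  have h := sum_affine_mul_conj x.2.2 X.2.2 Y.2.2 (2 / (siegelCoord x + 1))
    (2 * siegelDeriv x Y / (siegelCoord x + 1) ^ 2) (2 / (siegelCoord x + 1))
    (2 * siegelDeriv x X / (siegelCoord x + 1) ^ 2)
  have h2 : ∀ Y : ℝ × ℝ × (Fin k → ℂ), ∀ i, 2 * Y.2.2 i / (siegelCoord x + 1)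
      - 2 * x.2.2 i * siegelDeriv x Y / (siegelCoord x + 1) ^ 2
      = 2 / (siegelCoord x + 1) * Y.2.2 i
        - 2 * siegelDeriv x Y / (siegelCoord x + 1) ^ 2 * x.2.2 i := fun Y i => by ring
  rw [PiLp.inner_apply, Fin.sum_univ_succ, fderiv_toBall, fderiv_toBall]
  simp only [RCLike.inner_apply, Fin.cons_zero, Fin.cons_succ, h2]
  rw [h]
  simp only [map_div₀, map_mul, map_pow, map_ofNat]

theorem inner_toBall_fderiv (x Y : ℝ × ℝ × (Fin k → ℂ)) :
    inner ℂ (toBall x) (fderiv ℝ toBall x Y)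
      = 2 * siegelDeriv x Y / (siegelCoord x + 1) ^ 2
          * ((conj (siegelCoord x + 1) - 2) / conj (siegelCoord x + 1))
        + 2 / conj (siegelCoord x + 1) * (2 / (siegelCoord x + 1)
            * (∑ i, conj (x.2.2 i) * Y.2.2 i)
          - 2 * siegelDeriv x Y / (siegelCoord x + 1) ^ 2 * (∑ i, x.2.2 i * conj (x.2.2 i))) := by
  have h1 : conj (siegelCoord x + 1) - 2 = conj (siegelCoord x - 1) := by
    simp only [map_add, map_sub, map_one]
    ring
  rw [PiLp.inner_apply, Fin.sum_univ_succ, fderiv_toBall, h1]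
  simp only [RCLike.inner_apply, toBall, Fin.cons_zero, Fin.cons_succ, map_div₀, map_mul,
    map_ofNat]
  congr 1
  simp only [Finset.mul_sum, ← Finset.sum_sub_distrib]
  exact Finset.sum_congr rfl fun i _ => by ring

/-- With r = e^{-2φ} the ball metric pulls back to |dS/2 - conj ζ · dζ|²/r² + |dζ|²/r. Real and
imaginary parts of the first term give the dφ² and contact terms. -/
theorem complexHyperbolicMetric_toBall (x X Y : ℝ × ℝ × (Fin k → ℂ)) :
    complexHyperbolicMetric (k + 1) (toBall x) (fderiv ℝ toBall x X) (fderiv ℝ toBall x Y)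
      = horosphericalMetric x X Y := by
  have hE : Real.exp (2 * x.1) * Real.exp (-2 * x.1) = 1 := by
    rw [← Real.exp_add]
    simp
  have hr0 : (Real.exp (-2 * x.1) : ℂ) ≠ 0 := Complex.ofReal_ne_zero.2 (Real.exp_ne_zero _)
  have ht := siegelCoord_add_one_ne_zero x
  have htb : conj (siegelCoord x + 1) ≠ 0 := (map_ne_zero _).2 ht
  have hn0 : ∑ i, x.2.2 i * conj (x.2.2 i) = ((siegelCoord x + 1) + conj (siegelCoord x + 1)) / 2
      - 1 - (Real.exp (-2 * x.1) : ℂ) := by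
    have h1 : siegelCoord x + 1 + conj (siegelCoord x + 1)
        = ((2 * (siegelCoord x).re + 2 : ℝ) : ℂ) := by
      rw [Complex.add_conj]
      simp
      ring
    have h2 : ∑ i, x.2.2 i * conj (x.2.2 i) = ((∑ i, Complex.normSq (x.2.2 i) : ℝ) : ℂ) := by
      simp only [Complex.mul_conj, Complex.ofReal_sum]
    rw [h1, h2, siegelCoord_re]
    push_cast
    ring
  have hnorm : ((1 - ‖toBall x‖ ^ 2 : ℝ) : ℂ)
      = 4 * (Real.exp (-2 * x.1) : ℂ) / ((siegelCoord x + 1) * conj (siegelCoord x + 1)) := by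
    rw [one_sub_norm_sq_toBall, Complex.mul_conj]
    push_cast
    rfl
  have hsym : inner ℂ (fderiv ℝ toBall x X) (toBall x)
      = conj (inner ℂ (toBall x) (fderiv ℝ toBall x X)) := (inner_conj_symm _ _).symm
  have hc : conj (∑ i, conj (x.2.2 i) * X.2.2 i) = ∑ i, x.2.2 i * conj (X.2.2 i) := by
    simp only [map_sum, map_mul, Complex.conj_conj]
  have hcn : conj (∑ i, x.2.2 i * conj (x.2.2 i)) = ∑ i, x.2.2 i * conj (x.2.2 i) := by
    simp only [map_sum, map_mul, Complex.conj_conj]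
    exact Finset.sum_congr rfl fun i _ => mul_comm _ _
  have key : inner ℂ (fderiv ℝ toBall x X) (fderiv ℝ toBall x Y) / ((1 - ‖toBall x‖ ^ 2 : ℝ) : ℂ)
      + inner ℂ (fderiv ℝ toBall x X) (toBall x) * inner ℂ (toBall x) (fderiv ℝ toBall x Y)
        / ((1 - ‖toBall x‖ ^ 2 : ℝ) : ℂ) ^ 2
      = conj (siegelDeriv x X / 2 - ∑ i, conj (x.2.2 i) * X.2.2 i)
          * (siegelDeriv x Y / 2 - ∑ i, conj (x.2.2 i) * Y.2.2 i) / (Real.exp (-2 * x.1) : ℂ) ^ 2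
        + (∑ i, Y.2.2 i * conj (X.2.2 i)) / (Real.exp (-2 * x.1) : ℂ) := by
    rw [hsym, inner_toBall_fderiv, inner_toBall_fderiv, inner_fderiv_toBall, hnorm]
    simp only [map_add, map_sub, map_mul, map_div₀, map_pow, map_ofNat, Complex.conj_conj, map_one,
      hc, hcn] at hn0 htb ⊢
    rw [hn0]
    generalize (∑ i, x.2.2 i * conj (X.2.2 i)) = cX
    generalize (∑ i, conj (x.2.2 i) * Y.2.2 i) = cY
    generalize (∑ i, Y.2.2 i * conj (X.2.2 i)) = q
    generalize (Real.exp (-2 * x.1) : ℂ) = r at *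
    generalize conj (siegelDeriv x X) = PX
    generalize siegelDeriv x Y = PY
    generalize conj (siegelCoord x) = s at *
    generalize siegelCoord x = S at *
    -- With S + 1 and its conjugate as independent variables all denominators are monomials. The
    -- relation for |ζ|² has been substituted already, so a rational identity remains.
    obtain ⟨t, rfl⟩ : ∃ t, S = t - 1 := ⟨S + 1, by ring⟩
    obtain ⟨t', rfl⟩ : ∃ t, s = t - 1 := ⟨s + 1, by ring⟩
    simp only [sub_add_cancel] at *
    field_simp
    ring
  rw [complexHyperbolicMetric, key, half_siegelDeriv_sub, half_siegelDeriv_sub, horosphericalMetric]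
  have hE2 : (Real.exp (-2 * x.1))⁻¹ = Real.exp (2 * x.1) := by
    rw [← Real.exp_neg]
    congr 1
    ring
  have hq : (∑ i, Y.2.2 i * conj (X.2.2 i)).re = (∑ i, X.2.2 i * conj (Y.2.2 i)).re := by
    rw [← Complex.conj_re]
    simp only [map_sum, map_mul, Complex.conj_conj]
    exact congrArg Complex.re (Finset.sum_congr rfl fun i _ => mul_comm _ _)
  simp only [div_eq_mul_inv _ (Complex.ofReal _), div_eq_mul_inv _ (Complex.ofReal _ ^ 2)]
  rw [← inv_pow, ← Complex.ofReal_inv, hE2, Complex.add_re, ← Complex.ofReal_pow, Complex.re_mul_ofReal, Complex.re_mul_ofReal, hq]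
  have hA : ∀ a b c d : ℝ, (conj ((a : ℂ) + (b : ℂ) * Complex.I)
      * ((c : ℂ) + (d : ℂ) * Complex.I)).re = a * c + b * d := fun a b c d => by
    simp
  rw [hA]
  linear_combination (X.1 * Y.1 * (Real.exp (2 * x.1) * Real.exp (-2 * x.1) + 1)) * hE

end Horospherical

/-! ### The fibres are complex hyperbolic spaces -/

namespace ProjectiveSpecialKahlerDomain

variable {m : ℕ} {D : ProjectiveSpecialKahlerDomain m}
  {e : (Fin m → ℂ) → Matrix (Fin m) (Fin m) ℂ}

/-- On a fibre the prefactor e^φ is the only dependence of u on the point, and likewise for E; hence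
the constant linear coordinate ζ. -/
theorem formU_vertical (z : Fin m → ℂ) (y X : FibreSpace m) :
    D.formU (z, y) (0, X)
      = (Real.exp y.1 : ℂ) * D.formU (z, 0) (0, (0, 0, X.2.2)) := by
  simp only [formU_eq, Prod.fst_zero, add_zero, Real.exp_add, Complex.ofReal_mul]
  ring

theorem formE_vertical (β : Fin m) (z : Fin m → ℂ) (y X : FibreSpace m) :
    D.formE e β (z, y) (0, X)
      = (Real.exp y.1 : ℂ) * D.formE e β (z, 0) (0, (0, 0, X.2.2)) := by
  simp only [formE_eq, Prod.fst_zero, sub_eq_add_neg, Real.exp_add, Real.exp_zero, Complex.ofReal_mul,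
    Complex.ofReal_one]
  ring

variable (D e) in
/-- The components `(u, E^b)` at `φ = 0` as a linear map of the coordinates `(a, b)`. -/
noncomputable def heisenbergLinear (z : Fin m → ℂ) :
    ((Fin (m + 1) → ℝ) × (Fin (m + 1) → ℝ)) →ₗ[ℝ] (Fin (m + 1) → ℂ) where
  toFun c := Fin.cons (D.formU (z, 0) (0, (0, 0, c))) fun β => D.formE e β (z, 0) (0, (0, 0, c))
  map_add' c c' := by
    have h : ((0, (0, 0, c + c')) : TotalSpace m) = (0, (0, 0, c)) + (0, (0, 0, c')) := by simp
    ext i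
    refine Fin.cases ?_ (fun β => ?_) i
    · simp only [Fin.cons_zero, Pi.add_apply, h, formU_add]
    · simp only [Fin.cons_succ, Pi.add_apply, h, formE_add]
  map_smul' r c := by
    have h : ((0, (0, 0, r • c)) : TotalSpace m) = r • (0, (0, 0, c)) := by simp
    ext i
    refine Fin.cases ?_ (fun β => ?_) i
    · simp only [Fin.cons_zero, Pi.smul_apply, h, formU_smul, Complex.real_smul, RingHom.id_apply]
    · simp only [Fin.cons_succ, Pi.smul_apply, h, formE_smul, Complex.real_smul, RingHom.id_apply]

theorem sum_heisenbergLinear (z : Fin m → ℂ) (c c' : (Fin (m + 1) → ℝ) × (Fin (m + 1) → ℝ)) :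
    ∑ i, heisenbergLinear D e z c i * conj (heisenbergLinear D e z c' i)
      = D.formU (z, 0) (0, (0, 0, c)) * conj (D.formU (z, 0) (0, (0, 0, c')))
        + ∑ β, D.formE e β (z, 0) (0, (0, 0, c)) * conj (D.formE e β (z, 0) (0, (0, 0, c'))) := by
  rw [Fin.sum_univ_succ]
  rfl

variable (he : D.IsVielbein e) {z : Fin m → ℂ} (hz : z ∈ D.base)
include he hz

theorem heisenbergLinear_injective : Function.Injective (heisenbergLinear D e z) := by
  rw [← LinearMap.ker_eq_bot, LinearMap.ker_eq_bot']
  intro c hc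
  have h := eq_zero_of_formU_formE he (p := ((z, 0) : TotalSpace m)) (X := (0, (0, 0, c))) hz
    (congrFun hc 0) fun β => congrFun hc β.succ
  obtain ⟨h1, h2⟩ := fibreVec_eq_zero he hz h
  exact Prod.ext h1 h2

/-- The horospherical coordinates of the fibre over `z`. -/
noncomputable def horosphericalEquiv : FibreSpace m ≃L[ℝ] ℝ × ℝ × (Fin (m + 1) → ℂ) :=
  (ContinuousLinearEquiv.refl ℝ ℝ).prodCongr ((ContinuousLinearEquiv.refl ℝ ℝ).prodCongr
    (LinearEquiv.ofInjectiveOfFinrankEq (heisenbergLinear D e z) (heisenbergLinear_injective he hz)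
      (by
        rw [Module.finrank_prod, Module.finrank_pi_fintype ℝ (M := fun _ : Fin (m + 1) => ℂ)]
        simp [Complex.finrank_real_complex, mul_two])).toContinuousLinearEquiv)

theorem horosphericalEquiv_apply (y : FibreSpace m) :
    horosphericalEquiv he hz y = (y.1, y.2.1, heisenbergLinear D e z y.2.2) := rfl

/-- By `im_formU_add_sum_formE` at φ = 0, 2 Im(ζ · conj dζ) is minus the symplectic term of v. -/
theorem contactForm_horosphericalEquiv (y X : FibreSpace m) :
    contactForm (horosphericalEquiv he hz y) (horosphericalEquiv he hz X)
      = X.2.1 + ∑ A, (y.2.2.2 A * X.2.2.1 A - y.2.2.1 A * X.2.2.2 A) := by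
  have h := im_formU_add_sum_formE he hz ((z, 0) : TotalSpace m) (0, (0, 0, y.2.2))
    (0, (0, 0, X.2.2)) rfl
  rw [contactForm]
  simp only [horosphericalEquiv_apply]
  rw [sum_heisenbergLinear, h]
  simp
  ring

/-- The forms e vanish on the fibre, v supplies dφ² and the square of the contact form, and u, E
supply e^{2φ} |dζ|². -/
theorem fibreMetric_eq_horosphericalMetric (y X Y : FibreSpace m) :
    D.fibreMetric e z y X Y = horosphericalMetric (horosphericalEquiv he hz y)
      (horosphericalEquiv he hz X) (horosphericalEquiv he hz Y) := by
  have hB : ∀ β X, formBase e β ((z, y) : TotalSpace m) (0, X) = 0 := fun β X => by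
    simp [formBase]
  have hV : ∀ X, formV ((z, y) : TotalSpace m) (0, X) = ((-X.1 : ℝ) : ℂ)
      + ((-(Real.exp (2 * y.1) / 2 * contactForm (horosphericalEquiv he hz y)
        (horosphericalEquiv he hz X)) : ℝ) : ℂ) * Complex.I := fun X => by
    rw [formV_eq, contactForm_horosphericalEquiv]
    push_cast
    ring
  have hA : ∀ a b c d : ℝ, (((a : ℂ) + (b : ℂ) * Complex.I)
      * conj ((c : ℂ) + (d : ℂ) * Complex.I)).re = a * c + b * d := fun a b c d => by
    simp
  have hs : ∀ c w w' : ℂ, (c * w) * conj (c * w') = c * conj c * (w * conj w') := fun c w w' => by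
    rw [map_mul]
    ring
  have he2 : (Real.exp y.1 : ℂ) * conj (Real.exp y.1 : ℂ) = (Real.exp (2 * y.1) : ℂ) := by
    rw [Complex.conj_ofReal, ← Complex.ofReal_mul, ← Real.exp_add, two_mul]
  rw [fibreMetric, metric, Fin.sum_univ_succ]
  simp only [formsUe, formsVE, Fin.cons_zero, Fin.cons_succ, hB, zero_mul, Complex.zero_re,
    zero_add, formU_vertical z y, formE_vertical _ z y, hs, he2, Complex.re_ofReal_mul]
  rw [hV, hV, hA, horosphericalMetric]
  simp only [horosphericalEquiv_apply he hz X, horosphericalEquiv_apply he hz Y,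
    horosphericalEquiv_apply he hz y, sum_heisenbergLinear, Complex.add_re, Complex.re_sum,
    mul_add, Finset.mul_sum]
  ring

theorem areIsometric_fibre :
    AreIsometric Set.univ (D.fibreMetric e z)
      (Metric.ball (0 : EuclideanSpace ℂ (Fin (m + 2))) 1) (complexHyperbolicMetric (m + 2)) := by
  refine ⟨(horosphericalEquiv he hz).toHomeomorph.transOpenPartialHomeomorph (cayley (m + 1)),
    rfl, rfl, ?_, ?_, fun y _ X Y => ?_⟩
  · exact (contDiff_toBall.comp (horosphericalEquiv he hz).contDiff).contDiffOn
  · exact (horosphericalEquiv he hz).symm.contDiff.comp_contDiffOn contDiffOn_ofBall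
  · have hd : HasFDerivAt (toBall ∘ horosphericalEquiv he hz)
        ((fderiv ℝ toBall (horosphericalEquiv he hz y)).comp
          (horosphericalEquiv he hz).toContinuousLinearMap) y :=
      (contDiff_toBall.differentiable (by simp) _).hasFDerivAt.comp y
        (horosphericalEquiv he hz).hasFDerivAt
    have h := complexHyperbolicMetric_toBall (horosphericalEquiv he hz y)
      (horosphericalEquiv he hz X) (horosphericalEquiv he hz Y)
    rw [← fibreMetric_eq_horosphericalMetric] at h
    rw [← h]
    change complexHyperbolicMetric (m + 2) (toBall (horosphericalEquiv he hz y))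
      (fderiv ℝ (toBall ∘ horosphericalEquiv he hz) y X)
      (fderiv ℝ (toBall ∘ horosphericalEquiv he hz) y Y) = _
    rw [hd.fderiv]
    rfl

end ProjectiveSpecialKahlerDomain

/-! ### The theorem, with n = m + 1 and J_3 at index 2 -/

theorem mainTheorem3 (m : ℕ) (D : ProjectiveSpecialKahlerDomain m)
    (e : (Fin m → ℂ) → Matrix (Fin m) (Fin m) ℂ) (he : D.IsVielbein e) :
    ∃ J : Fin 3 → TotalSpace m → TotalSpace m →L[ℝ] TotalSpace m,
      -- the triple defined by the quaternionic vielbein exists and is unique on `M`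
      D.IsQuaternionicFrame e J ∧
      (∀ J' : Fin 3 → TotalSpace m → TotalSpace m →L[ℝ] TotalSpace m,
        D.IsQuaternionicFrame e J' → ∀ α, Set.EqOn (J' α) (J α) D.total) ∧
      -- `J_3` is integrable, and Hermitian with respect to `g`
      IsIntegrableComplex D.total (J 2) ∧
      IsHermitianStructure D.total (D.metric e) (J 2) ∧
      -- both factors are complex submanifolds
      (∀ y : FibreSpace m, IsComplexSubmanifold D.total (J 2) (D.base ×ˢ {y})) ∧
      (∀ z ∈ D.base, IsComplexSubmanifold D.total (J 2) ({z} ×ˢ Set.univ)) ∧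
      -- `J_3` restricts to the original complex structure of the first factor
      (∀ z ∈ D.base, ∀ (y : FibreSpace m) (X : Fin m → ℂ),
        J 2 (z, y) (X, 0) = (Complex.I • X, 0)) ∧
      ∀ z ∈ D.base,
        -- `J_3` restricts to the fibre, where it is Hermitian but not Kähler
        (∀ y X : FibreSpace m, J 2 (z, y) (0, X) =
          (0, ProjectiveSpecialKahlerDomain.fibreEndomorphism (J 2) z y X)) ∧
        IsHermitianStructure Set.univ (D.fibreMetric e z)
          (ProjectiveSpecialKahlerDomain.fibreEndomorphism (J 2) z) ∧
        ¬ IsKahlerStructure Set.univ (D.fibreMetric e z)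
          (ProjectiveSpecialKahlerDomain.fibreEndomorphism (J 2) z) ∧
        -- the fibre is isometric to complex hyperbolic space of dimension `n + 1 = m + 2`
        AreIsometric Set.univ (D.fibreMetric e z)
          (Metric.ball (0 : EuclideanSpace ℂ (Fin (m + 2))) 1)
          (complexHyperbolicMetric (m + 2)) :=
  open ProjectiveSpecialKahlerDomain in
  ⟨D.cMapStructure e, isQuaternionicFrame_cMapStructure he,
    fun _ h α => IsQuaternionicFrame.eqOn he (isQuaternionicFrame_cMapStructure he) h α,
    isIntegrableComplex_cMapStructure_two he, isHermitianStructure_cMapStructure_two he,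
    isComplexSubmanifold_base he, fun _ hz => isComplexSubmanifold_fibre he hz,
    fun _ hz y X => cMapStructure_two_horizontal he hz y X,
    fun _ hz => ⟨cMapStructure_two_vertical he hz, isHermitianStructure_fibre he hz,
      not_isKahlerStructure_fibre he hz, areIsometric_fibre he hz⟩⟩
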